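/- Let $G=K^{\mathbb C}$ be a connected complex reductive group with maximal compact subgroup $K$, realized as a closed complex subgroup of some $GL_n(\mathbb C)$ with $K=G\cap U(n)$ and $G=K\exp\mathfrak p$, where $\mathfrak g$ is the Lie algebra of $G$ and $\mathfrak p=i\mathfrak k\subset\mathfrak g$ is the real space of hermitian elements of $\mathfrak g$. Let $W$ be a finite dimensional irreducible holomorphic representation of $G$, not the trivial one, with a hermitian inner product for which $K$ acts unitarily. Fix a $K$-invariant inner product $\langle\,,\rangle$ on $\mathfrak p$ and a momentum map $\mu\colon\mathbb P(W)\to\mathfrak p$, i.e. a $K$-equivariant map such that for every $\alpha\in\mathfrak p$ the gradient of $\mu^\alpha=\langle\mu,\alpha\rangle$, with respect to a fixed positive multiple of the Fubini–Study metric, is the vector field of the flow $x\mapsto\exp(t\alpha)\cdot x$. Let $\beta$ be an extreme point of the convex hull of $\mu(\mathbb P(W))$, let $\beta_0$ be the largest eigenvalue of $\beta$ on $W$, $W_{\beta_0}$ its eigenspace, and $0\ne w_0\in W_{\beta_0}$. Put $$R^{\beta_-}=\{g\in G:\ \lim_{t\to+\infty}\exp(t\beta)\,g\,\exp(-t\beta)=e\}.$$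 For a linear subspace $U\subset W$ write $\mathbb P(U)\subset\mathbb P(W)$ for the set of lines contained in $U$, and $U^\perp$ for the orthogonal complement in $W$. Then $W_{\beta_0}=\mathbb C w_0$, the point $[w_0]$ is the only point of $\mathbb P(W)$ at which $\mu^\beta$ is maximal, and the action $(r,x)\mapsto r\cdot x$ restricts to an isomorphism $$\Phi\colon R^{\beta_-}\times\bigl(\mathbb P(W_{\beta_0}\oplus(\mathfrak g\cdot w_0)^{\perp})\setminus\mathbb P((\mathfrak g\cdot w_0)^{\perp})\bigr)\longrightarrow\mathbb P(W)\setminus\mathbb P((W_{\beta_0})^{\perp}),$$ that is, $\Phi$ is bijective, and $\Phi$ and $\Phi^{-1}$ are morphisms of algebraic varieties and, in particular, holomorphic. -/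

import Mathlib

open scoped Matrix InnerProductSpace LinearAlgebra.Projectivization Topology

noncomputable section

namespace LocalStructure

/-! ### Connected complex reductive groups -/

section Group

variable {n : Type*} [Fintype n] [DecidableEq n]

/-- The matrix exponential, as an invertible matrix. -/
def expGL (X : Matrix n n ℂ) : Matrix.GeneralLinearGroup n ℂ where
  val := NormedSpace.exp X
  inv := NormedSpace.exp (-X)
  val_inv := by
    rw [← Matrix.exp_add_of_commute X (-X) ((Commute.refl X).neg_right), add_neg_cancel,
      NormedSpace.exp_zero]
  inv_val := by
    rw [← Matrix.exp_add_of_commute (-X) X ((Commute.refl X).neg_left), neg_add_cancel,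
      NormedSpace.exp_zero]

lemma expGL_conj (g : Matrix.GeneralLinearGroup n ℂ) (X : Matrix n n ℂ) :
    expGL ((g : Matrix n n ℂ) * X * ((g⁻¹ : Matrix.GeneralLinearGroup n ℂ) : Matrix n n ℂ)) =
      g * expGL X * g⁻¹ :=
  Units.ext (Matrix.exp_units_conj g X)

variable (n) in
/-- A connected complex reductive group `G = K^ℂ`, realized as a closed complex subgroup of
`GL(n, ℂ)` that is compatible with the Cartan decomposition of `GL(n, ℂ)`: with
`K = G ∩ U(n)` and `𝔭` the hermitian elements of the Lie algebra, `G = K exp 𝔭`.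
The Lie algebra is a complex subspace, so `𝔭 = i 𝔨`. -/
structure ReductiveGroup where
  /-- the group -/
  carrier : Subgroup (Matrix.GeneralLinearGroup n ℂ)
  isClosed : IsClosed (carrier : Set (Matrix.GeneralLinearGroup n ℂ))
  isConnected : IsConnected (carrier : Set (Matrix.GeneralLinearGroup n ℂ))
  /-- the Lie algebra -/
  lie : Submodule ℂ (Matrix n n ℂ)
  mem_lie : ∀ X, X ∈ lie ↔ ∀ t : ℝ, expGL ((t : ℂ) • X) ∈ carrier
  cartan : ∀ g ∈ carrier, ∃ k ∈ carrier, ∃ X ∈ lie,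
    (k : Matrix n n ℂ) ∈ Matrix.unitaryGroup n ℂ ∧ Xᴴ = X ∧ g = k * expGL X

namespace ReductiveGroup

variable (G : ReductiveGroup n)

/-- The maximal compact subgroup `K = G ∩ U(n)`. -/
def maxCompact : Subgroup G.carrier where
  carrier := {g | ((g : Matrix.GeneralLinearGroup n ℂ) : Matrix n n ℂ) ∈ Matrix.unitaryGroup n ℂ}
  one_mem' := one_mem (Matrix.unitaryGroup n ℂ)
  mul_mem' {a b} ha hb := (Matrix.unitaryGroup n ℂ).mul_mem ha hb
  inv_mem' {g} hg := by
    have hg' : star ((g : Matrix.GeneralLinearGroup n ℂ) : Matrix n n ℂ) *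
        ((g : Matrix.GeneralLinearGroup n ℂ) : Matrix n n ℂ) = 1 :=
      (show _ ∈ Matrix.unitaryGroup n ℂ from hg).1
    have h : (((g : Matrix.GeneralLinearGroup n ℂ)⁻¹ : Matrix.GeneralLinearGroup n ℂ) :
        Matrix n n ℂ) = star ((g : Matrix.GeneralLinearGroup n ℂ) : Matrix n n ℂ) :=
      Units.inv_eq_of_mul_eq_one_left hg'
    change (((g : Matrix.GeneralLinearGroup n ℂ)⁻¹ : Matrix.GeneralLinearGroup n ℂ) :
        Matrix n n ℂ) ∈ Matrix.unitaryGroup n ℂ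
    rw [h]
    exact Unitary.star_mem hg

/-- The real vector space `𝔭 = i 𝔨` of hermitian elements of the Lie algebra. -/
def 𝔭 : Submodule ℝ (Matrix n n ℂ) where
  carrier := {X | X ∈ G.lie ∧ Xᴴ = X}
  zero_mem' := ⟨zero_mem _, Matrix.conjTranspose_zero⟩
  add_mem' ha hb := ⟨add_mem ha.1 hb.1, by rw [Matrix.conjTranspose_add, ha.2, hb.2]⟩
  smul_mem' c X hX := ⟨(G.lie.restrictScalars ℝ).smul_mem c hX.1, by
    rw [Matrix.conjTranspose_smul, hX.2, star_trivial]⟩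

lemma expGL_mem {X : Matrix n n ℂ} (hX : X ∈ G.lie) : expGL X ∈ G.carrier := by
  simpa using (G.mem_lie X).1 hX 1

/-- The exponential map of `G`. -/
def exp (X : G.lie) : G.carrier := ⟨expGL (X : Matrix n n ℂ), G.expGL_mem X.2⟩

/-- An element of `𝔭` as an element of the Lie algebra. -/
def ofP (X : G.𝔭) : G.lie := ⟨X, X.2.1⟩

/-- The adjoint action of `K` on `𝔭`. -/
def Ad (k : G.maxCompact) (X : G.𝔭) : G.𝔭 :=
  ⟨((k : G.carrier) : Matrix.GeneralLinearGroup n ℂ) * (X : Matrix n n ℂ) *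
      (((k : G.carrier) : Matrix.GeneralLinearGroup n ℂ)⁻¹ : Matrix.GeneralLinearGroup n ℂ), by
    refine ⟨(G.mem_lie _).2 fun t => ?_, ?_⟩
    · have := G.carrier.mul_mem (G.carrier.mul_mem (k : G.carrier).2
        ((G.mem_lie _).1 X.2.1 t)) (G.carrier.inv_mem (k : G.carrier).2)
      rw [← expGL_conj] at this
      simpa using this
    · have hk : star (((k : G.carrier) : Matrix.GeneralLinearGroup n ℂ) : Matrix n n ℂ) *
        (((k : G.carrier) : Matrix.GeneralLinearGroup n ℂ) : Matrix n n ℂ) = 1 :=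
        (show _ ∈ Matrix.unitaryGroup n ℂ from k.2).1
      have h : ((((k : G.carrier) : Matrix.GeneralLinearGroup n ℂ)⁻¹ :
          Matrix.GeneralLinearGroup n ℂ) : Matrix n n ℂ) =
          (((k : G.carrier) : Matrix.GeneralLinearGroup n ℂ) : Matrix n n ℂ)ᴴ :=
        Units.inv_eq_of_mul_eq_one_left hk
      have hX : (X : Matrix n n ℂ)ᴴ = X := X.2.2
      rw [h]
      simp only [Matrix.conjTranspose_mul, Matrix.conjTranspose_conjTranspose, hX,
        Matrix.mul_assoc]⟩

/-- `B` is a `K`-invariant inner product on `𝔭`. -/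
structure IsInvariantInner (B : LinearMap.BilinForm ℝ G.𝔭) : Prop where
  symm : ∀ X Y, B X Y = B Y X
  pos : ∀ X, X ≠ 0 → 0 < B X X
  invariant : ∀ (k : G.maxCompact) (X Y : G.𝔭), B (G.Ad k X) (G.Ad k Y) = B X Y

/-- The group `R^{β₋} = {g ∈ G : lim_{t → +∞} exp(tβ) g exp(-tβ) = e}`. -/
def Rminus (β : G.𝔭) : Subgroup G.carrier where
  carrier := {g | Filter.Tendsto
    (fun t : ℝ => G.exp (G.ofP (t • β)) * g * (G.exp (G.ofP (t • β)))⁻¹) Filter.atTop (𝓝 1)}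
  one_mem' := by
    simp only [Set.mem_ofPred_eq, mul_one, mul_inv_cancel]
    exact tendsto_const_nhds
  mul_mem' {a b} ha hb := by
    have := Filter.Tendsto.mul ha hb
    simpa [mul_assoc] using this
  inv_mem' {a} ha := by
    have := Filter.Tendsto.inv ha
    simpa [mul_assoc] using this

end ReductiveGroup

end Group

/-! ### Holomorphic representations that are unitary on the maximal compact subgroup -/

section Rep

variable {n : Type*} [Fintype n] [DecidableEq n]
  (W : Type*) [NormedAddCommGroup W] [InnerProductSpace ℂ W]

/-- A holomorphic representation of `G` on the hermitian vector space `W` whose restriction to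
`K` is unitary. -/
structure UnitaryRep (G : ReductiveGroup n) where
  /-- the representation -/
  rep : Representation ℂ G.carrier W
  continuous : ∀ w, Continuous fun g => rep g w
  holomorphic : ∀ (X : G.lie) (w : W), Differentiable ℂ fun z : ℂ => rep (G.exp (z • X)) w
  unitary : ∀ (k : G.maxCompact) (v w : W), ⟪rep k v, rep k w⟫_ℂ = ⟪v, w⟫_ℂ

namespace UnitaryRep

variable {W} {G : ReductiveGroup n} (ρ : UnitaryRep W G)

/-- The derived representation of the Lie algebra: `X · w = d/dz|₀ exp(zX) w`. -/
def dρ (X : G.lie) : Module.End ℂ W where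
  toFun w := deriv (fun z : ℂ => ρ.rep (G.exp (z • X)) w) 0
  map_add' v w := by
    simp only [map_add]
    exact deriv_add (ρ.holomorphic X v 0) (ρ.holomorphic X w 0)
  map_smul' c w := by
    simp only [map_smul, RingHom.id_apply]
    exact deriv_const_smul c (ρ.holomorphic X w 0)

/-- The subspace `𝔤 · w`. -/
def lieOrbit (w : W) : Submodule ℂ W := Submodule.span ℂ (Set.range fun X : G.lie => ρ.dρ X w)

/-- The action of `G` on the projective space of `W`. -/
def act (g : G.carrier) (x : ℙ ℂ W) : ℙ ℂ W :=
  Projectivization.map (ρ.rep g) (ρ.rep.apply_bijective g).injective x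

/-- `s` times the Fubini–Study metric at `[w]`, evaluated at the images in `T_{[w]} ℙ(W)` of
`u, v ∈ W = T_w W`. -/
def fubiniStudy (s : ℝ) (w u v : W) : ℝ :=
  s * (⟪u, v⟫_ℂ / (‖w‖ : ℂ) ^ 2 - ⟪u, w⟫_ℂ * ⟪w, v⟫_ℂ / (‖w‖ : ℂ) ^ 4).re

/-- The component `μ^α = ⟨μ, α⟩`, pulled back to `W ∖ {0}` (and set to `0` at the origin). -/
def component (B : LinearMap.BilinForm ℝ G.𝔭) (μ : ℙ ℂ W → G.𝔭) (α : G.𝔭) (w : W) : ℝ :=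
  open Classical in if h : w ≠ 0 then B (μ (Projectivization.mk ℂ w h)) α else 0

/-- `μ : ℙ(W) → 𝔭 = i 𝔨` is a momentum map for `s` times the Fubini–Study metric: it is
`K`-equivariant and `grad μ^α` is the vector field of the flow `exp(tα)`, for every `α ∈ 𝔭`. -/
structure IsMomentumMap (s : ℝ) (B : LinearMap.BilinForm ℝ G.𝔭) (μ : ℙ ℂ W → G.𝔭) : Prop where
  equivariant : ∀ (k : G.maxCompact) (x : ℙ ℂ W), μ (ρ.act k x) = G.Ad k (μ x)
  differentiable : ∀ (α : G.𝔭) (w : W), w ≠ 0 →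
    DifferentiableAt ℝ (component B μ α) w
  gradient : ∀ (α : G.𝔭) (w : W), w ≠ 0 → ∀ v : W,
    fderiv ℝ (component B μ α) w v = fubiniStudy s w (ρ.dρ (G.ofP α) w) v

/-- The set `ℙ(W)^β_max` where `μ^β` is maximal. -/
def maxSet (B : LinearMap.BilinForm ℝ G.𝔭) (μ : ℙ ℂ W → G.𝔭) (β : G.𝔭) : Set (ℙ ℂ W) :=
  {x | ∀ y, B (μ y) β ≤ B (μ x) β}

end UnitaryRep

/-- `ℙ(U)` as a subset of `ℙ(W)`, for a linear subspace `U` of `W`. -/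
def projSet {W : Type*} [AddCommGroup W] [Module ℂ W] (U : Submodule ℂ W) : Set (ℙ ℂ W) :=
  {x | x.submodule ≤ U}

end Rep

/-! ### Morphisms between subsets of `A × ℙ(V)`, with `A` a vector space -/

section Morphism

/-- Polynomial maps between finite dimensional complex vector spaces. -/
def IsPolynomialMap {E F : Type*} [AddCommGroup E] [Module ℂ E] [AddCommGroup F] [Module ℂ F]
    (P : E → F) : Prop :=
  ∀ φ : Module.Dual ℂ F, (fun x => φ (P x)) ∈
    Algebra.adjoin ℂ (Set.range fun (ψ : Module.Dual ℂ E) (x : E) => ψ x)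

variable {A V B V' X Y : Type*}
  [NormedAddCommGroup A] [NormedSpace ℂ A] [NormedAddCommGroup V] [NormedSpace ℂ V]
  [NormedAddCommGroup B] [NormedSpace ℂ B] [NormedAddCommGroup V'] [NormedSpace ℂ V']

/-- `F : X → Y` is a morphism of algebraic varieties, where `X` and `Y` are regarded, through the
injections `i` and `j`, as locally closed subvarieties of `A × ℙ(V)` and `B × ℙ(V')`: Zariski
locally the component in `B` is a quotient `N / D`, and the component in `ℙ(V')` is `[L]`, with
polynomial maps `N, D, L` on `A × V` that are homogeneous in the variable in `V`,
`N` and `D` of the same degree. -/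
def IsRegularMap (i : X → A × ℙ ℂ V) (j : Y → B × ℙ ℂ V') (F : X → Y) : Prop :=
  ∀ p : X, ∃ (d e : ℕ) (N : A × V → B) (D : A × V → ℂ) (L : A × V → V'),
    IsPolynomialMap N ∧ IsPolynomialMap D ∧ IsPolynomialMap L ∧
    (∀ a (c : ℂ) v, N (a, c • v) = c ^ d • N (a, v)) ∧
    (∀ a (c : ℂ) v, D (a, c • v) = c ^ d • D (a, v)) ∧
    (∀ a (c : ℂ) v, L (a, c • v) = c ^ e • L (a, v)) ∧
    (∀ a v hv, i p = (a, Projectivization.mk ℂ v hv) → D (a, v) ≠ 0 ∧ L (a, v) ≠ 0) ∧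
    ∀ q a v hv, i q = (a, Projectivization.mk ℂ v hv) → D (a, v) ≠ 0 → ∀ h : L (a, v) ≠ 0,
      j (F q) = ((D (a, v))⁻¹ • N (a, v), Projectivization.mk ℂ (L (a, v)) h)

/-- `F : X → Y` is holomorphic, where `X` and `Y` are regarded, through the injections `i` and `j`,
as complex submanifolds of `A × ℙ(V)` and `B × ℙ(V')`: locally the component in `B` is the
restriction of a holomorphic map `f`, and the component in `ℙ(V')` is `[g]` with `g` holomorphic,
both defined on an open subset of `A × (V ∖ {0})`. -/
def IsHolomorphicMap (i : X → A × ℙ ℂ V) (j : Y → B × ℙ ℂ V') (F : X → Y) : Prop :=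
  ∀ p a v hv, i p = (a, Projectivization.mk ℂ v hv) →
    ∃ (f : A × V → B) (g : A × V → V'), AnalyticAt ℂ f (a, v) ∧ AnalyticAt ℂ g (a, v) ∧
      g (a, v) ≠ 0 ∧
      ∀ᶠ z in 𝓝 (a, v), ∀ q (hz : z.2 ≠ 0), i q = (z.1, Projectivization.mk ℂ z.2 hz) →
        ∀ h : g z ≠ 0, j (F q) = (f z, Projectivization.mk ℂ (g z) h)

end Morphism

section Embeddings

variable {n : Type*} [Fintype n] [DecidableEq n] {G : ReductiveGroup n}
  {W : Type*} [AddCommGroup W] [Module ℂ W]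

/-- The product of a subgroup `R` of `G` and a subset `S` of `ℙ(W)`, as a subset of
`A × ℙ(W)` with `A` the space of `n × n` matrices. -/
def prodCoord (R : Subgroup G.carrier) (S : Set (ℙ ℂ W)) (p : R × S) : (n → n → ℂ) × ℙ ℂ W :=
  (fun a b => (((p.1 : G.carrier) : Matrix.GeneralLinearGroup n ℂ) : Matrix n n ℂ) a b, p.2)

/-- A subset of `ℙ(W)`, as a subset of `{0} × ℙ(W)`. -/
def projCoord (T : Set (ℙ ℂ W)) (x : T) : PUnit.{1} × ℙ ℂ W := (PUnit.unit, x)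

end Embeddings

end LocalStructure

end

/-! The gradient condition forces `μ^α([w]) = (s/2) ⟨αw, w⟩ / ‖w‖² + c(α)` with `c` linear, and
`K`-invariance makes `c` vanish on brackets (`exists_const`, `const_brk`). Take a maximal
commutative subspace of `𝔭` containing `β`. At joint eigenvectors `μ` takes values in this subspace,
and `β` is a convex combination of finitely many such values. Being extreme, it is one of them, and
a separating functional yields `α` commuting with `β` whose top eigenspace is mapped entirely to `β`
(`exists_exposing`).

Let `v` be a joint eigenvector in that eigenspace, and decompose `𝔤` into joint weight spaces of `α`
and `β`. Positive `α`-weight kills `v`. Weight zero preserves its line, because `μ` is constant on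
the eigenspace. For negative `α`-weight `X*` kills `v`, and evaluating `μ` on `[X*, X]` gives `(s/2)
‖Xv‖² / ‖v‖² = -2b B(C, C)`, where `b` is the `β`-weight of `X = A + iC`; so `Xv = 0` if `b ≥ 0`
(`norm_dρ_sq_eq`, `exists_weight_basis`). Thus the parabolic subalgebra of weights `b ≥ 0`
stabilizes the line of `v`, and irreducibility makes `W` the sum of this line and lower eigenspaces
of `β`: the top eigenspace is a line. The same identity shows that `X ↦ X w₀` is injective on the
negative part `𝔫` of `𝔤`, and nontriviality gives `w₀ ∈ 𝔤 w₀`, so `𝔤 w₀ = ℂ w₀ ⊕ 𝔫 w₀`.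

The rest is unipotent algebra. `R^{β₋} = exp 𝔫`, with exponential and logarithm polynomial. Let `ℓ`
be the coordinate along `w₀` and `κ : W → 𝔫` a retraction of `X ↦ X w₀` with kernel `ℂ w₀ ⊕ (𝔤
w₀)ᗮ`. The target is `ℓ ≠ 0`, the slice is `κ = 0, ℓ ≠ 0`, and `ℓ` is `R^{β₋}`-invariant. For `ℓ v =
1` the equation `κ(exp(-X) v) = 0` is the fixed-point equation `X = κ(exp(-X) v + X w₀)`, whose
right side contracts the weight filtration. Iteration stops after a fixed number of steps, so the
solution exists, is unique and is polynomial in `v`; homogenizing by `ℓ` gives the regular inverse.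
-/

noncomputable section

namespace LocalStructure

/-! ### Polynomial maps -/

section Polynomial

variable {E F H F₁ F₂ : Type*} [AddCommGroup E] [Module ℂ E] [AddCommGroup F] [Module ℂ F]
  [AddCommGroup H] [Module ℂ H] [AddCommGroup F₁] [Module ℂ F₁] [AddCommGroup F₂] [Module ℂ F₂]

variable (E) in
/-- The algebra of polynomial functions on a complex vector space. -/
def polyAlg : Subalgebra ℂ (E → ℂ) :=
  Algebra.adjoin ℂ (Set.range fun (ψ : Module.Dual ℂ E) (x : E) => ψ x)

lemma dual_mem_polyAlg (ψ : Module.Dual ℂ E) : (fun x => ψ x) ∈ polyAlg E :=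
  Algebra.subset_adjoin ⟨ψ, rfl⟩

lemma const_mem_polyAlg (c : ℂ) : (fun _ => c) ∈ polyAlg E :=
  (polyAlg E).algebraMap_mem c

lemma isPolynomialMap_linear (f : E →ₗ[ℂ] F) : IsPolynomialMap f :=
  fun φ => dual_mem_polyAlg (φ ∘ₗ f)

lemma isPolynomialMap_const (y : F) : IsPolynomialMap (fun _ : E => y) :=
  fun φ => const_mem_polyAlg (φ y)

lemma isPolynomialMap_id : IsPolynomialMap (fun x : E => x) :=
  isPolynomialMap_linear LinearMap.id

lemma IsPolynomialMap.add {P Q : E → F} (hP : IsPolynomialMap P) (hQ : IsPolynomialMap Q) :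
    IsPolynomialMap (fun x => P x + Q x) := by
  intro φ
  simp only [map_add]
  exact (polyAlg E).add_mem (hP φ) (hQ φ)

lemma IsPolynomialMap.smul {f : E → ℂ} {P : E → F} (hf : f ∈ polyAlg E) (hP : IsPolynomialMap P) :
    IsPolynomialMap (fun x => f x • P x) := by
  intro φ
  simp only [map_smul]
  exact (polyAlg E).mul_mem hf (hP φ)

lemma IsPolynomialMap.const_smul (c : ℂ) {P : E → F} (hP : IsPolynomialMap P) :
    IsPolynomialMap (fun x => c • P x) :=
  IsPolynomialMap.smul (const_mem_polyAlg c) hP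

lemma IsPolynomialMap.neg {P : E → F} (hP : IsPolynomialMap P) :
    IsPolynomialMap (fun x => -P x) := by
  simpa using hP.const_smul (-1)

lemma IsPolynomialMap.sub {P Q : E → F} (hP : IsPolynomialMap P) (hQ : IsPolynomialMap Q) :
    IsPolynomialMap (fun x => P x - Q x) := by
  simpa only [sub_eq_add_neg] using hP.add hQ.neg

lemma IsPolynomialMap.sum {ι : Type*} (s : Finset ι) {P : ι → E → F}
    (hP : ∀ i ∈ s, IsPolynomialMap (P i)) : IsPolynomialMap (fun x => ∑ i ∈ s, P i x) := by
  intro φ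
  have h : (fun x => φ (∑ i ∈ s, P i x)) = ∑ i ∈ s, fun x => φ (P i x) := by
    funext x; simp [map_sum]
  rw [h]
  exact (polyAlg E).sum_mem fun i hi => hP i hi φ

lemma IsPolynomialMap.comp {Q : F → H} {P : E → F} (hQ : IsPolynomialMap Q)
    (hP : IsPolynomialMap P) : IsPolynomialMap (fun x => Q (P x)) := by
  intro φ
  have h : ∀ f ∈ polyAlg F, (fun x => f (P x)) ∈ polyAlg E := by
    intro f hf
    induction hf using Algebra.adjoin_induction with
    | mem f hf => obtain ⟨ψ, rfl⟩ := hf; exact hP ψ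
    | algebraMap c => exact const_mem_polyAlg c
    | add f g _ _ hf hg => exact (polyAlg E).add_mem hf hg
    | mul f g _ _ hf hg => exact (polyAlg E).mul_mem hf hg
  exact h _ (hQ φ)

lemma IsPolynomialMap.linear_comp (f : F →ₗ[ℂ] H) {P : E → F} (hP : IsPolynomialMap P) :
    IsPolynomialMap (fun x => f (P x)) :=
  (isPolynomialMap_linear f).comp hP

lemma IsPolynomialMap.bilinear [FiniteDimensional ℂ F₁] (m : F₁ →ₗ[ℂ] F₂ →ₗ[ℂ] F) {P : E → F₁}
    {Q : E → F₂} (hP : IsPolynomialMap P) (hQ : IsPolynomialMap Q) :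
    IsPolynomialMap (fun x => m (P x) (Q x)) := by
  let b := Module.finBasis ℂ F₁
  have h : (fun x => m (P x) (Q x)) = fun x => ∑ i, b.coord i (P x) • m (b i) (Q x) := by
    funext x
    conv_lhs => rw [← b.sum_repr (P x)]
    simp only [map_sum, LinearMap.sum_apply, map_smul, LinearMap.smul_apply, Module.Basis.coord_apply]
  rw [h]
  exact IsPolynomialMap.sum _ fun i _ => IsPolynomialMap.smul (hP _) (hQ.linear_comp _)

lemma IsPolynomialMap.pow {A : Type*} [Ring A] [Algebra ℂ A] [FiniteDimensional ℂ A] {P : E → A}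
    (hP : IsPolynomialMap P) (k : ℕ) : IsPolynomialMap (fun x => P x ^ k) := by
  induction k with
  | zero => simpa using isPolynomialMap_const (1 : A)
  | succ k ih => simpa [pow_succ] using IsPolynomialMap.bilinear (LinearMap.mul ℂ A) ih hP

/-- The truncated exponential series. -/
def truncExp {A : Type*} [Ring A] [Algebra ℂ A] (m : ℕ) (x : A) : A :=
  ∑ k ∈ Finset.range m, ((k.factorial : ℂ)⁻¹) • x ^ k

lemma IsPolynomialMap.truncExp {A : Type*} [Ring A] [Algebra ℂ A] [FiniteDimensional ℂ A]
    {P : E → A} (hP : IsPolynomialMap P) (m : ℕ) :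
    IsPolynomialMap (fun x => truncExp m (P x)) :=
  IsPolynomialMap.sum _ fun k _ => (hP.pow k).const_smul _

/-- Homogenization of a polynomial function with respect to a linear functional. -/
lemma exists_homogenization_scalar (l : Module.Dual ℂ E) {f : E → ℂ} (hf : f ∈ polyAlg E) :
    ∃ d₀ : ℕ, ∀ d ≥ d₀, ∃ N ∈ polyAlg E, (∀ (c : ℂ) v, N (c • v) = c ^ d * N v) ∧
      ∀ v, l v ≠ 0 → N v = l v ^ d * f ((l v)⁻¹ • v) := by
  induction hf using Algebra.adjoin_induction with
  | mem f hf =>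
    obtain ⟨ψ, rfl⟩ := hf
    refine ⟨1, fun d hd => ?_⟩
    obtain ⟨e, rfl⟩ := Nat.exists_eq_add_of_le' hd
    refine ⟨(fun x => l x) ^ e * fun x => ψ x, (polyAlg E).mul_mem
      ((polyAlg E).pow_mem (dual_mem_polyAlg l) e) (dual_mem_polyAlg ψ), fun c v => ?_,
      fun v hv => ?_⟩
    · simp; ring
    · simp only [Pi.mul_apply, Pi.pow_apply, map_smul, smul_eq_mul, pow_succ]
      field_simp
  | algebraMap a =>
    refine ⟨0, fun d _ => ⟨(fun x => l x) ^ d * fun _ => a, (polyAlg E).mul_mem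
      ((polyAlg E).pow_mem (dual_mem_polyAlg l) d) (const_mem_polyAlg a), fun c v => ?_,
      fun v hv => ?_⟩⟩
    · simp; ring
    · simp
  | add f g _ _ hf hg =>
    obtain ⟨d₁, h₁⟩ := hf
    obtain ⟨d₂, h₂⟩ := hg
    -- A sum needs both homogenizations in one degree; this is why the claim covers every degree
    -- from some bound on.
    refine ⟨max d₁ d₂, fun d hd => ?_⟩
    obtain ⟨N₁, hN₁, hh₁, he₁⟩ := h₁ d (le_trans (le_max_left _ _) hd)
    obtain ⟨N₂, hN₂, hh₂, he₂⟩ := h₂ d (le_trans (le_max_right _ _) hd)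
    refine ⟨N₁ + N₂, (polyAlg E).add_mem hN₁ hN₂, fun c v => ?_, fun v hv => ?_⟩
    · simp [hh₁, hh₂, mul_add]
    · simp [he₁ v hv, he₂ v hv, mul_add]
  | mul f g _ _ hf hg =>
    obtain ⟨d₁, h₁⟩ := hf
    obtain ⟨d₂, h₂⟩ := hg
    refine ⟨d₁ + d₂, fun d hd => ?_⟩
    obtain ⟨N₁, hN₁, hh₁, he₁⟩ := h₁ d₁ le_rfl
    -- The second factor absorbs the surplus degree.
    obtain ⟨N₂, hN₂, hh₂, he₂⟩ := h₂ (d - d₁) (by omega)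
    have hd' : d = d₁ + (d - d₁) := by omega
    refine ⟨N₁ * N₂, (polyAlg E).mul_mem hN₁ hN₂, fun c v => ?_, fun v hv => ?_⟩
    · simp only [Pi.mul_apply, hh₁, hh₂]
      conv_rhs => rw [hd', pow_add]
      ring
    · simp only [Pi.mul_apply, he₁ v hv, he₂ v hv]
      conv_rhs => rw [hd', pow_add]
      ring

/-- Passes from a polynomial map on the affine chart `l = 1` to homogeneous data on the whole space,
with one degree for all coordinates. -/
lemma exists_homogenization [FiniteDimensional ℂ F] (l : Module.Dual ℂ E) {P : E → F}
    (hP : IsPolynomialMap P) :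
    ∃ d₀ : ℕ, ∀ d ≥ d₀, ∃ N : E → F, IsPolynomialMap N ∧
      (∀ (c : ℂ) v, N (c • v) = c ^ d • N v) ∧
      ∀ v, l v ≠ 0 → N v = l v ^ d • P ((l v)⁻¹ • v) := by
  let b := Module.finBasis ℂ F
  choose d₀ h using fun i => exists_homogenization_scalar l (hP (b.coord i))
  refine ⟨∑ i, d₀ i, fun d hd => ?_⟩
  choose N hN hh he using fun i => h i d
    ((Finset.single_le_sum (fun _ _ => Nat.zero_le _) (Finset.mem_univ i)).trans hd)
  refine ⟨fun v => ∑ i, N i v • b i, IsPolynomialMap.sum _ fun i _ =>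
    IsPolynomialMap.smul (hN i) (isPolynomialMap_const _), fun c v => ?_, fun v hv => ?_⟩
  · simp only [hh, Finset.smul_sum, smul_smul]
  · simp only [he _ v hv, mul_smul, ← Finset.smul_sum]
    congr 1
    exact b.sum_repr _

end Polynomial

/-! ### Analyticity of polynomial maps and of morphisms -/

section Analytic

variable {E F : Type*} [NormedAddCommGroup E] [NormedSpace ℂ E] [FiniteDimensional ℂ E]
  [NormedAddCommGroup F] [NormedSpace ℂ F] [FiniteDimensional ℂ F]

lemma analyticAt_of_mem_polyAlg {f : E → ℂ} (hf : f ∈ polyAlg E) (x : E) : AnalyticAt ℂ f x := by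
  induction hf using Algebra.adjoin_induction with
  | mem f hf =>
    obtain ⟨ψ, rfl⟩ := hf
    exact (LinearMap.toContinuousLinearMap ψ).analyticAt x
  | algebraMap c => exact analyticAt_const
  | add f g _ _ hf hg => exact hf.add hg
  | mul f g _ _ hf hg => exact hf.mul hg

lemma IsPolynomialMap.analyticAt {P : E → F} (hP : IsPolynomialMap P) (x : E) :
    AnalyticAt ℂ P x := by
  let b := Module.finBasis ℂ F
  have h : P = fun x => ∑ i, b.coord i (P x) • b i := by
    funext x; exact (b.sum_repr _).symm
  rw [h]
  exact Finset.analyticAt_fun_sum _ fun i _ =>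
    (analyticAt_of_mem_polyAlg (hP (b.coord i)) x).smul analyticAt_const

variable {A V B V₂ X Y : Type*}
  [NormedAddCommGroup A] [NormedSpace ℂ A] [NormedAddCommGroup V] [NormedSpace ℂ V]
  [NormedAddCommGroup B] [NormedSpace ℂ B] [NormedAddCommGroup V₂] [NormedSpace ℂ V₂]
  [FiniteDimensional ℂ A] [FiniteDimensional ℂ B] [FiniteDimensional ℂ V] [FiniteDimensional ℂ V₂]

/-- Morphisms of algebraic varieties are holomorphic. -/
lemma IsRegularMap.isHolomorphicMap {i : X → A × ℙ ℂ V} {j : Y → B × ℙ ℂ V₂} {F : X → Y}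
    (h : IsRegularMap i j F) : IsHolomorphicMap i j F := by
  intro p a v hv hp
  obtain ⟨d, e, N, D, L, hN, hD, hL, -, -, -, h0, hF⟩ := h p
  obtain ⟨hD0, hL0⟩ := h0 a v hv hp
  refine ⟨fun z => (D z)⁻¹ • N z, L, ((hD.analyticAt _).inv hD0).smul (hN.analyticAt _),
    hL.analyticAt _, hL0, ?_⟩
  filter_upwards [(hD.analyticAt (a, v)).continuousAt.eventually_ne hD0] with z hz q hz2 hq hz3
  exact hF q z.1 z.2 hz2 hq hz hz3

end Analytic

/-! ### Filtrations by eigenvalues -/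

section Filtration

variable {E E₁ E₂ E₃ : Type*} [AddCommGroup E] [Module ℂ E] [AddCommGroup E₁] [Module ℂ E₁]
  [AddCommGroup E₂] [Module ℂ E₂] [AddCommGroup E₃] [Module ℂ E₃]

/-- The span of the eigenvectors of `A` with real eigenvalue at most `c`. -/
def fil (A : Module.End ℂ E) (c : ℝ) : Submodule ℂ E :=
  Submodule.span ℂ {x | ∃ l : ℝ, l ≤ c ∧ A x = (l : ℂ) • x}

lemma mem_fil {A : Module.End ℂ E} {c l : ℝ} {x : E} (hl : l ≤ c) (hx : A x = (l : ℂ) • x) :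
    x ∈ fil A c := Submodule.subset_span ⟨l, hl, hx⟩

lemma fil_mono (A : Module.End ℂ E) {c d : ℝ} (h : c ≤ d) : fil A c ≤ fil A d :=
  Submodule.span_mono fun _ ⟨l, hl, hx⟩ => ⟨l, hl.trans h, hx⟩

/-- The Leibniz rule makes eigenvalues add. It is applied to products of matrices and to the action
of `𝔤` on `W`. -/
lemma fil_bilinear {A₁ : Module.End ℂ E₁} {A₂ : Module.End ℂ E₂} {A₃ : Module.End ℂ E₃}
    (m : E₁ →ₗ[ℂ] E₂ →ₗ[ℂ] E₃) (h : ∀ x y, A₃ (m x y) = m (A₁ x) y + m x (A₂ y)) {a b : ℝ}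
    {x : E₁} {y : E₂} (hx : x ∈ fil A₁ a) (hy : y ∈ fil A₂ b) : m x y ∈ fil A₃ (a + b) := by
  induction hx, hy using Submodule.span_induction₂ with
  | mem_mem x y hx hy =>
    obtain ⟨l, hl, hx⟩ := hx
    obtain ⟨k, hk, hy⟩ := hy
    refine mem_fil (l := l + k) (add_le_add hl hk) ?_
    rw [h, hx, hy]
    simp [add_smul]
  | zero_left y hy => simp
  | zero_right x hx => simp
  | add_left x y z _ _ _ h₁ h₂ => simpa using add_mem h₁ h₂
  | add_right x y z _ _ _ h₁ h₂ => simpa using add_mem h₁ h₂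
  | smul_left r x y _ _ h => simpa using Submodule.smul_mem _ r h
  | smul_right r x y _ _ h => simpa using Submodule.smul_mem _ r h

lemma fil_map {A₁ : Module.End ℂ E₁} {A₂ : Module.End ℂ E₂} (f : E₁ →ₗ[ℂ] E₂) (k : ℝ)
    (h : ∀ x, A₂ (f x) = f (A₁ x) + (k : ℂ) • f x) {a : ℝ} {x : E₁} (hx : x ∈ fil A₁ a) :
    f x ∈ fil A₂ (a + k) := by
  induction hx using Submodule.span_induction with
  | mem x hx =>
    obtain ⟨l, hl, hx⟩ := hx
    refine mem_fil (l := l + k) (by linarith) ?_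
    rw [h, hx]
    simp [add_smul]
  | zero => simp
  | add x y _ _ h₁ h₂ => simpa using add_mem h₁ h₂
  | smul r x _ h => simpa using Submodule.smul_mem _ r h

lemma finite_real_eigenvalues [FiniteDimensional ℂ E] (A : Module.End ℂ E) :
    {l : ℝ | A.HasEigenvalue (l : ℂ)}.Finite :=
  Set.Finite.preimage Complex.ofReal_injective.injOn (Module.End.finite_hasEigenvalue A)

lemma exists_fil_eq_bot [FiniteDimensional ℂ E] (A : Module.End ℂ E) :
    ∃ c₀ : ℝ, fil A c₀ = ⊥ := by
  obtain ⟨b, hb⟩ := (finite_real_eigenvalues A).bddBelow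
  refine ⟨b - 1, ?_⟩
  rw [fil, Submodule.span_eq_bot]
  rintro x ⟨l, hl, hx⟩
  by_contra h0
  have : b ≤ l := hb (Module.End.hasEigenvalue_of_hasEigenvector
    ⟨Module.End.mem_eigenspace_iff.2 hx, h0⟩)
  linarith

/-- Finitely many eigenvalues leave a gap below `c`. Allowing every `δ' ≤ δ` lets several operators
share the minimum of their gaps. -/
lemma exists_gap [FiniteDimensional ℂ E] (A : Module.End ℂ E) (c : ℝ) :
    ∃ δ > 0, ∀ δ' ≤ δ, ∀ (l : ℝ) (x : E), l < c → A x = (l : ℂ) • x → x ∈ fil A (c - δ') := by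
  have hfin : ({l : ℝ | A.HasEigenvalue (l : ℂ)} ∩ Set.Iio c).Finite :=
    (finite_real_eigenvalues A).inter_of_left _
  obtain ⟨m, hm, hm'⟩ : ∃ m < c, ∀ l ∈ {l : ℝ | A.HasEigenvalue (l : ℂ)} ∩ Set.Iio c, l ≤ m := by
    rcases Set.eq_empty_or_nonempty ({l : ℝ | A.HasEigenvalue (l : ℂ)} ∩ Set.Iio c) with h | h
    · exact ⟨c - 1, by linarith, by simp [h]⟩
    · obtain ⟨m, hm, hm'⟩ := Set.exists_max_image _ id hfin h
      exact ⟨m, hm.2, hm'⟩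
  refine ⟨c - m, by linarith, fun δ' hδ' l x hl hx => ?_⟩
  by_cases h0 : x = 0
  · rw [h0]; exact zero_mem _
  have := hm' l ⟨Module.End.hasEigenvalue_of_hasEigenvector
    ⟨Module.End.mem_eigenspace_iff.2 hx, h0⟩, hl⟩
  exact mem_fil (by linarith) hx

lemma pow_mem_fil {A a : Module.End ℂ E} {δ : ℝ} (ha : ∀ t, ∀ x ∈ fil A t, a x ∈ fil A (t - δ))
    (k : ℕ) {t : ℝ} {x : E} (hx : x ∈ fil A t) : (a ^ k) x ∈ fil A (t - k * δ) := by
  induction k with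
  | zero => simpa using hx
  | succ k ih =>
    rw [pow_succ', Module.End.mul_apply]
    have := ha _ _ ih
    convert this using 2
    push_cast; ring

/-- Telescoping without commutativity: `a^(k+2) - b^(k+2) = a (a^(k+1) - b^(k+1)) + (a - b)
b^(k+1)`. Every further factor lowers by another `δ`, on top of the shift `c` of `a - b`. -/
lemma pow_sub_pow_mem_fil {A a b : Module.End ℂ E} {δ c : ℝ}
    (ha : ∀ t, ∀ x ∈ fil A t, a x ∈ fil A (t - δ))
    (hb : ∀ t, ∀ x ∈ fil A t, b x ∈ fil A (t - δ))
    (hab : ∀ t, ∀ x ∈ fil A t, (a - b) x ∈ fil A (t + c)) (k : ℕ) {t : ℝ} {x : E}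
    (hx : x ∈ fil A t) : (a ^ (k + 1) - b ^ (k + 1)) x ∈ fil A (t + c - k * δ) := by
  induction k with
  | zero => simpa using hab t x hx
  | succ k ih =>
    have h : a ^ (k + 1 + 1) - b ^ (k + 1 + 1) =
        a * (a ^ (k + 1) - b ^ (k + 1)) + (a - b) * b ^ (k + 1) := by
      rw [pow_succ' a (k + 1), pow_succ' b (k + 1)]; noncomm_ring
    rw [h, LinearMap.add_apply, Module.End.mul_apply, Module.End.mul_apply]
    refine add_mem ?_ ?_
    · convert ha _ _ ih using 2
      push_cast; ring
    · convert hab _ _ (pow_mem_fil hb (k + 1) hx) using 2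
      push_cast; ring

/-- A map that contracts the filtration has a unique fixed point, reached by iteration from `0`. -/
lemma iterate_eq_of_contracts {A : Module.End ℂ E} {δ c₀ : ℝ} (hc₀ : fil A c₀ = ⊥)
    (D : Submodule ℂ E) (hD : D ≤ fil A (-δ)) (S : E → E) (hS : ∀ x ∈ D, S x ∈ D)
    (hS' : ∀ x ∈ D, ∀ y ∈ D, ∀ c, x - y ∈ fil A c → S x - S y ∈ fil A (c - δ)) {N : ℕ}
    (hN : -δ - N * δ ≤ c₀) {x y : E} (hx : x ∈ D) (hy : y ∈ D) : S^[N] x = S^[N] y := by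
  -- Differences start in level `-δ` and drop by `δ` at each step, until they reach the level `c₀`,
  -- where the filtration is zero.
  have h : ∀ k : ℕ, S^[k] x ∈ D ∧ S^[k] y ∈ D ∧ S^[k] x - S^[k] y ∈ fil A (-δ - k * δ) := by
    intro k
    induction k with
    | zero => simpa using ⟨hx, hy, hD (sub_mem hx hy)⟩
    | succ k ih =>
      obtain ⟨h₁, h₂, h₃⟩ := ih
      simp only [Function.iterate_succ_apply']
      refine ⟨hS _ h₁, hS _ h₂, ?_⟩
      convert hS' _ h₁ _ h₂ _ h₃ using 2
      push_cast; ring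
  have := fil_mono A hN (h N).2.2
  rw [hc₀, Submodule.mem_bot] at this
  exact sub_eq_zero.1 this

end Filtration

/-! ### Simultaneous diagonalization -/

section Joint

/-- A commuting family of symmetric operators has an orthonormal basis of joint eigenvectors. -/
lemma exists_joint_eigenbasis {E ι : Type*} [NormedAddCommGroup E] [InnerProductSpace ℂ E]
    [FiniteDimensional ℂ E] (T : ι → Module.End ℂ E) (hT : ∀ i, (T i).IsSymmetric)
    (hc : ∀ i j, Commute (T i) (T j)) :
    ∃ (N : ℕ) (b : OrthonormalBasis (Fin N) ℂ E) (χ : Fin N → ι → ℝ),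
      ∀ k i, T i (b k) = (χ k i : ℂ) • b k := by
  classical
  have hint := LinearMap.IsSymmetric.directSum_isInternal_of_pairwise_commute hT
    (fun i j _ => hc i j)
  have hfam := LinearMap.IsSymmetric.orthogonalFamily_iInf_eigenspaces hT
  -- The family is indexed by all functions `ι → ℂ`; only finitely many joint eigenspaces are
  -- nonzero, and these carry the basis.
  have hfin : {χ : ι → ℂ | (⨅ j, Module.End.eigenspace (T j) (χ j)) ≠ ⊥}.Finite :=
    WellFoundedGT.finite_ne_bot_of_iSupIndep hint.submodule_iSupIndep
  have hint' := DirectSum.isInternal_ne_bot_iff.2 hint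
  have : Fintype {χ : ι → ℂ // (⨅ j, Module.End.eigenspace (T j) (χ j)) ≠ ⊥} := hfin.fintype
  have hfam' : OrthogonalFamily ℂ
      (fun χ : {χ : ι → ℂ // (⨅ j, Module.End.eigenspace (T j) (χ j)) ≠ ⊥} =>
        (⨅ j, Module.End.eigenspace (T j) (χ.1 j) : Submodule ℂ E))
      fun χ => (⨅ j, Module.End.eigenspace (T j) (χ.1 j)).subtypeₗᵢ :=
    hfam.comp Subtype.val_injective
  let b := hint'.subordinateOrthonormalBasis rfl hfam'
  have hb : ∀ k i, ∃ r : ℝ, T i (b k) = (r : ℂ) • b k := by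
    intro k i
    have h1 := hint'.subordinateOrthonormalBasis_subordinate rfl k hfam'
    have h2 := (Submodule.mem_iInf _).1 h1 i
    rw [Module.End.mem_eigenspace_iff] at h2
    set z := (hint'.subordinateOrthonormalBasisIndex rfl k hfam').1 i with hz
    refine ⟨z.re, ?_⟩
    have h0 : b k ≠ 0 := b.orthonormal.ne_zero k
    have hconj := (hT i).conj_eigenvalue_eq_self
      (Module.End.hasEigenvalue_of_hasEigenvector ⟨Module.End.mem_eigenspace_iff.2 h2, h0⟩)
    rw [Complex.conj_eq_iff_re.1 hconj]
    exact h2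
  choose χ hχ using hb
  exact ⟨_, b, χ, hχ⟩

variable {n : Type*} [Fintype n] [DecidableEq n]

/-- The commutator with a fixed matrix. -/
def adMat (α : Matrix n n ℂ) : Module.End ℂ (Matrix n n ℂ) :=
  LinearMap.mulLeft ℂ α - LinearMap.mulRight ℂ α

@[simp] lemma adMat_apply (α X : Matrix n n ℂ) : adMat α X = α * X - X * α := rfl

open scoped ComplexOrder in
/-- The trace form `tr (Xᴴ Y)` as an inner product. -/
@[reducible] def traceCore (V : Submodule ℂ (Matrix n n ℂ)) : InnerProductSpace.Core ℂ V where
  inner X Y := ((X : Matrix n n ℂ)ᴴ * Y).trace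
  conj_inner_symm X Y := by
    rw [starRingEnd_apply, ← Matrix.trace_conjTranspose]
    simp
  re_inner_nonneg X := by
    have := (Matrix.posSemidef_conjTranspose_mul_self (X : Matrix n n ℂ)).trace_nonneg
    exact (Complex.le_def.1 this).1
  add_left X Y Z := by simp [Matrix.add_mul]
  smul_left X Y r := by simp
  definite X h := by
    have := Matrix.trace_conjTranspose_mul_self_eq_zero_iff.1 h
    exact Subtype.ext this

/-- Two commuting hermitian matrices have a joint eigenbasis on every subspace of matrices that is
stable under the commutators with them. -/
lemma exists_joint_adMat_basis (V : Submodule ℂ (Matrix n n ℂ)) (α β : Matrix n n ℂ)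
    (hα : αᴴ = α) (hβ : βᴴ = β) (hαβ : α * β = β * α) (hαV : ∀ X ∈ V, adMat α X ∈ V)
    (hβV : ∀ X ∈ V, adMat β X ∈ V) :
    ∃ (N : ℕ) (b : Module.Basis (Fin N) ℂ V) (a c : Fin N → ℝ), ∀ k,
      adMat α (b k) = (a k : ℂ) • (b k : Matrix n n ℂ) ∧
      adMat β (b k) = (c k : ℂ) • (b k : Matrix n n ℂ) := by
  let _ := (traceCore V).toNormedAddCommGroup
  let _ := InnerProductSpace.ofCore (traceCore V).toCore
  -- Cyclicity of the trace makes the commutator with a hermitian matrix symmetric.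
  have hsymm : ∀ (γ : Matrix n n ℂ) (h : ∀ X ∈ V, adMat γ X ∈ V), γᴴ = γ →
      ((adMat γ).restrict h).IsSymmetric := by
    intro γ h hγ X Y
    change (((adMat γ X))ᴴ * (Y : Matrix n n ℂ)).trace = ((X : Matrix n n ℂ)ᴴ * adMat γ Y).trace
    simp only [adMat_apply, Matrix.conjTranspose_sub, Matrix.conjTranspose_mul, hγ,
      Matrix.sub_mul, Matrix.mul_sub, Matrix.trace_sub, Matrix.mul_assoc]
    rw [Matrix.trace_mul_comm γ, Matrix.mul_assoc]
  let T : Bool → Module.End ℂ V := fun i =>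
    if i then (adMat α).restrict hαV else (adMat β).restrict hβV
  have hcomm : Commute ((adMat α).restrict hαV) ((adMat β).restrict hβV) := by
    ext1 X
    apply Subtype.ext
    change adMat α (adMat β X) = adMat β (adMat α X)
    simp only [adMat_apply, Matrix.mul_sub, Matrix.sub_mul, ← Matrix.mul_assoc, hαβ]
    simp only [Matrix.mul_assoc, hαβ]
    abel
  obtain ⟨N, b, χ, hb⟩ := exists_joint_eigenbasis T
    (by rintro (_ | _); exacts [hsymm β hβV hβ, hsymm α hαV hα])
    (by rintro (_ | _) (_ | _); exacts [Commute.refl _, hcomm.symm, hcomm, Commute.refl _])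
  refine ⟨N, b.toBasis, fun k => χ k true, fun k => χ k false, fun k => ⟨?_, ?_⟩⟩
  · have := congrArg Subtype.val (hb k true)
    simpa using! this
  · have := congrArg Subtype.val (hb k false)
    simpa using! this

end Joint

/-! ### The exponential map of a Banach algebra -/

section Banach

open NormedSpace

variable {𝔸 : Type*} [NormedRing 𝔸] [NormedAlgebra ℂ 𝔸] [CompleteSpace 𝔸]

/-- The inverse function theorem at `0`. The right inverse serves the Lie product formula, the left
inverse the local injectivity of the exponential. -/
lemma exists_local_log : ∃ L : 𝔸 → 𝔸, HasFDerivAt L (1 : 𝔸 →L[ℂ] 𝔸) 1 ∧ L 1 = 0 ∧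
    (∀ᶠ y in 𝓝 1, exp (L y) = y) ∧ ∀ᶠ x in 𝓝 0, L (exp x) = x := by
  have h : HasStrictFDerivAt (exp : 𝔸 → 𝔸)
      ((ContinuousLinearEquiv.refl ℂ 𝔸 : 𝔸 ≃L[ℂ] 𝔸) : 𝔸 →L[ℂ] 𝔸) 0 :=
    hasStrictFDerivAt_exp_zero
  refine ⟨h.localInverse _ _ _, ?_, ?_, ?_, h.eventually_left_inverse⟩
  · have := h.to_localInverse.hasFDerivAt
    rw [exp_zero] at this
    exact this
  · have := h.localInverse_apply_image
    rwa [exp_zero] at this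
  · have := h.eventually_right_inverse
    rwa [exp_zero] at this

lemma tendsto_natCast_inv_punctured :
    Filter.Tendsto (fun k : ℕ => ((k : ℂ))⁻¹) Filter.atTop (𝓝[≠] 0) := by
  refine tendsto_nhdsWithin_iff.2 ⟨?_, ?_⟩
  · exact tendsto_inv_atTop_nhds_zero_nat (𝕜 := ℂ)
  · filter_upwards [Filter.eventually_gt_atTop 0] with k hk
    simpa using hk.ne'

lemma tendsto_natCast_smul {F : Type*} [NormedAddCommGroup F] [NormedSpace ℂ F] {f : ℂ → F}
    {f' : F} (h : HasDerivAt f f' 0) (h0 : f 0 = 0) :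
    Filter.Tendsto (fun k : ℕ => (k : ℂ) • f (k : ℂ)⁻¹) Filter.atTop (𝓝 f') := by
  have := (hasDerivAt_iff_tendsto_slope_zero.1 h).comp tendsto_natCast_inv_punctured
  refine this.congr fun k => ?_
  simp [h0]

lemma hasDerivAt_exp_smul_zero (X : 𝔸) : HasDerivAt (fun z : ℂ => exp (z • X)) X 0 := by
  simpa using hasDerivAt_exp_smul_const X (0 : ℂ)

/-- The Lie product formula. -/
lemma tendsto_exp_mul_exp_pow (X Y : 𝔸) :
    Filter.Tendsto (fun k : ℕ => (exp ((k : ℂ)⁻¹ • X) * exp ((k : ℂ)⁻¹ • Y)) ^ k)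
      Filter.atTop (𝓝 (exp (X + Y))) := by
  let _ : NormedAlgebra ℚ 𝔸 := NormedAlgebra.restrictScalars ℚ ℂ 𝔸
  obtain ⟨L, hL, hL0, hexp, -⟩ := exists_local_log (𝔸 := 𝔸)
  have hγ : HasDerivAt (fun z : ℂ => exp (z • X) * exp (z • Y)) (X + Y) 0 := by
    simpa using (hasDerivAt_exp_smul_zero X).fun_mul (hasDerivAt_exp_smul_zero Y)
  have hγ0 : exp ((0 : ℂ) • X) * exp ((0 : ℂ) • Y) = 1 := by simp
  have hLγ : HasDerivAt (fun z : ℂ => L (exp (z • X) * exp (z • Y))) (X + Y) 0 := by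
    have h1 : HasFDerivAt L (1 : 𝔸 →L[ℂ] 𝔸) (exp ((0 : ℂ) • X) * exp ((0 : ℂ) • Y)) := by
      rwa [hγ0]
    simpa using! h1.comp_hasDerivAt 0 hγ
  -- `k` times the logarithm of the product at `1/k` tends to `X + Y`; exponentiation turns the
  -- factor `k` into a `k`-th power.
  have h2 := tendsto_natCast_smul hLγ (by simp [hL0])
  have h3 := (exp_continuous (𝔸 := 𝔸)).continuousAt.tendsto.comp h2
  refine h3.congr' ?_
  have h4 : Filter.Tendsto (fun k : ℕ => exp ((k : ℂ)⁻¹ • X) * exp ((k : ℂ)⁻¹ • Y)) Filter.atTop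
      (𝓝 1) := by
    rw [← hγ0]
    exact hγ.continuousAt.tendsto.comp (tendsto_natCast_inv_punctured.mono_right inf_le_left)
  filter_upwards [h4.eventually hexp] with k hk
  simp only [Function.comp_apply]
  rw [Nat.cast_smul_eq_nsmul, exp_nsmul, hk]

/-- The source of brackets, both in `𝔤` and in the derived representation. -/
lemma hasDerivAt_exp_conj (X Y : 𝔸) :
    HasDerivAt (fun z : ℂ => exp (z • X) * Y * exp (-(z • X))) (X * Y - Y * X) 0 := by
  have h1 := (hasDerivAt_exp_smul_zero X).mul_const Y
  have h2 : HasDerivAt (fun z : ℂ => exp (-(z • X))) (-X) 0 := by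
    simpa using hasDerivAt_exp_smul_zero (-X)
  have := h1.fun_mul h2
  simpa [sub_eq_add_neg] using this

lemma deriv_mem_submodule {F : Type*} [NormedAddCommGroup F] [NormedSpace ℂ F]
    [FiniteDimensional ℂ F] (S : Submodule ℂ F) {f : ℂ → F} {f' : F} (h : HasDerivAt f f' 0)
    (hf : ∀ z, f z ∈ S) : f' ∈ S := by
  refine S.closed_of_finiteDimensional.mem_of_tendsto (hasDerivAt_iff_tendsto_slope_zero.1 h)
    (Filter.Eventually.of_forall fun t => ?_)
  exact S.smul_mem _ (sub_mem (hf _) (hf _))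

end Banach

/-! ### The Lie algebra of a closed subgroup -/

section Group

open scoped Matrix.Norms.Operator

variable {n : Type*} [Fintype n] [DecidableEq n]

@[simp] lemma coe_expGL (X : Matrix n n ℂ) :
    ((expGL X : Matrix.GeneralLinearGroup n ℂ) : Matrix n n ℂ) = NormedSpace.exp X := rfl

@[simp] lemma expGL_zero : expGL (0 : Matrix n n ℂ) = 1 :=
  Units.ext NormedSpace.exp_zero

lemma expGL_add {X Y : Matrix n n ℂ} (h : Commute X Y) :
    expGL (X + Y) = expGL X * expGL Y :=
  Units.ext (Matrix.exp_add_of_commute X Y h)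

lemma expGL_neg (X : Matrix n n ℂ) : expGL (-X) = (expGL X)⁻¹ := by
  apply eq_inv_of_mul_eq_one_left
  rw [← expGL_add (Commute.refl X).neg_left]
  simp

lemma expGL_nsmul (k : ℕ) (X : Matrix n n ℂ) : expGL (k • X) = expGL X ^ k :=
  Units.ext (Matrix.exp_nsmul k X)

lemma expGL_zsmul (k : ℤ) (X : Matrix n n ℂ) : expGL (k • X) = expGL X ^ k := by
  obtain ⟨m, rfl | rfl⟩ := k.eq_nat_or_neg
  · rw [natCast_zsmul, zpow_natCast, expGL_nsmul]
  · rw [neg_smul, natCast_zsmul, zpow_neg, zpow_natCast, expGL_neg, expGL_nsmul]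

lemma continuous_exp_matrix :
    Continuous (NormedSpace.exp : Matrix n n ℂ → Matrix n n ℂ) :=
  NormedSpace.exp_continuous

lemma continuous_expGL : Continuous (expGL : Matrix n n ℂ → Matrix.GeneralLinearGroup n ℂ) :=
  Units.continuous_iff.2 ⟨continuous_exp_matrix, continuous_exp_matrix.comp continuous_neg⟩

lemma isEmbedding_coe_GL : Topology.IsEmbedding
    (fun g : Matrix.GeneralLinearGroup n ℂ => (g : Matrix n n ℂ)) :=
  (Units.isOpenEmbedding_val (R := Matrix n n ℂ)).isEmbedding

namespace ReductiveGroup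

variable (G : ReductiveGroup n)

/-- If nonzero `Y j → 0` in `M` had exponentials in `G`, their directions would accumulate at a unit
vector `v ∈ M`. Integer multiples of `Y j` approximate `t v`, so `exp(tv) ∈ G` by closedness and `v
∈ 𝔤 ∩ M = 0`. -/
lemma exists_forall_small_of_disjoint (M : Submodule ℂ (Matrix n n ℂ)) (hM : Disjoint G.lie M) :
    ∃ ε > 0, ∀ Y ∈ M, ‖Y‖ < ε → expGL Y ∈ G.carrier → Y = 0 := by
  by_contra! hcon
  choose Y hYM hYn hYG hY0 using fun j : ℕ => hcon (1 / ((j : ℝ) + 1)) Nat.one_div_pos_of_nat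
  have hpos : ∀ j, 0 < ‖Y j‖ := fun j => norm_pos_iff.2 (hY0 j)
  have hYlim : Filter.Tendsto (fun j => ‖Y j‖) Filter.atTop (𝓝 0) :=
    squeeze_zero (fun _ => norm_nonneg _) (fun j => (hYn j).le)
      tendsto_one_div_add_atTop_nhds_zero_nat
  let u : ℕ → Matrix n n ℂ := fun j => (‖Y j‖⁻¹ : ℝ) • Y j
  have hu : ∀ j, u j ∈ Metric.sphere (0 : Matrix n n ℂ) 1 := by
    intro j
    simp only [u, mem_sphere_zero_iff_norm, norm_smul, norm_inv, norm_norm]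
    exact inv_mul_cancel₀ (hpos j).ne'
  have : ProperSpace (Matrix n n ℂ) := FiniteDimensional.proper ℂ _
  obtain ⟨v, hv, φ, hφ, hlim⟩ := (isCompact_sphere (0 : Matrix n n ℂ) 1).tendsto_subseq hu
  have hvM : v ∈ M := by
    refine M.closed_of_finiteDimensional.mem_of_tendsto hlim (Filter.Eventually.of_forall ?_)
    intro j
    exact (M.restrictScalars ℝ).smul_mem _ (hYM _)
  have hvG : v ∈ G.lie := by
    rw [G.mem_lie]
    intro t
    -- Integer multiples keep the exponential in `G`; the rounding error is at most `‖Y (φ j)‖`.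
    let k : ℕ → ℤ := fun j => ⌊t / ‖Y (φ j)‖⌋
    have hk : Filter.Tendsto (fun j => (k j : ℝ) * ‖Y (φ j)‖) Filter.atTop (𝓝 t) := by
      rw [tendsto_iff_norm_sub_tendsto_zero]
      refine squeeze_zero (fun _ => norm_nonneg _) (fun j => ?_) (hYlim.comp hφ.tendsto_atTop)
      have h1 := Int.floor_le (t / ‖Y (φ j)‖)
      have h2 := Int.lt_floor_add_one (t / ‖Y (φ j)‖)
      rw [le_div_iff₀ (hpos _)] at h1
      rw [div_lt_iff₀ (hpos _)] at h2
      simp only [Function.comp_apply, Real.norm_eq_abs, abs_le, k]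
      constructor <;> linarith
    have hlim2 := (continuous_expGL (n := n)).continuousAt.tendsto.comp (hk.smul hlim)
    have hGc : (t : ℂ) • v = t • v := by simp
    rw [hGc]
    refine G.isClosed.mem_of_tendsto hlim2 (Filter.Eventually.of_forall fun j => ?_)
    have : ((k j : ℝ) * ‖Y (φ j)‖) • (u ∘ φ) j = k j • Y (φ j) := by
      simp only [u, Function.comp_apply, smul_smul]
      rw [mul_assoc, mul_inv_cancel₀ (hpos _).ne', mul_one, Int.cast_smul_eq_zsmul]
    simp only [Function.comp_apply] at this ⊢
    rw [this, expGL_zsmul]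
    exact G.carrier.zpow_mem (hYG _) _
  have h0 : v = 0 := by simpa using (Submodule.disjoint_def.1 hM) v hvG hvM
  simp [h0] at hv

/-- Elements of `G` near the identity are exponentials of small elements of the Lie algebra. -/
lemma exists_exp_near {U : Set (Matrix n n ℂ)} (hU : U ∈ 𝓝 0) :
    ∃ V ∈ 𝓝 (1 : Matrix n n ℂ), ∀ g ∈ G.carrier, (g : Matrix n n ℂ) ∈ V →
      ∃ X ∈ G.lie, X ∈ U ∧ expGL X = g := by
  obtain ⟨M, hM⟩ := Submodule.exists_isCompl G.lie
  obtain ⟨ε, hε, hsmall⟩ := G.exists_forall_small_of_disjoint M hM.disjoint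
  let e : (G.lie × M) ≃L[ℂ] Matrix n n ℂ :=
    (Submodule.prodEquivOfIsCompl G.lie M hM).toContinuousLinearEquiv
  let ψ : G.lie × M → Matrix n n ℂ := fun p =>
    NormedSpace.exp (p.1 : Matrix n n ℂ) * NormedSpace.exp (p.2 : Matrix n n ℂ)
  -- The derivative of `exp X exp Y` at the origin is the sum map on `𝔤 ⊕ M`, an isomorphism, so
  -- such products fill a neighbourhood of `1`.
  have hψ : HasStrictFDerivAt ψ (e : (G.lie × M) →L[ℂ] Matrix n n ℂ) 0 := by
    have hexp : HasStrictFDerivAt (NormedSpace.exp) (1 : Matrix n n ℂ →L[ℂ] Matrix n n ℂ) 0 :=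
      hasStrictFDerivAt_exp_zero
    have h1 : HasStrictFDerivAt (fun p : G.lie × M => NormedSpace.exp (p.1 : Matrix n n ℂ))
        (G.lie.subtypeL ∘L ContinuousLinearMap.fst ℂ G.lie M) 0 := by
      have h := (G.lie.subtypeL ∘L ContinuousLinearMap.fst ℂ G.lie M).hasStrictFDerivAt (x := 0)
      exact HasStrictFDerivAt.comp (g := NormedSpace.exp) 0 (by rw [map_zero]; exact hexp) h
    have h2 : HasStrictFDerivAt (fun p : G.lie × M => NormedSpace.exp (p.2 : Matrix n n ℂ))
        (M.subtypeL ∘L ContinuousLinearMap.snd ℂ G.lie M) 0 := by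
      have h := (M.subtypeL ∘L ContinuousLinearMap.snd ℂ G.lie M).hasStrictFDerivAt (x := 0)
      exact HasStrictFDerivAt.comp (g := NormedSpace.exp) 0 (by rw [map_zero]; exact hexp) h
    refine (h1.mul' h2).congr_fderiv ?_
    refine ContinuousLinearMap.ext fun p => ?_
    change NormedSpace.exp (0 : Matrix n n ℂ) * (p.2 : Matrix n n ℂ) +
      (p.1 : Matrix n n ℂ) * NormedSpace.exp (0 : Matrix n n ℂ) = p.1 + p.2
    rw [NormedSpace.exp_zero, one_mul, mul_one, add_comm]
  have hmap := hψ.map_nhds_eq_of_equiv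
  have hψ0 : ψ 0 = 1 := by simp [ψ]
  rw [hψ0] at hmap
  have hfst : Filter.Tendsto (fun p : G.lie × M => (p.1 : Matrix n n ℂ)) (𝓝 0) (𝓝 0) :=
    Continuous.tendsto' (by fun_prop) _ _ (by simp)
  have hsnd : Filter.Tendsto (fun p : G.lie × M => (p.2 : Matrix n n ℂ)) (𝓝 0) (𝓝 0) :=
    Continuous.tendsto' (by fun_prop) _ _ (by simp)
  have hS : {p : G.lie × M | (p.1 : Matrix n n ℂ) ∈ U ∧ ‖(p.2 : Matrix n n ℂ)‖ < ε} ∈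
      𝓝 (0 : G.lie × M) := by
    filter_upwards [hfst hU, hsnd (Metric.ball_mem_nhds 0 hε)] with p h1 h2
    exact ⟨h1, by simpa using h2⟩
  refine ⟨_, hmap ▸ Filter.image_mem_map hS, ?_⟩
  rintro g hg ⟨p, ⟨hpU, hpε⟩, hpg⟩
  have hgeq : expGL (p.1 : Matrix n n ℂ) * expGL (p.2 : Matrix n n ℂ) = g := Units.ext hpg
  have h2 : expGL (p.2 : Matrix n n ℂ) ∈ G.carrier := by
    rw [← inv_mul_cancel_left (expGL (p.1 : Matrix n n ℂ)) (expGL (p.2 : Matrix n n ℂ)), hgeq]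
    exact G.carrier.mul_mem (G.carrier.inv_mem (G.expGL_mem p.1.2)) hg
  -- The complementary factor lies in `G` and has a small exponent, hence is trivial.
  have h0 := hsmall _ p.2.2 hpε h2
  refine ⟨p.1, p.1.2, hpU, ?_⟩
  rw [← hgeq, h0]
  simp

/-- A connected group is generated by the exponentials of its Lie algebra. -/
lemma eq_top_of_exp_mem (H : Subgroup G.carrier) (h : ∀ X : G.lie, G.exp X ∈ H) : H = ⊤ := by
  obtain ⟨V, hV, hVG⟩ := G.exists_exp_near Filter.univ_mem
  have hnhds : (H : Set G.carrier) ∈ 𝓝 (1 : G.carrier) := by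
    have hc : Filter.Tendsto (fun g : G.carrier =>
        ((g : Matrix.GeneralLinearGroup n ℂ) : Matrix n n ℂ)) (𝓝 1) (𝓝 1) :=
      Continuous.tendsto' (Units.continuous_val.comp continuous_subtype_val) _ _ (by simp)
    filter_upwards [hc hV] with g hg
    obtain ⟨X, hX, -, hXg⟩ := hVG g g.2 hg
    have : g = G.exp ⟨X, hX⟩ := Subtype.ext hXg.symm
    rw [this]
    exact h _
  have hopen : IsOpen (H : Set G.carrier) := H.isOpen_of_mem_nhds hnhds
  have : ConnectedSpace G.carrier := isConnected_iff_connectedSpace.1 G.isConnected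
  have huniv := IsClopen.eq_univ ⟨H.isClosed_of_isOpen hopen, hopen⟩ ⟨1, H.one_mem⟩
  exact SetLike.coe_injective (by simpa using huniv)

lemma conj_mem_lie {g : Matrix.GeneralLinearGroup n ℂ} (hg : g ∈ G.carrier) {X : Matrix n n ℂ}
    (hX : X ∈ G.lie) :
    (g : Matrix n n ℂ) * X * ((g⁻¹ : Matrix.GeneralLinearGroup n ℂ) : Matrix n n ℂ) ∈ G.lie := by
  refine (G.mem_lie _).2 fun t => ?_
  have := G.carrier.mul_mem (G.carrier.mul_mem hg ((G.mem_lie _).1 hX t)) (G.carrier.inv_mem hg)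
  rw [← expGL_conj] at this
  simpa using this

lemma commutator_mem_lie {X Y : Matrix n n ℂ} (hX : X ∈ G.lie) (hY : Y ∈ G.lie) :
    X * Y - Y * X ∈ G.lie := by
  refine deriv_mem_submodule G.lie (hasDerivAt_exp_conj X Y) fun z => ?_
  have := G.conj_mem_lie (G.expGL_mem (G.lie.smul_mem z hX)) hY
  rwa [← expGL_neg] at this

/-- By the Cartan decomposition `G` is stable under conjugate transposition: `(k exp P)ᴴ = exp P ·
k⁻¹`. -/
lemma conjTranspose_mem_lie {X : Matrix n n ℂ} (hX : X ∈ G.lie) : Xᴴ ∈ G.lie := by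
  refine (G.mem_lie _).2 fun t => ?_
  obtain ⟨k, hk, P, hP, hkU, hPH, hg⟩ := G.cartan _ ((G.mem_lie X).1 hX t)
  have hinv : ((k⁻¹ : Matrix.GeneralLinearGroup n ℂ) : Matrix n n ℂ) = (k : Matrix n n ℂ)ᴴ :=
    Units.inv_eq_of_mul_eq_one_left hkU.1
  have : expGL ((t : ℂ) • Xᴴ) = expGL P * k⁻¹ := by
    apply Units.ext
    have h1 := congrArg (fun g : Matrix.GeneralLinearGroup n ℂ => (g : Matrix n n ℂ)ᴴ) hg
    simp only [coe_expGL, Units.val_mul, Matrix.conjTranspose_mul, ← Matrix.exp_conjTranspose,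
      hPH, Matrix.conjTranspose_smul, ← hinv] at h1
    simpa using h1
  rw [this]
  exact G.carrier.mul_mem (G.expGL_mem hP) (G.carrier.inv_mem hk)

lemma exp_mem_maxCompact (X : G.lie) (hX : (X : Matrix n n ℂ)ᴴ = -X) :
    G.exp X ∈ G.maxCompact := by
  change NormedSpace.exp (X : Matrix n n ℂ) ∈ Matrix.unitaryGroup n ℂ
  refine Matrix.mem_unitaryGroup_iff.2 ?_
  rw [Matrix.star_eq_conjTranspose, ← Matrix.exp_conjTranspose, hX,
    ← Matrix.exp_add_of_commute _ _ (Commute.refl (X : Matrix n n ℂ)).neg_right]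
  simp

end ReductiveGroup

end Group

/-! ### The derived representation -/

section Derived

variable {n : Type*} [Fintype n] [DecidableEq n]

namespace ReductiveGroup

variable (G : ReductiveGroup n)

lemma coe_exp (X : G.lie) : ((G.exp X : G.carrier) : Matrix.GeneralLinearGroup n ℂ) =
    expGL (X : Matrix n n ℂ) := rfl

@[simp] lemma exp_zero : G.exp 0 = 1 := Subtype.ext (by rw [coe_exp]; simp)

lemma exp_add_smul (z w : ℂ) (X : G.lie) :
    G.exp ((z + w) • X) = G.exp (z • X) * G.exp (w • X) := by
  apply Subtype.ext
  change expGL (((z + w) • X : G.lie) : Matrix n n ℂ) = expGL _ * expGL _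
  rw [← expGL_add]
  · simp [add_smul]
  · exact ((Commute.refl (X : Matrix n n ℂ)).smul_left z).smul_right w

lemma exp_neg (X : G.lie) : G.exp (-X) = (G.exp X)⁻¹ :=
  Subtype.ext (expGL_neg _)

/-- The adjoint action of `G` on its Lie algebra. -/
def conj (g : G.carrier) (X : G.lie) : G.lie :=
  ⟨((g : Matrix.GeneralLinearGroup n ℂ) : Matrix n n ℂ) * X *
    (((g : Matrix.GeneralLinearGroup n ℂ)⁻¹ : Matrix.GeneralLinearGroup n ℂ) : Matrix n n ℂ),
    G.conj_mem_lie g.2 X.2⟩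

lemma exp_conj (g : G.carrier) (X : G.lie) : G.exp (G.conj g X) = g * G.exp X * g⁻¹ :=
  Subtype.ext (expGL_conj _ _)

lemma conj_smul (g : G.carrier) (z : ℂ) (X : G.lie) : G.conj g (z • X) = z • G.conj g X :=
  Subtype.ext (by simp [conj])

/-- The adjoint representation of the Lie algebra. -/
def ad (X : G.lie) : Module.End ℂ G.lie :=
  (adMat (X : Matrix n n ℂ)).restrict fun _ hY => G.commutator_mem_lie X.2 hY

@[simp] lemma coe_ad (X Y : G.lie) : (G.ad X Y : Matrix n n ℂ) = X * Y - Y * X := rfl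

/-- The hermitian adjoint on the Lie algebra. -/
def lieStar (X : G.lie) : G.lie := ⟨(X : Matrix n n ℂ)ᴴ, G.conjTranspose_mem_lie X.2⟩

@[simp] lemma coe_lieStar (X : G.lie) : (G.lieStar X : Matrix n n ℂ) = (X : Matrix n n ℂ)ᴴ := rfl

end ReductiveGroup

namespace UnitaryRep

variable {G : ReductiveGroup n} {W : Type*} [NormedAddCommGroup W] [InnerProductSpace ℂ W]
  (ρ : UnitaryRep W G)

lemma hasDerivAt_rep (X : G.lie) (w : W) (z : ℂ) :
    HasDerivAt (fun z : ℂ => ρ.rep (G.exp (z • X)) w) (ρ.dρ X (ρ.rep (G.exp (z • X)) w)) z := by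
  have h0 : HasDerivAt (fun h : ℂ => ρ.rep (G.exp (h • X)) (ρ.rep (G.exp (z • X)) w))
      (ρ.dρ X (ρ.rep (G.exp (z • X)) w)) (z - z) := by
    rw [sub_self]
    exact (ρ.holomorphic X _ 0).hasDerivAt
  have := h0.comp_sub_const z z
  refine this.congr_of_eventuallyEq (Filter.Eventually.of_forall fun y => ?_)
  simp only
  rw [← Module.End.mul_apply, ← map_mul, ← G.exp_add_smul, sub_add_cancel]

lemma hasDerivAt_rep_zero (X : G.lie) (w : W) :
    HasDerivAt (fun z : ℂ => ρ.rep (G.exp (z • X)) w) (ρ.dρ X w) 0 := by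
  simpa using ρ.hasDerivAt_rep X w 0

lemma dρ_smul (c : ℂ) (X : G.lie) : ρ.dρ (c • X) = c • ρ.dρ X := by
  ext w
  have h1 : HasDerivAt (fun z : ℂ => ρ.rep (G.exp (z • X)) w) (ρ.dρ X w) (0 * c) := by
    simpa using ρ.hasDerivAt_rep_zero X w
  have h2 := HasDerivAt.scomp (0 : ℂ) h1 ((hasDerivAt_id (0 : ℂ)).mul_const c)
  have h3 := ρ.hasDerivAt_rep_zero (c • X) w
  have h4 := h3.unique (h2.congr_of_eventuallyEq
    (Filter.Eventually.of_forall fun z => by simp [smul_smul]))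
  simpa using h4

/-- Differentiates the unitarity of `exp(tX)`, an element of `K`, at `t = 0`. -/
lemma inner_dρ_of_skew (X : G.lie) (hX : (X : Matrix n n ℂ)ᴴ = -X) (v w : W) :
    ⟪ρ.dρ X v, w⟫_ℂ = -⟪v, ρ.dρ X w⟫_ℂ := by
  have hr : ∀ u : W, HasDerivAt (fun t : ℝ => ρ.rep (G.exp ((t : ℂ) • X)) u) (ρ.dρ X u) 0 := by
    intro u
    have := HasDerivAt.scomp_of_eq (0 : ℝ) (ρ.hasDerivAt_rep_zero X u)
      (Complex.ofRealCLM.hasDerivAt (x := 0)) (by simp)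
    simpa using! this
  have h1 := (hr v).inner ℂ (hr w)
  have h2 : HasDerivAt (fun _ : ℝ => ⟪v, w⟫_ℂ) 0 0 := hasDerivAt_const _ _
  have h3 := h1.unique (h2.congr_of_eventuallyEq (Filter.Eventually.of_forall fun t => by
    have hmem : G.exp ((t : ℂ) • X) ∈ G.maxCompact := G.exp_mem_maxCompact _ (by simp [hX])
    exact ρ.unitary ⟨_, hmem⟩ v w))
  simp only [Complex.ofReal_zero, zero_smul, ReductiveGroup.exp_zero, map_one,
    Module.End.one_apply] at h3
  rw [add_comm] at h3
  exact eq_neg_of_add_eq_zero_left h3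

lemma dρ_neg (X : G.lie) : ρ.dρ (-X) = -ρ.dρ X := by
  rw [← neg_one_smul ℂ X, dρ_smul, neg_one_smul]

variable [FiniteDimensional ℂ W]

lemma rep_mul_dρ (g : G.carrier) (X : G.lie) (w : W) :
    ρ.dρ (G.conj g X) (ρ.rep g w) = ρ.rep g (ρ.dρ X w) := by
  have h1 := ρ.hasDerivAt_rep_zero (G.conj g X) (ρ.rep g w)
  have h2 := (LinearMap.toContinuousLinearMap (ρ.rep g)).hasFDerivAt.comp_hasDerivAt (0 : ℂ)
    (ρ.hasDerivAt_rep_zero X w)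
  refine h1.unique (h2.congr_of_eventuallyEq (Filter.Eventually.of_forall fun z => ?_))
  simp only [Function.comp_apply, LinearMap.coe_toContinuousLinearMap']
  rw [← G.conj_smul, G.exp_conj, ← Module.End.mul_apply, ← map_mul, inv_mul_cancel_right,
    map_mul, Module.End.mul_apply]

/-- The derived representation as a continuous operator. -/
def dρc (X : G.lie) : W →L[ℂ] W := LinearMap.toContinuousLinearMap (ρ.dρ X)

@[simp] lemma dρc_apply (X : G.lie) (w : W) : ρ.dρc X w = ρ.dρ X w := rfl

lemma dρc_smul (c : ℂ) (X : G.lie) : ρ.dρc (c • X) = c • ρ.dρc X := by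
  ext w; simp [dρ_smul]

/-- `exp(-zA) ρ(exp(zX)) w` has zero derivative in `z`, hence keeps its initial value `w`. -/
lemma rep_exp (X : G.lie) (w : W) :
    ρ.rep (G.exp X) w = NormedSpace.exp (ρ.dρc X) w := by
  let _ : NormedAlgebra ℚ (W →L[ℂ] W) := NormedAlgebra.restrictScalars ℚ ℂ _
  let A := ρ.dρc X
  have hg : ∀ z : ℂ, HasDerivAt
      (fun z : ℂ => NormedSpace.exp (z • (-A)) (ρ.rep (G.exp (z • X)) w)) 0 z := by
    intro z
    have h1 := hasDerivAt_exp_smul_const (-A) z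
    have h2 := h1.clm_apply (ρ.hasDerivAt_rep X w z)
    convert h2 using 1
    simp [A]
  have hconst := is_const_of_deriv_eq_zero (fun z => (hg z).differentiableAt)
    (fun z => (hg z).deriv) 1 0
  simp only [one_smul, zero_smul, NormedSpace.exp_zero, ReductiveGroup.exp_zero, map_one,
    Module.End.one_apply, one_apply_eq_self] at hconst
  have hinv : NormedSpace.exp A * NormedSpace.exp (-A) = 1 := by
    rw [← NormedSpace.exp_add_of_commute (Commute.refl A).neg_right]
    simp
  conv_rhs => rw [← hconst]
  exact (congrArg (fun T : W →L[ℂ] W => T (ρ.rep (G.exp X) w)) hinv).symm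

open scoped Matrix.Norms.Operator in
-- The representation is only assumed continuous, and holomorphic along one-parameter groups, so
-- additivity of its derivative is not automatic. The Lie product formula, used in `G` and for
-- operators on `W`, gives it at the level of exponentials.
lemma exp_dρc_add (X Y : G.lie) :
    NormedSpace.exp (ρ.dρc (X + Y)) = NormedSpace.exp (ρ.dρc X + ρ.dρc Y) := by
  ext w
  rw [← rep_exp]
  let g : ℕ → G.carrier := fun k => (G.exp ((k : ℂ)⁻¹ • X) * G.exp ((k : ℂ)⁻¹ • Y)) ^ k
  have hg : Filter.Tendsto g Filter.atTop (𝓝 (G.exp (X + Y))) := by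
    rw [tendsto_subtype_rng, isEmbedding_coe_GL.tendsto_nhds_iff]
    exact tendsto_exp_mul_exp_pow (X : Matrix n n ℂ) (Y : Matrix n n ℂ)
  have h1 := ((ρ.continuous w).tendsto _).comp hg
  have h2 := ((ContinuousLinearMap.apply ℂ W w).continuous.tendsto _).comp
    (tendsto_exp_mul_exp_pow (ρ.dρc X) (ρ.dρc Y))
  refine tendsto_nhds_unique h1 (h2.congr fun k => ?_)
  have h3 : ∀ (k : ℕ) (z : ℂ) (v : W),
      ((NormedSpace.exp (z • ρ.dρc X) * NormedSpace.exp (z • ρ.dρc Y)) ^ k) v =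
      ρ.rep ((G.exp (z • X) * G.exp (z • Y)) ^ k) v := by
    intro k z v
    induction k generalizing v with
    | zero => simp
    | succ k ih =>
      rw [pow_succ, pow_succ, map_mul, mul_apply_eq_comp, Module.End.mul_apply, ih,
        map_mul, mul_apply_eq_comp, Module.End.mul_apply, ← dρc_smul, ← dρc_smul,
        ← rep_exp, ← rep_exp]
  exact h3 k _ w

lemma dρ_add (X Y : G.lie) : ρ.dρ (X + Y) = ρ.dρ X + ρ.dρ Y := by
  have h1 := hasDerivAt_exp_smul_zero (ρ.dρc (X + Y))
  have h2 := hasDerivAt_exp_smul_zero (ρ.dρc X + ρ.dρc Y)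
  have h3 : ρ.dρc (X + Y) = ρ.dρc X + ρ.dρc Y := by
    refine h1.unique (h2.congr_of_eventuallyEq (Filter.Eventually.of_forall fun z => ?_))
    simp only
    rw [← dρc_smul, smul_add, exp_dρc_add, smul_add, dρc_smul, dρc_smul]
  ext w
  exact congrArg (fun A : W →L[ℂ] W => A w) h3

/-- The derived representation as a linear map. -/
def dρL : G.lie →ₗ[ℂ] Module.End ℂ W where
  toFun := ρ.dρ
  map_add' := ρ.dρ_add
  map_smul' := ρ.dρ_smul

@[simp] lemma dρL_apply (X : G.lie) : ρ.dρL X = ρ.dρ X := rfl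

lemma dρc_neg (X : G.lie) : ρ.dρc (-X) = -ρ.dρc X := by
  ext w; simp [dρ_neg]

open scoped Matrix.Norms.Operator in
lemma dρ_ad (X Y : G.lie) (w : W) :
    ρ.dρ (G.ad X Y) w = ρ.dρ X (ρ.dρ Y w) - ρ.dρ Y (ρ.dρ X w) := by
  -- `D` extends the derived representation to all matrices, where the curve `exp(zX) Y exp(-zX)` is
  -- differentiated.
  obtain ⟨D, hD⟩ := LinearMap.exists_extend ρ.dρL
  have hD' : ∀ Z : G.lie, D Z = ρ.dρ Z := fun Z => LinearMap.congr_fun hD Z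
  have h1 : HasDerivAt (fun z : ℂ => D (NormedSpace.exp (z • (X : Matrix n n ℂ)) * Y *
      NormedSpace.exp (-(z • (X : Matrix n n ℂ)))) w) (ρ.dρ (G.ad X Y) w) 0 := by
    have := (LinearMap.toContinuousLinearMap
      ((LinearMap.applyₗ w) ∘ₗ D)).hasFDerivAt.comp_hasDerivAt (0 : ℂ)
      (hasDerivAt_exp_conj (X : Matrix n n ℂ) (Y : Matrix n n ℂ))
    rw [← hD']
    exact this
  have h2 := (ContinuousLinearMap.apply ℂ W w).hasFDerivAt.comp_hasDerivAt (0 : ℂ)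
    (hasDerivAt_exp_conj (ρ.dρc X) (ρ.dρc Y))
  refine h1.unique (h2.congr_of_eventuallyEq (Filter.Eventually.of_forall fun z => ?_))
  have h3 := ρ.rep_mul_dρ (G.exp (z • X)) Y (ρ.rep (G.exp (-(z • X))) w)
  rw [← Module.End.mul_apply (ρ.rep _), ← map_mul, G.exp_neg, mul_inv_cancel, map_one,
    Module.End.one_apply, ← hD', ← G.exp_neg, rep_exp, rep_exp] at h3
  have h4 : ((G.conj (G.exp (z • X)) Y : G.lie) : Matrix n n ℂ) =
      NormedSpace.exp (z • (X : Matrix n n ℂ)) * Y *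
      NormedSpace.exp (-(z • (X : Matrix n n ℂ))) := by
    change _ * _ * (((expGL _)⁻¹ : Matrix.GeneralLinearGroup n ℂ) : Matrix n n ℂ) = _
    rw [← expGL_neg]
    rfl
  rw [h4] at h3
  simp only
  rw [h3, dρc_neg, dρc_smul]
  rfl

/-- Write `X = S + iT` with `S`, `T` skew-hermitian; then `X* = -S + iT`, and the skew case applies
to both parts. -/
lemma inner_dρ (X : G.lie) (v w : W) : ⟪ρ.dρ X v, w⟫_ℂ = ⟪v, ρ.dρ (G.lieStar X) w⟫_ℂ := by
  let S : G.lie := (2⁻¹ : ℂ) • (X - G.lieStar X)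
  let T : G.lie := (-Complex.I * 2⁻¹ : ℂ) • (X + G.lieStar X)
  have hX : X = S + Complex.I • T := by
    simp only [S, T, smul_smul, ← mul_assoc, mul_neg, Complex.I_mul_I, neg_neg, one_mul]
    rw [← smul_add, show X - G.lieStar X + (X + G.lieStar X) = (2 : ℂ) • X by rw [two_smul]; abel,
      smul_smul]
    norm_num
  have hX' : G.lieStar X = -S + Complex.I • T := by
    have h : Complex.I • T = X - S := eq_sub_of_add_eq' hX.symm
    have h2 : S + S = X - G.lieStar X := by
      simp only [S]
      rw [← two_smul ℂ, smul_smul]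
      norm_num
    rw [h, show -S + (X - S) = X - (S + S) by abel, h2, sub_sub_cancel]
  have hS : (S : Matrix n n ℂ)ᴴ = -S := by
    simp [S, Matrix.conjTranspose_smul, ← smul_neg]
  have hT : (T : Matrix n n ℂ)ᴴ = -T := by
    simp [T, Matrix.conjTranspose_smul, add_comm]
  have h1 := ρ.inner_dρ_of_skew S hS v w
  have h2 := ρ.inner_dρ_of_skew T hT v w
  rw [hX']
  conv_lhs => rw [hX]
  rw [← neg_one_smul ℂ S]
  simp only [dρ_add, dρ_smul, LinearMap.add_apply, LinearMap.smul_apply, inner_add_left,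
    inner_add_right, inner_smul_left, inner_smul_right, h1, h2]
  simp

lemma rep_exp_mem (U : Submodule ℂ W) (X : G.lie) (hU : ∀ w ∈ U, ρ.dρ X w ∈ U) {w : W}
    (hw : w ∈ U) : ρ.rep (G.exp X) w ∈ U := by
  rw [rep_exp]
  have hsum := (NormedSpace.exp_series_hasSum_exp' (𝕂 := ℂ) (ρ.dρc X)).mapL
    (ContinuousLinearMap.apply ℂ W w)
  refine U.closed_of_finiteDimensional.mem_of_tendsto hsum
    (Filter.Eventually.of_forall fun s => U.sum_mem fun k _ => ?_)
  have hk : ∀ k : ℕ, (ρ.dρc X ^ k) w ∈ U := by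
    intro k
    induction k with
    | zero => simpa using hw
    | succ k ih => rw [pow_succ', mul_apply_eq_comp]; exact hU _ ih
  exact U.smul_mem _ (hk k)

/-- A subspace that is stable under the Lie algebra is stable under the group. -/
lemma rep_mem_of_dρ_mem (U : Submodule ℂ W) (hU : ∀ X : G.lie, ∀ w ∈ U, ρ.dρ X w ∈ U)
    (g : G.carrier) {w : W} (hw : w ∈ U) : ρ.rep g w ∈ U := by
  let H : Subgroup G.carrier :=
    { carrier := {g | (∀ w ∈ U, ρ.rep g w ∈ U) ∧ ∀ w ∈ U, ρ.rep g⁻¹ w ∈ U}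
      one_mem' := by simp
      mul_mem' := by
        rintro a b ⟨ha, ha'⟩ ⟨hb, hb'⟩
        refine ⟨fun w hw => ?_, fun w hw => ?_⟩
        · rw [map_mul]; exact ha _ (hb _ hw)
        · rw [mul_inv_rev, map_mul]; exact hb' _ (ha' _ hw)
      inv_mem' := by
        rintro a ⟨ha, ha'⟩
        exact ⟨ha', by simpa using ha⟩ }
  have hH : H = ⊤ := G.eq_top_of_exp_mem H fun X =>
    ⟨fun _ => ρ.rep_exp_mem U X (hU X), fun _ => by
      rw [← G.exp_neg]; exact ρ.rep_exp_mem U (-X) (hU (-X))⟩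
  have : g ∈ H := by rw [hH]; trivial
  exact this.1 w hw

lemma eq_top_of_dρ_mem (hirr : ρ.rep.IsIrreducible) (U : Submodule ℂ W)
    (hU : ∀ X : G.lie, ∀ w ∈ U, ρ.dρ X w ∈ U) (hne : U ≠ ⊥) : U = ⊤ := by
  let S : Subrepresentation ρ.rep := ⟨U, fun g _ hw => ρ.rep_mem_of_dρ_mem U hU g hw⟩
  rcases hirr.eq_bot_or_eq_top S with h | h
  · exact absurd (congrArg Subrepresentation.toSubmodule h) hne
  · exact congrArg Subrepresentation.toSubmodule h

/-- A vector killed by the Lie algebra is fixed by the group. -/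
lemma rep_eq_of_dρ_eq_zero {w : W} (hw : ∀ X : G.lie, ρ.dρ X w = 0) (g : G.carrier) :
    ρ.rep g w = w := by
  let H : Subgroup G.carrier :=
    { carrier := {g | ρ.rep g w = w}
      one_mem' := by simp
      mul_mem' := by
        intro a b (ha : _ = _) (hb : _ = _)
        simp [map_mul, ha, hb]
      inv_mem' := by
        intro a (ha : _ = _)
        change ρ.rep a⁻¹ w = w
        conv_lhs => rw [← ha, ← Module.End.mul_apply, ← map_mul]
        simp }
  have hH : H = ⊤ := G.eq_top_of_exp_mem H fun X => by
    have h := is_const_of_deriv_eq_zero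
      (fun z => (ρ.hasDerivAt_rep X w z).differentiableAt) (fun z => ?_) 1 0
    · simpa using! h
    · have hc : ρ.dρ X (ρ.rep (G.exp (z • X)) w) = ρ.rep (G.exp (z • X)) (ρ.dρ X w) := by
        have := ρ.rep_mul_dρ (G.exp (z • X)) X w
        rw [← this]
        congr 2
        apply Subtype.ext
        change _ = ((expGL (z • (X : Matrix n n ℂ)) : Matrix.GeneralLinearGroup n ℂ) : Matrix n n ℂ) * X *
          (((expGL (z • (X : Matrix n n ℂ)))⁻¹ : Matrix.GeneralLinearGroup n ℂ) : Matrix n n ℂ)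
        rw [Units.eq_mul_inv_iff_mul_eq]
        exact ((Commute.refl (X : Matrix n n ℂ)).smul_right z).exp_right
      rw [(ρ.hasDerivAt_rep X w z).deriv, hc, hw, map_zero]
  have : g ∈ H := by rw [hH]; trivial
  exact this

end UnitaryRep

end Derived

/-! ### Momentum maps -/

section Momentum

set_option linter.unusedSectionVars false

variable {n : Type*} [Fintype n] [DecidableEq n]

namespace ReductiveGroup

variable (G : ReductiveGroup n)

@[simp] lemma coe_ofP (X : G.𝔭) : (G.ofP X : Matrix n n ℂ) = X := rfl

lemma ofP_add (X Y : G.𝔭) : G.ofP (X + Y) = G.ofP X + G.ofP Y := rfl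

lemma ofP_smul (r : ℝ) (X : G.𝔭) : G.ofP (r • X) = (r : ℂ) • G.ofP X :=
  Subtype.ext (by simp [ofP])

@[simp] lemma lieStar_ofP (X : G.𝔭) : G.lieStar (G.ofP X) = G.ofP X := Subtype.ext X.2.2

/-- The bracket `[iη, X]` for `η, X ∈ 𝔭`. -/
def brk (η X : G.𝔭) : G.𝔭 :=
  ⟨Complex.I • ((η : Matrix n n ℂ) * X - X * η),
    G.lie.smul_mem _ (G.commutator_mem_lie η.2.1 X.2.1), by
      rw [Matrix.conjTranspose_smul, Matrix.conjTranspose_sub, Matrix.conjTranspose_mul,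
        Matrix.conjTranspose_mul, η.2.2, X.2.2, ← neg_sub, smul_neg]
      simp⟩

lemma coe_brk (η X : G.𝔭) :
    (G.brk η X : Matrix n n ℂ) = Complex.I • ((η : Matrix n n ℂ) * X - X * η) := rfl

lemma brk_neg (η X : G.𝔭) : G.brk (-η) X = -G.brk η X :=
  Subtype.ext (by
    change Complex.I • (-(η : Matrix n n ℂ) * X - X * -(η : Matrix n n ℂ)) = -(Complex.I • _)
    rw [← smul_neg]
    congr 1
    rw [Matrix.neg_mul, Matrix.mul_neg]
    abel)

lemma brk_eq_zero_iff {η X : G.𝔭} : G.brk η X = 0 ↔ (η : Matrix n n ℂ) * X = X * η := by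
  rw [← Subtype.coe_inj, coe_brk]
  simp [sub_eq_zero]

/-- The one-parameter group `exp(itη)` of `K`. -/
def expK (η : G.𝔭) (t : ℝ) : G.maxCompact :=
  ⟨G.exp (((t : ℂ) * Complex.I) • G.ofP η), G.exp_mem_maxCompact _ (by
    have h : (η : Matrix n n ℂ)ᴴ = η := η.2.2
    simp [h])⟩

lemma expK_neg (η : G.𝔭) (t : ℝ) : G.expK (-η) t = (G.expK η t)⁻¹ := by
  apply Subtype.ext
  change G.exp _ = (G.exp _)⁻¹
  rw [← G.exp_neg]
  congr 1
  exact Subtype.ext (by simp)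

lemma Ad_inv_Ad (k : G.maxCompact) (X : G.𝔭) : G.Ad k⁻¹ (G.Ad k X) = X := by
  apply Subtype.ext
  simp [Ad, Matrix.mul_assoc]

open scoped Matrix.Norms.Operator in
lemma hasDerivAt_Ad (f : G.𝔭 →ₗ[ℝ] ℝ) (η X : G.𝔭) :
    HasDerivAt (fun t : ℝ => f (G.Ad (G.expK η t) X)) (f (G.brk η X)) 0 := by
  obtain ⟨F, hF⟩ := LinearMap.exists_extend f
  have hF' : ∀ Z : G.𝔭, F Z = f Z := fun Z => LinearMap.congr_fun hF Z
  have h1 := hasDerivAt_exp_conj (Complex.I • (η : Matrix n n ℂ)) (X : Matrix n n ℂ)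
  have h2 := HasDerivAt.scomp_of_eq (0 : ℝ) h1 (Complex.ofRealCLM.hasDerivAt (x := 0)) (by simp)
  have h3 := (LinearMap.toContinuousLinearMap F).hasFDerivAt.comp_hasDerivAt (0 : ℝ) h2
  have e1 : f (G.brk η X) = F (Complex.ofRealCLM 1 • ((Complex.I • (η : Matrix n n ℂ)) * X -
      X * (Complex.I • (η : Matrix n n ℂ)))) := by
    rw [← hF', coe_brk]
    simp [smul_sub]
  rw [e1]
  refine h3.congr_of_eventuallyEq (Filter.Eventually.of_forall fun t => ?_)
  simp only [Function.comp_apply, LinearMap.coe_toContinuousLinearMap']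
  rw [← hF']
  congr 1
  have e2 : (((t : ℂ) * Complex.I) • G.ofP η : G.lie).1 =
      Complex.ofRealCLM t • Complex.I • (η : Matrix n n ℂ) := by
    simp [smul_smul]
  change NormedSpace.exp (((t : ℂ) * Complex.I) • G.ofP η : G.lie).1 * (X : Matrix n n ℂ) *
    (((expGL (((t : ℂ) * Complex.I) • G.ofP η : G.lie).1)⁻¹ : Matrix.GeneralLinearGroup n ℂ) :
      Matrix n n ℂ) = _
  rw [← expGL_neg, coe_expGL, e2]
  rfl

variable {G} in
-- Infinitesimal form of the invariance of `B` under `exp(itη)`.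
lemma IsInvariantInner.brk_left {B : LinearMap.BilinForm ℝ G.𝔭} (hB : G.IsInvariantInner B)
    (η X Y : G.𝔭) : B (G.brk η X) Y = -B X (G.brk η Y) := by
  have h1 := G.hasDerivAt_Ad (B.flip Y) η X
  have h2 := G.hasDerivAt_Ad (B X) (-η) Y
  have h3 := h1.unique (h2.congr_of_eventuallyEq (Filter.Eventually.of_forall fun t => by
    change B (G.Ad (G.expK η t) X) Y = B X (G.Ad (G.expK (-η) t) Y)
    rw [← hB.invariant (G.expK η t)⁻¹ (G.Ad (G.expK η t) X), G.Ad_inv_Ad, G.expK_neg]))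
  simpa [brk_neg] using h3

end ReductiveGroup

namespace UnitaryRep

variable {G : ReductiveGroup n} {W : Type*} [NormedAddCommGroup W] [InnerProductSpace ℂ W]
  [FiniteDimensional ℂ W] (ρ : UnitaryRep W G)

lemma dρ_ofP_isSymmetric (α : G.𝔭) : (ρ.dρ (G.ofP α)).IsSymmetric := fun v w => by
  rw [inner_dρ, G.lieStar_ofP]

lemma inner_dρ_ofP_self (α : G.𝔭) (w : W) :
    ⟪ρ.dρ (G.ofP α) w, w⟫_ℂ = ((⟪ρ.dρ (G.ofP α) w, w⟫_ℂ).re : ℂ) :=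
  ((ρ.dρ_ofP_isSymmetric α).coe_re_inner_apply_self w).symm

/-- The Rayleigh quotient of `α`. -/
def rayleigh (α : G.𝔭) (w : W) : ℝ := (⟪ρ.dρ (G.ofP α) w, w⟫_ℂ).re / ‖w‖ ^ 2

lemma rayleigh_smul {c : ℂ} (hc : c ≠ 0) (α : G.𝔭) (w : W) :
    ρ.rayleigh α (c • w) = ρ.rayleigh α w := by
  have hc' : ‖c‖ ≠ 0 := norm_ne_zero_iff.2 hc
  rw [rayleigh, rayleigh, map_smul, inner_smul_left, inner_smul_right, ← mul_assoc,
    Complex.conj_mul', norm_smul, ← Complex.ofReal_pow, Complex.re_ofReal_mul, mul_pow,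
    mul_div_mul_left _ _ (pow_ne_zero 2 hc')]

lemma rayleigh_of_eigen {α : G.𝔭} {w : W} (hw : w ≠ 0) {l : ℝ}
    (h : ρ.dρ (G.ofP α) w = (l : ℂ) • w) : ρ.rayleigh α w = l := by
  have : ‖w‖ ^ 2 ≠ 0 := pow_ne_zero 2 (norm_ne_zero_iff.2 hw)
  rw [rayleigh, h, inner_smul_left, Complex.conj_ofReal, inner_self_eq_norm_sq_to_K,
    Complex.re_ofReal_mul]
  rw [div_eq_iff this]
  norm_cast

lemma component_mk (B : LinearMap.BilinForm ℝ G.𝔭) (μ : ℙ ℂ W → G.𝔭) (α : G.𝔭) {w : W}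
    (hw : w ≠ 0) : component B μ α w = B (μ (Projectivization.mk ℂ w hw)) α := dif_pos hw

variable {ρ} {s : ℝ} {B : LinearMap.BilinForm ℝ G.𝔭} {μ : ℙ ℂ W → G.𝔭}

/-- The factor `s / 2` compensates for `Re ⟨Ax, v⟩` occurring twice in the derivative of `⟨Ax, x⟩`.
Thus `s / 2` times the Rayleigh quotient has the gradient required of `μ^α`. -/
lemma hasDerivAt_rayleigh_line (α : G.𝔭) (w v : W) (t : ℝ) (h : w + (t : ℂ) • v ≠ 0) :
    HasDerivAt (fun t : ℝ => s / 2 * ρ.rayleigh α (w + (t : ℂ) • v))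
      (fubiniStudy s (w + (t : ℂ) • v) (ρ.dρ (G.ofP α) (w + (t : ℂ) • v)) v) t := by
  let A := ρ.dρ (G.ofP α)
  set x := w + (t : ℂ) • v with hx
  have hγ : HasDerivAt (fun t : ℝ => w + (t : ℂ) • v) v t := by
    have := (Complex.ofRealCLM.hasDerivAt (x := t)).smul_const v
    simpa using this.const_add w
  have hAγ : HasDerivAt (fun t : ℝ => A (w + (t : ℂ) • v)) (A v) t := by
    have := (Complex.ofRealCLM.hasDerivAt (x := t)).smul_const (A v)
    simpa using this.const_add (A w)
  have h1 := Complex.reCLM.hasFDerivAt.comp_hasDerivAt t (hAγ.inner ℂ hγ)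
  have h2 := Complex.reCLM.hasFDerivAt.comp_hasDerivAt t (hγ.inner ℂ hγ)
  have hnorm : ‖x‖ ^ 2 ≠ 0 := pow_ne_zero 2 (norm_ne_zero_iff.2 h)
  have hself : ∀ y : W, (⟪y, y⟫_ℂ).re = ‖y‖ ^ 2 := fun y => by
    rw [inner_self_eq_norm_sq_to_K]; norm_cast
  have h3 := (h1.div h2 (by
    change (⟪x, x⟫_ℂ).re ≠ 0
    rwa [hself])).const_mul (s / 2)
  have hre : ∀ y z : W, (⟪y, z⟫_ℂ).re = (⟪z, y⟫_ℂ).re := fun y z => inner_re_symm (𝕜 := ℂ) y z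
  have hsymm : (⟪A v, x⟫_ℂ).re = (⟪A x, v⟫_ℂ).re := by
    rw [ρ.dρ_ofP_isSymmetric α v x, hre]
  have hreal := ρ.inner_dρ_ofP_self α x
  refine (h3.congr_of_eventuallyEq (Filter.Eventually.of_forall fun t => ?_)).congr_deriv ?_
  · change s / 2 * (_ / _) = s / 2 * ((⟪A (w + (t : ℂ) • v), w + (t : ℂ) • v⟫_ℂ).re /
      (⟪w + (t : ℂ) • v, w + (t : ℂ) • v⟫_ℂ).re)
    rw [hself]
  · simp only [Function.comp_apply, Complex.reCLM_apply, ← hx, Complex.add_re, hsymm,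
      hre v x, hself]
    rw [fubiniStudy, hreal]
    have e : ((⟪A x, v⟫_ℂ / (‖x‖ : ℂ) ^ 2 - ((⟪A x, x⟫_ℂ).re : ℂ) * ⟪x, v⟫_ℂ / (‖x‖ : ℂ) ^ 4)).re =
        (⟪A x, v⟫_ℂ).re / ‖x‖ ^ 2 - (⟪A x, x⟫_ℂ).re * (⟪x, v⟫_ℂ).re / ‖x‖ ^ 4 := by
      rw [Complex.sub_re, ← Complex.ofReal_pow, ← Complex.ofReal_pow, Complex.div_ofReal_re,
        Complex.div_ofReal_re, Complex.re_ofReal_mul]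
    rw [e]
    have hn : ‖x‖ ≠ 0 := norm_ne_zero_iff.2 h
    simp only [A, Complex.ofReal_re]
    field_simp
    ring

/-- A momentum map is determined up to a constant. -/
lemma IsMomentumMap.exists_const [Nontrivial W] (hμ : ρ.IsMomentumMap s B μ) :
    ∃ c : G.𝔭 →ₗ[ℝ] ℝ, ∀ (α : G.𝔭) (w : W) (hw : w ≠ 0),
      B (μ (Projectivization.mk ℂ w hw)) α = s / 2 * ρ.rayleigh α w + c α := by
  obtain ⟨w₁, hw₁⟩ := exists_ne (0 : W)
  let c : G.𝔭 →ₗ[ℝ] ℝ :=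
    { toFun := fun α => B (μ (Projectivization.mk ℂ w₁ hw₁)) α - s / 2 * ρ.rayleigh α w₁
      map_add' := fun α α' => by
        simp only [rayleigh, G.ofP_add, dρ_add, LinearMap.add_apply, inner_add_left,
          Complex.add_re, map_add]
        ring
      map_smul' := fun r α => by
        simp only [rayleigh, G.ofP_smul, dρ_smul, LinearMap.smul_apply, inner_smul_left,
          Complex.conj_ofReal, Complex.re_ofReal_mul, map_smul, RingHom.id_apply, smul_eq_mul]
        ring }
  refine ⟨c, fun α w hw => ?_⟩
  change _ = _ + (B (μ (Projectivization.mk ℂ w₁ hw₁)) α - s / 2 * ρ.rayleigh α w₁)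
  -- If `w` is not proportional to `w₁`, the real line through both avoids `0` and the derivatives
  -- can be compared along it. Proportional vectors give the same point and the same quotient.
  by_cases hdep : ∃ z : ℂ, w = z • w₁
  · obtain ⟨z, rfl⟩ := hdep
    have hz : z ≠ 0 := by rintro rfl; simp at hw
    have : Projectivization.mk ℂ (z • w₁) hw = Projectivization.mk ℂ w₁ hw₁ :=
      (Projectivization.mk_eq_mk_iff' ℂ _ _ _ _).2 ⟨z, rfl⟩
    rw [this, ρ.rayleigh_smul hz]
    ring
  · have hne : ∀ t : ℝ, w₁ + (t : ℂ) • (w - w₁) ≠ 0 := by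
      intro t ht
      by_cases h0 : (t : ℂ) = 0
      · simp [h0, hw₁] at ht
      · apply hdep
        refine ⟨(t : ℂ)⁻¹ * (t - 1), ?_⟩
        have : (t : ℂ) • w = ((t : ℂ) - 1) • w₁ := by
          rw [sub_smul, one_smul]
          rw [smul_sub] at ht
          rw [← sub_eq_zero, ← ht]
          abel
        rw [mul_smul, ← this, smul_smul, inv_mul_cancel₀ h0, one_smul]
    have hd : ∀ t : ℝ, HasDerivAt (fun t : ℝ => component B μ α (w₁ + (t : ℂ) • (w - w₁)) -
        s / 2 * ρ.rayleigh α (w₁ + (t : ℂ) • (w - w₁))) 0 t := by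
      intro t
      have hγ : HasDerivAt (fun t : ℝ => w₁ + (t : ℂ) • (w - w₁)) (w - w₁) t := by
        have := (Complex.ofRealCLM.hasDerivAt (x := t)).smul_const (w - w₁)
        simpa using this.const_add w₁
      have h1 := (hμ.differentiable α _ (hne t)).hasFDerivAt.comp_hasDerivAt t hγ
      rw [hμ.gradient α _ (hne t)] at h1
      have := h1.sub (hasDerivAt_rayleigh_line (ρ := ρ) (s := s) α w₁ (w - w₁) t (hne t))
      rw [sub_self] at this
      exact this
    have hconst := is_const_of_deriv_eq_zero (fun t => (hd t).differentiableAt)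
      (fun t => (hd t).deriv) 1 0
    simp only [Complex.ofReal_one, one_smul, add_sub_cancel, Complex.ofReal_zero, zero_smul,
      add_zero] at hconst
    rw [component_mk B μ α hw, component_mk B μ α hw₁] at hconst
    linarith

lemma norm_rep_maxCompact (k : G.maxCompact) (w : W) : ‖ρ.rep k w‖ = ‖w‖ := by
  rw [@norm_eq_sqrt_re_inner ℂ, @norm_eq_sqrt_re_inner ℂ, ρ.unitary]

lemma rayleigh_Ad (k : G.maxCompact) (α : G.𝔭) (w : W) :
    ρ.rayleigh (G.Ad k α) (ρ.rep k w) = ρ.rayleigh α w := by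
  have h : G.ofP (G.Ad k α) = G.conj k (G.ofP α) := rfl
  rw [rayleigh, rayleigh, h, rep_mul_dρ, ρ.unitary, norm_rep_maxCompact]

/-- Moving the point and `α` by the same `k ∈ K` changes neither `B(μ, α)` nor the Rayleigh
quotient. Hence `c` is `Ad(K)`-invariant, and its derivative along `exp(itη)` vanishes. -/
lemma IsMomentumMap.const_brk [Nontrivial W] (hB : G.IsInvariantInner B)
    (hμ : ρ.IsMomentumMap s B μ) {c : G.𝔭 →ₗ[ℝ] ℝ}
    (hc : ∀ (α : G.𝔭) (w : W) (hw : w ≠ 0),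
      B (μ (Projectivization.mk ℂ w hw)) α = s / 2 * ρ.rayleigh α w + c α) (η X : G.𝔭) :
    c (G.brk η X) = 0 := by
  obtain ⟨w, hw⟩ := exists_ne (0 : W)
  have h1 := G.hasDerivAt_Ad c η X
  refine h1.unique ((hasDerivAt_const (0 : ℝ) (c X)).congr_of_eventuallyEq
    (Filter.Eventually.of_forall fun t => ?_))
  set k := G.expK η t
  have hkw : ρ.rep k w ≠ 0 := by
    rw [← norm_ne_zero_iff, norm_rep_maxCompact]; exact norm_ne_zero_iff.2 hw
  have e1 := hc X w hw
  have e2 := hc (G.Ad k X) (ρ.rep k w) hkw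
  have e3 : μ (Projectivization.mk ℂ (ρ.rep k w) hkw) =
      G.Ad k (μ (Projectivization.mk ℂ w hw)) :=
    hμ.equivariant k (Projectivization.mk ℂ w hw)
  rw [e3, hB.invariant, rayleigh_Ad] at e2
  change c (G.Ad k X) = c X
  linarith

/-- The momentum map at an eigenvector of `η` commutes with `η`. -/
lemma IsMomentumMap.brk_eq_zero (hμ : ρ.IsMomentumMap s B μ) (η : G.𝔭) {w : W} (hw : w ≠ 0)
    {l : ℂ} (hl : ρ.dρ (G.ofP η) w = l • w) : G.brk η (μ (Projectivization.mk ℂ w hw)) = 0 := by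
  have hfix : ∀ t : ℝ, ρ.act (G.expK η t) (Projectivization.mk ℂ w hw) =
      Projectivization.mk ℂ w hw := by
    intro t
    have hmem : ρ.rep (G.expK η t) w ∈ Submodule.span ℂ {w} := by
      refine ρ.rep_exp_mem _ _ (fun u hu => ?_) (Submodule.mem_span_singleton_self w)
      obtain ⟨a, rfl⟩ := Submodule.mem_span_singleton.1 hu
      refine Submodule.mem_span_singleton.2 ⟨(t : ℂ) * Complex.I * a * l, ?_⟩
      rw [dρ_smul, LinearMap.smul_apply, map_smul, hl, smul_smul, smul_smul]
    obtain ⟨a, ha⟩ := Submodule.mem_span_singleton.1 hmem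
    change Projectivization.mk ℂ (ρ.rep (G.expK η t) w) _ = _
    exact (Projectivization.mk_eq_mk_iff' ℂ _ _ _ _).2 ⟨a, ha⟩
  set m := μ (Projectivization.mk ℂ w hw)
  have hm : ∀ t : ℝ, G.Ad (G.expK η t) m = m := fun t => by
    rw [← hμ.equivariant, hfix]
  refine (Module.forall_dual_apply_eq_zero_iff ℝ _).1 fun f => ?_
  refine (G.hasDerivAt_Ad f η m).unique ((hasDerivAt_const (0 : ℝ) (f m)).congr_of_eventuallyEq
    (Filter.Eventually.of_forall fun t => ?_))
  simp only [hm]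

end UnitaryRep

end Momentum

/-! ### Extreme points of the convex hull of the momentum image -/

section ExtremePoints

set_option linter.unusedSectionVars false

variable {n : Type*} [Fintype n] [DecidableEq n]

namespace ReductiveGroup

variable (G : ReductiveGroup n)

/-- The hermitian part of an element of the Lie algebra. -/
def reP (X : G.lie) : G.𝔭 :=
  ⟨(2⁻¹ : ℂ) • ((X : Matrix n n ℂ) + (X : Matrix n n ℂ)ᴴ),
    G.lie.smul_mem _ (add_mem X.2 (G.conjTranspose_mem_lie X.2)), by
      simp [Matrix.conjTranspose_smul, add_comm]⟩

/-- The element `C` of `𝔭` such that `X - iC` is hermitian. -/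
def imP (X : G.lie) : G.𝔭 :=
  ⟨(-Complex.I * 2⁻¹ : ℂ) • ((X : Matrix n n ℂ) - (X : Matrix n n ℂ)ᴴ),
    G.lie.smul_mem _ (sub_mem X.2 (G.conjTranspose_mem_lie X.2)), by
      rw [Matrix.conjTranspose_smul, Matrix.conjTranspose_sub, Matrix.conjTranspose_conjTranspose,
        ← neg_sub, smul_neg, ← neg_smul]
      simp⟩

lemma coe_reP (X : G.lie) : (G.reP X : Matrix n n ℂ) =
    (2⁻¹ : ℂ) • ((X : Matrix n n ℂ) + (X : Matrix n n ℂ)ᴴ) := rfl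

lemma coe_imP (X : G.lie) : (G.imP X : Matrix n n ℂ) =
    (-Complex.I * 2⁻¹ : ℂ) • ((X : Matrix n n ℂ) - (X : Matrix n n ℂ)ᴴ) := rfl

lemma eq_reP_add_imP (X : G.lie) : X = G.ofP (G.reP X) + Complex.I • G.ofP (G.imP X) := by
  apply Subtype.ext
  simp only [Submodule.coe_add, Submodule.coe_smul, coe_ofP, coe_reP, coe_imP, smul_smul,
    ← mul_assoc, mul_neg, Complex.I_mul_I, neg_neg, one_mul]
  module

variable {G}

lemma ad_lieStar {β : G.𝔭} {X : G.lie} {b : ℝ} (hX : G.ad (G.ofP β) X = (b : ℂ) • X) :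
    G.ad (G.ofP β) (G.lieStar X) = ((-b : ℝ) : ℂ) • G.lieStar X := by
  have h := congrArg (fun Y : G.lie => (Y : Matrix n n ℂ)ᴴ) hX
  have hβ : (β : Matrix n n ℂ)ᴴ = β := β.2.2
  simp only [coe_ad, coe_ofP, Matrix.conjTranspose_sub, Matrix.conjTranspose_mul, hβ,
    Submodule.coe_smul, Matrix.conjTranspose_smul, Complex.star_def, Complex.conj_ofReal] at h
  apply Subtype.ext
  simp only [coe_ad, coe_ofP, coe_lieStar, Submodule.coe_smul]
  rw [← neg_sub, h]
  push_cast
  rw [neg_smul]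

/-- With `X = A + iC`, `A` and `C` hermitian, the weight equation splits into `i[A, β] = bC` and, in
`brk_imP`, `i[C, β] = -bA`. -/
lemma brk_reP {β : G.𝔭} {X : G.lie} {b : ℝ} (hX : G.ad (G.ofP β) X = (b : ℂ) • X) :
    G.brk (G.reP X) β = b • G.imP X := by
  have h1 : (β : Matrix n n ℂ) * X - X * β = (b : ℂ) • (X : Matrix n n ℂ) :=
    congrArg Subtype.val hX
  have h2 : (β : Matrix n n ℂ) * (X : Matrix n n ℂ)ᴴ - (X : Matrix n n ℂ)ᴴ * β =
    ((-b : ℝ) : ℂ) • (X : Matrix n n ℂ)ᴴ := congrArg Subtype.val (ad_lieStar hX)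
  apply Subtype.ext
  change Complex.I • (((2⁻¹ : ℂ) • ((X : Matrix n n ℂ) + (X : Matrix n n ℂ)ᴴ)) * β -
    β * ((2⁻¹ : ℂ) • ((X : Matrix n n ℂ) + (X : Matrix n n ℂ)ᴴ))) =
    b • ((-Complex.I * 2⁻¹ : ℂ) • ((X : Matrix n n ℂ) - (X : Matrix n n ℂ)ᴴ))
  have e : ((2⁻¹ : ℂ) • ((X : Matrix n n ℂ) + (X : Matrix n n ℂ)ᴴ)) * β -
      β * ((2⁻¹ : ℂ) • ((X : Matrix n n ℂ) + (X : Matrix n n ℂ)ᴴ)) =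
      (-2⁻¹ : ℂ) • (((β : Matrix n n ℂ) * X - X * β) +
        ((β : Matrix n n ℂ) * (X : Matrix n n ℂ)ᴴ - (X : Matrix n n ℂ)ᴴ * β)) := by
    rw [Matrix.smul_mul, Matrix.mul_smul, Matrix.add_mul, Matrix.mul_add]
    module
  rw [e, h1, h2, ← Complex.coe_smul]
  push_cast
  module

lemma brk_imP {β : G.𝔭} {X : G.lie} {b : ℝ} (hX : G.ad (G.ofP β) X = (b : ℂ) • X) :
    G.brk (G.imP X) β = (-b) • G.reP X := by
  have h1 : (β : Matrix n n ℂ) * X - X * β = (b : ℂ) • (X : Matrix n n ℂ) :=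
    congrArg Subtype.val hX
  have h2 : (β : Matrix n n ℂ) * (X : Matrix n n ℂ)ᴴ - (X : Matrix n n ℂ)ᴴ * β =
    ((-b : ℝ) : ℂ) • (X : Matrix n n ℂ)ᴴ := congrArg Subtype.val (ad_lieStar hX)
  apply Subtype.ext
  change Complex.I • (((-Complex.I * 2⁻¹ : ℂ) • ((X : Matrix n n ℂ) - (X : Matrix n n ℂ)ᴴ)) * β -
    β * ((-Complex.I * 2⁻¹ : ℂ) • ((X : Matrix n n ℂ) - (X : Matrix n n ℂ)ᴴ))) =
    (-b) • ((2⁻¹ : ℂ) • ((X : Matrix n n ℂ) + (X : Matrix n n ℂ)ᴴ))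
  have e : ((-Complex.I * 2⁻¹ : ℂ) • ((X : Matrix n n ℂ) - (X : Matrix n n ℂ)ᴴ)) * β -
      β * ((-Complex.I * 2⁻¹ : ℂ) • ((X : Matrix n n ℂ) - (X : Matrix n n ℂ)ᴴ)) =
      (Complex.I * 2⁻¹ : ℂ) • (((β : Matrix n n ℂ) * X - X * β) -
        ((β : Matrix n n ℂ) * (X : Matrix n n ℂ)ᴴ - (X : Matrix n n ℂ)ᴴ * β)) := by
    rw [Matrix.smul_mul, Matrix.mul_smul, Matrix.sub_mul, Matrix.mul_sub]
    module
  rw [e, h1, h2, ← Complex.coe_smul, smul_smul, ← mul_assoc, Complex.I_mul_I]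
  push_cast
  module

/-- For `X = A + iC` one has `[X*, X] = 2i[A, C]`. This is a bracket in `𝔭`, so `μ` can be evaluated
on it while the constant `c` drops out. -/
lemma ad_lieStar_self (X : G.lie) :
    G.ad (G.lieStar X) X = G.ofP ((2 : ℝ) • G.brk (G.reP X) (G.imP X)) := by
  rw [G.ofP_smul]
  apply Subtype.ext
  change (X : Matrix n n ℂ)ᴴ * X - X * (X : Matrix n n ℂ)ᴴ = ((2 : ℝ) : ℂ) • Complex.I •
    (((2⁻¹ : ℂ) • ((X : Matrix n n ℂ) + (X : Matrix n n ℂ)ᴴ)) *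
      ((-Complex.I * 2⁻¹ : ℂ) • ((X : Matrix n n ℂ) - (X : Matrix n n ℂ)ᴴ)) -
      ((-Complex.I * 2⁻¹ : ℂ) • ((X : Matrix n n ℂ) - (X : Matrix n n ℂ)ᴴ)) *
      ((2⁻¹ : ℂ) • ((X : Matrix n n ℂ) + (X : Matrix n n ℂ)ᴴ)))
  have e : ∀ (Y Z : Matrix n n ℂ) (z : ℂ), ((2⁻¹ : ℂ) • (Y + Z)) * (z • (Y - Z)) -
      (z • (Y - Z)) * ((2⁻¹ : ℂ) • (Y + Z)) = z • (Z * Y - Y * Z) := by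
    intro Y Z z
    simp only [Matrix.smul_mul, Matrix.mul_smul, Matrix.add_mul, Matrix.mul_sub, Matrix.sub_mul,
      Matrix.mul_add]
    module
  have e' : ((2 : ℝ) : ℂ) * (Complex.I * (-Complex.I * 2⁻¹)) = 1 := by
    push_cast
    linear_combination (-1 : ℂ) * Complex.I_mul_I
  rw [e, smul_smul, smul_smul, mul_assoc, e', one_smul]

lemma eq_zero_of_imP_eq_zero {β : G.𝔭} {X : G.lie} {b : ℝ}
    (hX : G.ad (G.ofP β) X = (b : ℂ) • X) (hb : b ≠ 0) (h : G.imP X = 0) : X = 0 := by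
  have h1 := brk_imP hX
  have h2 : G.brk (G.imP X) β = 0 := by
    rw [h]; exact G.brk_eq_zero_iff.2 (by simp)
  rw [h2] at h1
  have h3 : G.reP X = 0 := by
    have := (smul_eq_zero.1 h1.symm).resolve_left (neg_ne_zero.2 hb)
    exact this
  rw [G.eq_reP_add_imP X, h, h3]
  exact Subtype.ext (by simp)

/-- Every element of `𝔭` lies in a maximal commutative subspace. -/
lemma exists_maximal_abelian (β : G.𝔭) : ∃ a : Submodule ℝ G.𝔭, β ∈ a ∧
    (∀ x ∈ a, ∀ y ∈ a, Commute (x : Matrix n n ℂ) y) ∧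
    ∀ x : G.𝔭, (∀ y ∈ a, Commute (y : Matrix n n ℂ) x) → x ∈ a := by
  have hspan : ∀ (a : Submodule ℝ G.𝔭) (x : G.𝔭), (∀ y ∈ a, ∀ z ∈ a, Commute (y : Matrix n n ℂ) z) →
      (∀ y ∈ a, Commute (y : Matrix n n ℂ) x) →
      ∀ y ∈ a ⊔ Submodule.span ℝ {x}, ∀ z ∈ a ⊔ Submodule.span ℝ {x},
        Commute (y : Matrix n n ℂ) z := by
    intro a x ha hx y hy z hz
    obtain ⟨y₁, hy₁, y₂, hy₂, rfl⟩ := Submodule.mem_sup.1 hy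
    obtain ⟨z₁, hz₁, z₂, hz₂, rfl⟩ := Submodule.mem_sup.1 hz
    obtain ⟨r, rfl⟩ := Submodule.mem_span_singleton.1 hy₂
    obtain ⟨t, rfl⟩ := Submodule.mem_span_singleton.1 hz₂
    simp only [Submodule.coe_add, Submodule.coe_smul]
    exact ((ha _ hy₁ _ hz₁).add_right ((hx _ hy₁).smul_right t)).add_left
      ((((hx _ hz₁).symm).smul_left r).add_right
        (((Commute.refl (x : Matrix n n ℂ)).smul_left r).smul_right t))
  let S : Set (Submodule ℝ G.𝔭) := {a | β ∈ a ∧ ∀ x ∈ a, ∀ y ∈ a, Commute (x : Matrix n n ℂ) y}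
  have hne : S.Nonempty := by
    refine ⟨⊥ ⊔ Submodule.span ℝ {β}, Submodule.mem_sup_right
      (Submodule.mem_span_singleton_self β), hspan ⊥ β ?_ ?_⟩
    · intro y hy z hz
      rw [(Submodule.mem_bot ℝ).1 hy]
      exact Commute.zero_left _
    · intro y hy
      rw [(Submodule.mem_bot ℝ).1 hy]
      exact Commute.zero_left _
  -- Finite dimension provides a maximal commutative subspace; adjoining an element of its
  -- centralizer keeps it commutative.
  obtain ⟨a, ⟨hβa, ha⟩, hmax⟩ := (wellFounded_gt (α := Submodule ℝ G.𝔭)).has_min S hne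
  refine ⟨a, hβa, ha, fun x hx => ?_⟩
  by_contra hxa
  refine hmax (a ⊔ Submodule.span ℝ {x}) ⟨Submodule.mem_sup_left hβa, hspan a x ha hx⟩
    (lt_of_le_of_ne le_sup_left fun h => hxa ?_)
  rw [h]
  exact Submodule.mem_sup_right (Submodule.mem_span_singleton_self x)

end ReductiveGroup

namespace UnitaryRep

variable {G : ReductiveGroup n} {W : Type*} [NormedAddCommGroup W] [InnerProductSpace ℂ W]
  [FiniteDimensional ℂ W] {ρ : UnitaryRep W G} {s : ℝ} {B : LinearMap.BilinForm ℝ G.𝔭}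
  {μ : ℙ ℂ W → G.𝔭} {c : G.𝔭 →ₗ[ℝ] ℝ}

lemma dρ_eigen_add {Y X : G.lie} {a l : ℂ} {w : W} (hX : G.ad Y X = a • X)
    (hw : ρ.dρ Y w = l • w) : ρ.dρ Y (ρ.dρ X w) = (l + a) • ρ.dρ X w := by
  have h := ρ.dρ_ad Y X w
  rw [hX, hw, dρ_smul, LinearMap.smul_apply, map_smul] at h
  rw [add_smul, h]
  abel

/-- The weights of `β = μ([v])` on the Lie algebra are controlled by the norm of `X v`. -/
lemma norm_dρ_sq_eq (hB : G.IsInvariantInner B)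
    (hc : ∀ (α : G.𝔭) (w : W) (hw : w ≠ 0),
      B (μ (Projectivization.mk ℂ w hw)) α = s / 2 * ρ.rayleigh α w + c α)
    (hc' : ∀ η X : G.𝔭, c (G.brk η X) = 0) {β : G.𝔭} {v : W} (hv : v ≠ 0)
    (hβ : μ (Projectivization.mk ℂ v hv) = β) {X : G.lie} {b : ℝ}
    (hX : G.ad (G.ofP β) X = (b : ℂ) • X) (hXv : ρ.dρ (G.lieStar X) v = 0) :
    s / 2 * (‖ρ.dρ X v‖ ^ 2 / ‖v‖ ^ 2) = -(2 * b) * B (G.imP X) (G.imP X) := by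
  -- The momentum identity at `[X*, X] = 2i[A, C]`. Since `X* v = 0`, the Rayleigh quotient is
  -- `‖Xv‖² / ‖v‖²`, while invariance gives `B(β, i[A, C]) = -b B(C, C)`.
  have h1 := hc ((2 : ℝ) • G.brk (G.reP X) (G.imP X)) v hv
  have h2 : B β (G.brk (G.reP X) (G.imP X)) = -(b * B (G.imP X) (G.imP X)) := by
    rw [← neg_neg (B β (G.brk (G.reP X) (G.imP X))), ← hB.brk_left, ReductiveGroup.brk_reP hX,
      map_smul, LinearMap.smul_apply, smul_eq_mul]
  have h3 : ρ.rayleigh ((2 : ℝ) • G.brk (G.reP X) (G.imP X)) v = ‖ρ.dρ X v‖ ^ 2 / ‖v‖ ^ 2 := by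
    rw [rayleigh, ← ReductiveGroup.ad_lieStar_self, dρ_ad, hXv, map_zero, sub_zero, inner_dρ]
    congr 1
    have : G.lieStar (G.lieStar X) = X := Subtype.ext (by simp)
    rw [this, inner_self_eq_norm_sq_to_K]
    norm_cast
  rw [hβ, h3, map_smul, map_smul, hc', h2] at h1
  simp only [smul_eq_mul] at h1
  linarith

lemma re_inner_eq_sum {A : Module.End ℂ W} (hA : A.IsSymmetric) {N : ℕ}
    (u : OrthonormalBasis (Fin N) ℂ W) {l : Fin N → ℝ} (hu : ∀ k, A (u k) = (l k : ℂ) • u k)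
    (w : W) : (⟪A w, w⟫_ℂ).re = ∑ k, l k * ‖⟪u k, w⟫_ℂ‖ ^ 2 := by
  rw [← u.sum_inner_mul_inner (A w) w, Complex.re_sum]
  refine Finset.sum_congr rfl fun k _ => ?_
  rw [hA, hu, inner_smul_right, mul_assoc, ← inner_conj_symm w (u k), Complex.conj_mul',
    Complex.re_ofReal_mul, ← Complex.ofReal_pow, Complex.ofReal_re]

lemma eq_of_forall_bilin (hB : G.IsInvariantInner B) {a : Submodule ℝ G.𝔭} {x y : G.𝔭}
    (hx : x ∈ a) (hy : y ∈ a) (h : ∀ z ∈ a, B x z = B y z) : x = y := by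
  by_contra hne
  have h1 := hB.pos (x - y) (sub_ne_zero.2 hne)
  have h2 := h (x - y) (sub_mem hx hy)
  rw [LinearMap.map_sub₂, h2, sub_self] at h1
  exact lt_irrefl _ h1

lemma exists_repr_on (hB : G.IsInvariantInner B) (a : Submodule ℝ G.𝔭) (f : G.𝔭 →ₗ[ℝ] ℝ) :
    ∃ α ∈ a, ∀ x ∈ a, B x α = f x := by
  let Φ : a →ₗ[ℝ] Module.Dual ℝ a := (B.domRestrict₁₂ a a).flip
  have hinj : Function.Injective Φ := by
    rw [injective_iff_map_eq_zero]
    intro x hx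
    refine Subtype.ext (eq_of_forall_bilin hB x.2 (zero_mem a) fun z hz => ?_)
    have := LinearMap.congr_fun hx ⟨z, hz⟩
    rw [hB.symm, ZeroMemClass.coe_zero, hB.symm 0 z, map_zero]
    exact this
  have hsurj : Function.Surjective Φ :=
    (LinearMap.injective_iff_surjective_of_finrank_eq_finrank (K := ℝ) (V := a)
      (V₂ := Module.Dual ℝ a) (f := Φ) (Subspace.dual_finrank_eq (K := ℝ) (V := a)).symm).1 hinj
  obtain ⟨α, hα⟩ := hsurj (f ∘ₗ a.subtype)
  refine ⟨α, α.2, fun x hx => ?_⟩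
  exact LinearMap.congr_fun hα ⟨x, hx⟩

/-- `V` carries no topology, so Hahn–Banach is applied in coordinates; the hull of a finite set is
closed. -/
lemma exists_separating {V : Type*} [AddCommGroup V] [Module ℝ V] [FiniteDimensional ℝ V]
    {S : Set V} (hS : S.Finite) {β : V} (hβ : β ∉ convexHull ℝ S) :
    ∃ f : V →ₗ[ℝ] ℝ, ∀ x ∈ S, f x < f β := by
  let e := (Module.finBasis ℝ V).equivFun
  have hβmem : e β ∉ convexHull ℝ (e '' S) := by
    rw [← LinearEquiv.coe_coe, ← LinearMap.image_convexHull]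
    rintro ⟨x, hx, hxβ⟩
    exact hβ (e.injective hxβ ▸ hx)
  obtain ⟨f, u, hu, hβmem⟩ := geometric_hahn_banach_closed_point (convex_convexHull ℝ (e '' S))
    ((hS.image e).isClosed_convexHull (𝕜 := ℝ)) hβmem
  exact ⟨f.toLinearMap ∘ₗ e.toLinearMap, fun x hx =>
    (hu (e x) (subset_convexHull ℝ _ ⟨x, hx, rfl⟩)).trans hβmem⟩

/-- An extreme point `β` of the momentum polytope is the value at a joint eigenvector of `β` and an
element `α` of `𝔭` whose top eigenspace maps to `β`. -/
lemma exists_exposing (hB : G.IsInvariantInner B) (hs : 0 < s) (hμ : ρ.IsMomentumMap s B μ)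
    (hc : ∀ (α : G.𝔭) (w : W) (hw : w ≠ 0),
      B (μ (Projectivization.mk ℂ w hw)) α = s / 2 * ρ.rayleigh α w + c α)
    {β : G.𝔭} (hβ : β ∈ (convexHull ℝ (Set.range μ)).extremePoints ℝ) :
    ∃ (v : W) (hv : v ≠ 0) (α : G.𝔭) (a₀ b₀ : ℝ), μ (Projectivization.mk ℂ v hv) = β ∧
      Commute (α : Matrix n n ℂ) β ∧ ρ.dρ (G.ofP α) v = (a₀ : ℂ) • v ∧
      ρ.dρ (G.ofP β) v = (b₀ : ℂ) • v ∧
      (∀ (l : ℝ) (w : W), a₀ < l → ρ.dρ (G.ofP α) w = (l : ℂ) • w → w = 0) ∧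
      ∀ (w : W) (hw : w ≠ 0), ρ.dρ (G.ofP α) w = (a₀ : ℂ) • w →
        μ (Projectivization.mk ℂ w hw) = β := by
  obtain ⟨a, hβa, hcomm, hmax⟩ := G.exists_maximal_abelian β
  let T : a → Module.End ℂ W := fun η => ρ.dρ (G.ofP η)
  have hTc : ∀ η η' : a, Commute (T η) (T η') := by
    intro η η'
    have h0 : G.ad (G.ofP η) (G.ofP η') = 0 :=
      Subtype.ext (by simpa [sub_eq_zero] using (hcomm _ η.2 _ η'.2).eq)
    ext w
    have := ρ.dρ_ad (G.ofP η) (G.ofP η') w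
    have hz : ρ.dρ 0 = 0 := ρ.dρL.map_zero
    rw [h0, hz, LinearMap.zero_apply] at this
    exact (sub_eq_zero.1 this.symm)
  obtain ⟨N, u, χ, hu⟩ := exists_joint_eigenbasis T (fun η => ρ.dρ_ofP_isSymmetric η) hTc
  have hu0 : ∀ k, u k ≠ 0 := fun k => u.orthonormal.ne_zero k
  -- The value of `μ` at a joint eigenvector commutes with all of `a`, hence lies in `a` by
  -- maximality, where pairings with `a` determine it.
  have hmem : ∀ (w : W) (hw : w ≠ 0) (χ' : a → ℝ), (∀ η, T η w = (χ' η : ℂ) • w) →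
      μ (Projectivization.mk ℂ w hw) ∈ a ∧
      ∀ η : a, B (μ (Projectivization.mk ℂ w hw)) η = s / 2 * χ' η + c η := by
    intro w hw χ' hχ'
    refine ⟨hmax _ fun y hy => ?_, fun η => ?_⟩
    · exact G.brk_eq_zero_iff.1 (hμ.brk_eq_zero y hw (hχ' ⟨y, hy⟩))
    · rw [hc _ w hw, ρ.rayleigh_of_eigen hw (hχ' η)]
  let m : Fin N → G.𝔭 := fun k => μ (Projectivization.mk ℂ (u k) (hu0 k))
  have hm : ∀ k, m k ∈ a ∧ ∀ η : a, B (m k) η = s / 2 * χ k η + c η :=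
    fun k => hmem _ (hu0 k) (χ k) (hu k)
  -- `β` is one of the values at the joint eigenvectors
  obtain ⟨x, hx⟩ : β ∈ Set.range μ := extremePoints_convexHull_subset hβ
  have hβm : β ∈ convexHull ℝ (Set.range m) := by
    induction x using Projectivization.ind with
    | h w hw =>
    have hw2 : 0 < ‖w‖ ^ 2 := by positivity
    let p : Fin N → ℝ := fun k => ‖⟪u k, w⟫_ℂ‖ ^ 2 / ‖w‖ ^ 2
    have hp : ∑ k, p k = 1 := by
      rw [← Finset.sum_div, u.sum_sq_norm_inner_right, div_self hw2.ne']
    -- Both sides lie in `a`. Paired with `η ∈ a`, the claim says that the Rayleigh quotient is the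
    -- `p`-average of the weights.
    have hβeq : β = ∑ k, p k • m k := by
      refine eq_of_forall_bilin hB hβa (Submodule.sum_mem _ fun k _ =>
        a.smul_mem _ (hm k).1) fun η hη => ?_
      have e1 : B (∑ k, p k • m k) η = ∑ k, p k * (s / 2 * χ k ⟨η, hη⟩ + c η) := by
        rw [map_sum, LinearMap.sum_apply]
        refine Finset.sum_congr rfl fun k _ => ?_
        rw [map_smul, LinearMap.smul_apply, (hm k).2 ⟨η, hη⟩, smul_eq_mul]
      have e2 : ρ.rayleigh η w = ∑ k, p k * χ k ⟨η, hη⟩ := by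
        rw [rayleigh, re_inner_eq_sum (ρ.dρ_ofP_isSymmetric η) u (fun k => hu k ⟨η, hη⟩),
          Finset.sum_div]
        exact Finset.sum_congr rfl fun k _ => by simp only [p]; ring
      rw [← hx, hc η w hw, e1, e2]
      simp only [mul_add, Finset.sum_add_distrib, ← Finset.sum_mul, hp, one_mul, Finset.mul_sum]
      congr 1
      exact Finset.sum_congr rfl fun k _ => by ring
    rw [hβeq]
    exact (convex_convexHull ℝ _).sum_mem (fun k _ => by positivity) hp
      fun k _ => subset_convexHull ℝ _ ⟨k, rfl⟩
  have hsub : convexHull ℝ (Set.range m) ⊆ convexHull ℝ (Set.range μ) :=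
    convexHull_mono (by rintro _ ⟨k, rfl⟩; exact ⟨_, rfl⟩)
  obtain ⟨k₀, hk₀⟩ : β ∈ Set.range m := extremePoints_convexHull_subset
    (inter_extremePoints_subset_extremePoints_of_subset hsub ⟨hβm, hβ⟩)
  -- the exposing element
  have hnot : β ∉ convexHull ℝ (Set.range m \ {β}) := by
    have hconv := ((convex_convexHull ℝ (Set.range μ)).mem_extremePoints_iff_convex_sdiff.1 hβ).2
    intro h
    have hsub' : Set.range m \ {β} ⊆ convexHull ℝ (Set.range μ) \ {β} := fun y hy =>
      ⟨hsub (subset_convexHull ℝ _ hy.1), hy.2⟩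
    exact (convexHull_min hsub' hconv h).2 rfl
  obtain ⟨f, hf⟩ := exists_separating ((Set.finite_range m).sdiff) hnot
  obtain ⟨α, hαa, hα⟩ := exists_repr_on hB a f
  -- On `a` the separating functional is pairing with `α`, so it compares the `α`-weights: `s / 2`
  -- is positive and `c α` cancels.
  have hlt : ∀ k, m k ≠ β → χ k ⟨α, hαa⟩ < χ k₀ ⟨α, hαa⟩ := by
    intro k hk
    have h1 := hf (m k) ⟨⟨k, rfl⟩, hk⟩
    rw [← hα _ (hm k).1, ← hα _ hβa, ← hk₀] at h1
    have h2 := (hm k).2 ⟨α, hαa⟩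
    have h3 := (hm k₀).2 ⟨α, hαa⟩
    simp only at h2 h3
    rw [h2, h3] at h1
    have : s / 2 * χ k ⟨α, hαa⟩ < s / 2 * χ k₀ ⟨α, hαa⟩ := by linarith
    exact lt_of_mul_lt_mul_left this (by positivity)
  have heq : ∀ k, m k = β → ∀ η, χ k η = χ k₀ η := by
    intro k hk η
    have h2 := (hm k).2 η
    have h3 := (hm k₀).2 η
    rw [hk] at h2
    rw [hk₀] at h3
    have : s / 2 * χ k η = s / 2 * χ k₀ η := by linarith
    exact mul_left_cancel₀ (by positivity) this
  have hcoord : ∀ (w : W) (η : a) (l : ℝ), T η w = (l : ℂ) • w →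
      ∀ k, ⟪u k, w⟫_ℂ ≠ 0 → χ k η = l := by
    intro w η l hw k hk
    have h1 := ρ.dρ_ofP_isSymmetric (η : G.𝔭) (u k) w
    change ⟪T η (u k), w⟫_ℂ = ⟪u k, T η w⟫_ℂ at h1
    rw [hw, hu, inner_smul_left, inner_smul_right, Complex.conj_ofReal] at h1
    exact_mod_cast mul_right_cancel₀ hk h1
  refine ⟨u k₀, hu0 k₀, α, χ k₀ ⟨α, hαa⟩, χ k₀ ⟨β, hβa⟩, hk₀, hcomm _ hαa _ hβa,
    hu k₀ ⟨α, hαa⟩, hu k₀ ⟨β, hβa⟩, fun l w hl hw => ?_, fun w hw hαw => ?_⟩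
  · refine (u.repr.map_eq_zero_iff).1 (PiLp.ext fun k => ?_)
    rw [u.repr_apply_apply, PiLp.zero_apply]
    by_contra hk
    have h1 := hcoord w ⟨α, hαa⟩ l hw k hk
    by_cases h2 : m k = β
    · have := heq k h2 ⟨α, hαa⟩
      linarith
    · have := hlt k h2
      linarith
  · have hk : ∀ k, ⟪u k, w⟫_ℂ ≠ 0 → m k = β := by
      intro k hk
      by_contra h2
      have h1 := hcoord w ⟨α, hαa⟩ _ hαw k hk
      have := hlt k h2
      linarith
    have hwη : ∀ η, T η w = (χ k₀ η : ℂ) • w := by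
      intro η
      conv_lhs => rw [← u.sum_repr' w]
      conv_rhs => rw [← u.sum_repr' w]
      rw [map_sum, Finset.smul_sum]
      refine Finset.sum_congr rfl fun k _ => ?_
      by_cases h0 : ⟪u k, w⟫_ℂ = 0
      · simp [h0]
      · rw [map_smul, hu, heq k (hk k h0), smul_comm]
    obtain ⟨h1, h2⟩ := hmem w hw (χ k₀) hwη
    refine eq_of_forall_bilin hB h1 hβa fun η hη => ?_
    have h3 := h2 ⟨η, hη⟩
    have h4 := (hm k₀).2 ⟨η, hη⟩
    rw [hk₀] at h4
    simp only at h3 h4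
    rw [h3, h4]

end UnitaryRep

end ExtremePoints

/-! ### The highest weight vector attached to an extreme point -/

section HighestWeight

lemma eq_zero_of_mem_fil {E : Type*} [AddCommGroup E] [Module ℂ E] {A : Module.End ℂ E}
    {c l : ℝ} {x : E} (hc : c < l) (hx : x ∈ fil A c) (hl : A x = (l : ℂ) • x) : x = 0 := by
  have hle : fil A c ≤ ⨆ (z : ℂ) (_ : z ≠ (l : ℂ)), A.eigenspace z := by
    refine Submodule.span_le.2 ?_
    rintro y ⟨k, hk, hy⟩
    have hkl : (k : ℂ) ≠ (l : ℂ) := fun h => by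
      have := Complex.ofReal_injective h
      linarith
    exact Submodule.mem_iSup_of_mem (k : ℂ) (Submodule.mem_iSup_of_mem hkl
      (Module.End.mem_eigenspace_iff.2 hy))
  exact Submodule.disjoint_def.1 (A.eigenspaces_iSupIndep (l : ℂ)) x
    (Module.End.mem_eigenspace_iff.2 hl) (hle hx)

variable {n : Type*} [Fintype n] [DecidableEq n]
  {G : ReductiveGroup n} {W : Type*} [NormedAddCommGroup W] [InnerProductSpace ℂ W]

/-- `w₀` is a highest weight vector of weight `β₀` for the parabolic subalgebra defined by `β`. -/
structure UnitaryRep.IsHighestWeight (ρ : UnitaryRep W G) (β : G.𝔭) (β₀ : ℝ) (w₀ : W) : Prop where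
  ne_zero : w₀ ≠ 0
  eigen : ρ.dρ (G.ofP β) w₀ = (β₀ : ℂ) • w₀
  mem_span : ∀ w, ρ.dρ (G.ofP β) w = (β₀ : ℂ) • w → w ∈ Submodule.span ℂ {w₀}
  sup_eq_top : Submodule.span ℂ {w₀} ⊔
    Submodule.span ℂ {w | ∃ l : ℝ, l < β₀ ∧ ρ.dρ (G.ofP β) w = (l : ℂ) • w} = ⊤
  dρ_mem : ∀ X : G.lie, ρ.dρ X w₀ ∈ Submodule.span ℂ {w₀} ⊔
    Submodule.span ℂ {w | ∃ (Y : G.lie) (b : ℝ), b < 0 ∧ G.ad (G.ofP β) Y = (b : ℂ) • Y ∧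
      ρ.dρ Y w₀ = w}
  inj : ∀ (X : G.lie) (b : ℝ), b < 0 → G.ad (G.ofP β) X = (b : ℂ) • X → ρ.dρ X w₀ = 0 → X = 0
  mem_lieOrbit : w₀ ∈ ρ.lieOrbit w₀

namespace UnitaryRep

variable [FiniteDimensional ℂ W] {ρ : UnitaryRep W G} {s : ℝ} {B : LinearMap.BilinForm ℝ G.𝔭}
  {μ : ℙ ℂ W → G.𝔭} {c : G.𝔭 →ₗ[ℝ] ℝ}

/-- `A` preserves the `α`-eigenspace, and `μ` is constant there, so `⟨Aw, w⟩ = κ ⟨w, w⟩` on it. Over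
`ℂ` the quadratic form determines the operator: `A` acts as the scalar `κ`. -/
lemma dρ_mem_span_of_commute
    (hc : ∀ (α : G.𝔭) (w : W) (hw : w ≠ 0),
      B (μ (Projectivization.mk ℂ w hw)) α = s / 2 * ρ.rayleigh α w + c α) (hs : 0 < s)
    {α β : G.𝔭} {a₀ : ℝ} {v : W} (hv : v ≠ 0) (hα : ρ.dρ (G.ofP α) v = (a₀ : ℂ) • v)
    (hconst : ∀ (w : W) (hw : w ≠ 0), ρ.dρ (G.ofP α) w = (a₀ : ℂ) • w →
        μ (Projectivization.mk ℂ w hw) = β)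
    (A : G.𝔭) (hA : Commute (α : Matrix n n ℂ) A) :
    ρ.dρ (G.ofP A) v ∈ Submodule.span ℂ {v} := by
  let V := (ρ.dρ (G.ofP α)).eigenspace (a₀ : ℂ)
  have h0 : G.ad (G.ofP α) (G.ofP A) = (0 : ℂ) • G.ofP A := by
    rw [zero_smul]
    exact Subtype.ext (by simpa [sub_eq_zero] using hA.eq)
  have hV : ∀ w ∈ V, ρ.dρ (G.ofP A) w ∈ V := by
    intro w hw
    have := dρ_eigen_add (ρ := ρ) h0 (Module.End.mem_eigenspace_iff.1 hw)
    rw [add_zero] at this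
    exact Module.End.mem_eigenspace_iff.2 this
  let κ : ℝ := ρ.rayleigh A v
  have hκ : ∀ w ∈ V, ⟪ρ.dρ (G.ofP A) w, w⟫_ℂ = (κ : ℂ) * ⟪w, w⟫_ℂ := by
    intro w hw
    by_cases hw0 : w = 0
    · simp [hw0]
    have h1 := hc A w hw0
    have h2 := hc A v hv
    rw [hconst w hw0 (Module.End.mem_eigenspace_iff.1 hw)] at h1
    rw [hconst v hv hα] at h2
    have h3 : ρ.rayleigh A w = κ := by
      have : s / 2 * ρ.rayleigh A w = s / 2 * κ := by simp only [κ]; linarith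
      exact mul_left_cancel₀ (by positivity) this
    have hn : ‖w‖ ^ 2 ≠ 0 := pow_ne_zero 2 (norm_ne_zero_iff.2 hw0)
    rw [rayleigh, div_eq_iff hn] at h3
    rw [inner_dρ_ofP_self, h3, inner_self_eq_norm_sq_to_K]
    push_cast
    rfl
  let T : V →ₗ[ℂ] V := (ρ.dρ (G.ofP A)).restrict hV - (κ : ℂ) • LinearMap.id
  have hT : T = 0 := by
    rw [← inner_map_self_eq_zero]
    intro x
    change ⟪ρ.dρ (G.ofP A) x - (κ : ℂ) • (x : W), (x : W)⟫_ℂ = 0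
    rw [inner_sub_left, hκ x x.2, inner_smul_left, Complex.conj_ofReal, sub_self]
  have hvV : v ∈ V := Module.End.mem_eigenspace_iff.2 hα
  have := congrArg Subtype.val (LinearMap.congr_fun hT ⟨v, hvV⟩)
  change ρ.dρ (G.ofP A) v - (κ : ℂ) • v = 0 at this
  rw [sub_eq_zero.1 this]
  exact Submodule.smul_mem _ _ (Submodule.mem_span_singleton_self v)

/-- The parabolic subalgebra of non-negative weights of `β` stabilizes the line of `v`. -/
lemma exists_weight_basis (hB : G.IsInvariantInner B) (hs : 0 < s) (hμ : ρ.IsMomentumMap s B μ)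
    (hc : ∀ (α : G.𝔭) (w : W) (hw : w ≠ 0),
      B (μ (Projectivization.mk ℂ w hw)) α = s / 2 * ρ.rayleigh α w + c α)
    (hc' : ∀ η X : G.𝔭, c (G.brk η X) = 0)
    {β : G.𝔭} (hβ : β ∈ (convexHull ℝ (Set.range μ)).extremePoints ℝ) :
    ∃ (v : W) (hv : v ≠ 0) (b₀ : ℝ) (N : ℕ) (e : Module.Basis (Fin N) ℂ G.lie) (b : Fin N → ℝ),
      μ (Projectivization.mk ℂ v hv) = β ∧ ρ.dρ (G.ofP β) v = (b₀ : ℂ) • v ∧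
      (∀ j, G.ad (G.ofP β) (e j) = (b j : ℂ) • e j) ∧
      ∀ j, 0 ≤ b j → ρ.dρ (e j) v ∈ Submodule.span ℂ {v} := by
  obtain ⟨v, hv, α, a₀, b₀, hμv, hαβ, hαv, hβv, htop, hconst⟩ := exists_exposing hB hs hμ hc hβ
  obtain ⟨N, e, a, b, he⟩ := exists_joint_adMat_basis G.lie (α : Matrix n n ℂ) β α.2.2 β.2.2
    hαβ.eq (fun X hX => G.commutator_mem_lie α.2.1 hX) (fun X hX => G.commutator_mem_lie β.2.1 hX)
  have hea : ∀ j, G.ad (G.ofP α) (e j) = (a j : ℂ) • e j := fun j => Subtype.ext (he j).1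
  have heb : ∀ j, G.ad (G.ofP β) (e j) = (b j : ℂ) • e j := fun j => Subtype.ext (he j).2
  have hkill : ∀ (X : G.lie) (a : ℝ), 0 < a → G.ad (G.ofP α) X = (a : ℂ) • X → ρ.dρ X v = 0 := by
    intro X a ha hX
    refine htop (a₀ + a) _ (by linarith) ?_
    have := dρ_eigen_add (ρ := ρ) hX hαv
    push_cast
    exact this
  refine ⟨v, hv, b₀, N, e, b, hμv, hβv, heb, fun j hj => ?_⟩
  -- Negative `α`-weight: the adjoint of `e j` kills `v`, and the norm identity gives `‖e j v‖² ≤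
  -- 0`. Zero: the hermitian parts commute with `α`. Positive: `e j v` would exceed the top
  -- `α`-eigenvalue.
  rcases lt_trichotomy (a j) 0 with h | h | h
  · have hstar : ρ.dρ (G.lieStar (e j)) v = 0 :=
      hkill _ (-a j) (by linarith) (ReductiveGroup.ad_lieStar (hea j))
    have key := norm_dρ_sq_eq hB hc hc' hv hμv (heb j) hstar
    have hBn : 0 ≤ B (G.imP (e j)) (G.imP (e j)) := by
      by_cases h0 : G.imP (e j) = 0
      · rw [h0]; simp
      · exact (hB.pos _ h0).le
    have hv2 : 0 < ‖v‖ ^ 2 := by positivity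
    have h1 : s / 2 * (‖ρ.dρ (e j) v‖ ^ 2 / ‖v‖ ^ 2) ≤ 0 := by
      rw [key]
      have := mul_nonneg hj hBn
      linarith
    have h2 : ‖ρ.dρ (e j) v‖ ^ 2 = 0 := by
      by_contra hne
      have : 0 < ‖ρ.dρ (e j) v‖ ^ 2 := lt_of_le_of_ne (by positivity) (Ne.symm hne)
      have : 0 < s / 2 * (‖ρ.dρ (e j) v‖ ^ 2 / ‖v‖ ^ 2) := by positivity
      linarith
    rw [norm_eq_zero.1 (pow_eq_zero_iff two_ne_zero |>.1 h2)]
    exact zero_mem _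
  · have h0 : G.ad (G.ofP α) (e j) = ((0 : ℝ) : ℂ) • e j := by rw [hea, h]
    have h1 := ReductiveGroup.brk_reP h0
    have h2 := ReductiveGroup.brk_imP h0
    rw [neg_zero, zero_smul] at h2
    rw [zero_smul] at h1
    have m1 := dρ_mem_span_of_commute hc hs hv hαv hconst (G.reP (e j))
      (G.brk_eq_zero_iff.1 h1).symm
    have m2 := dρ_mem_span_of_commute hc hs hv hαv hconst (G.imP (e j))
      (G.brk_eq_zero_iff.1 h2).symm
    rw [G.eq_reP_add_imP (e j), dρ_add, dρ_smul]
    exact add_mem m1 (Submodule.smul_mem _ _ m2)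
  · rw [hkill _ _ h (hea j)]
    exact zero_mem _

/-- An irreducible representation is spanned by a vector stabilized by a parabolic subalgebra and
vectors of smaller weight. -/
lemma span_sup_lower_eq_top (hirr : ρ.rep.IsIrreducible) {β : G.𝔭} {v : W} (hv : v ≠ 0) {b₀ : ℝ}
    {N : ℕ} (e : Module.Basis (Fin N) ℂ G.lie) {b : Fin N → ℝ}
    (hβv : ρ.dρ (G.ofP β) v = (b₀ : ℂ) • v)
    (he : ∀ j, G.ad (G.ofP β) (e j) = (b j : ℂ) • e j)
    (hpar : ∀ j, 0 ≤ b j → ρ.dρ (e j) v ∈ Submodule.span ℂ {v}) :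
    Submodule.span ℂ {v} ⊔
      Submodule.span ℂ {w | ∃ l : ℝ, l < b₀ ∧ ρ.dρ (G.ofP β) w = (l : ℂ) • w} = ⊤ := by
  let neg : G.lie → Prop := fun X => ∃ b : ℝ, b < 0 ∧ G.ad (G.ofP β) X = (b : ℂ) • X
  let word : List G.lie → W := fun L => L.foldr (fun X w => ρ.dρ X w) v
  let U : Submodule ℂ W := Submodule.span ℂ {w | ∃ L : List G.lie, (∀ X ∈ L, neg X) ∧ word L = w}
  have hneg : ∀ X, neg X → ∀ w ∈ U, ρ.dρ X w ∈ U := by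
    intro X hX w hw
    induction hw using Submodule.span_induction with
    | mem w hw =>
      obtain ⟨L, hL, rfl⟩ := hw
      exact Submodule.subset_span ⟨X :: L, fun Y hY => by
        rcases List.mem_cons.1 hY with rfl | h
        exacts [hX, hL Y h], rfl⟩
    | zero => simp
    | add x y _ _ h1 h2 => rw [map_add]; exact add_mem h1 h2
    | smul r x _ h => rw [map_smul]; exact Submodule.smul_mem _ _ h
  have hvU : v ∈ U := Submodule.subset_span ⟨[], by simp, rfl⟩
  -- Induction on the length, moving `Z` inward by `Z X w = [Z, X] w + X Z w`. The claim is for all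
  -- `Z` at once because `[Z, X]` is again arbitrary; the empty word uses `hpar`.
  have hword : ∀ L : List G.lie, (∀ X ∈ L, neg X) → ∀ Z : G.lie, ρ.dρ Z (word L) ∈ U := by
    intro L
    induction L with
    | nil =>
      intro _ Z
      rw [← e.sum_repr Z, ← dρL_apply, map_sum, LinearMap.sum_apply]
      refine Submodule.sum_mem _ fun j _ => ?_
      rw [map_smul, LinearMap.smul_apply, dρL_apply]
      refine Submodule.smul_mem _ _ ?_
      by_cases hj : 0 ≤ b j
      · exact (Submodule.span_singleton_le_iff_mem v U).2 hvU (hpar j hj)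
      · exact hneg _ ⟨b j, not_le.1 hj, he j⟩ _ hvU
    | cons X L ih =>
      intro hL Z
      have hX : neg X := hL X (by simp)
      have hL' : ∀ Y ∈ L, neg Y := fun Y hY => hL Y (by simp [hY])
      have h := ρ.dρ_ad Z X (word L)
      have h' : ρ.dρ Z (word (X :: L)) =
          ρ.dρ (G.ad Z X) (word L) + ρ.dρ X (ρ.dρ Z (word L)) := by
        change ρ.dρ Z (ρ.dρ X (word L)) = _
        rw [h]; abel
      rw [h']
      exact add_mem (ih hL' _) (hneg X hX _ (ih hL' Z))
  have hU : U = ⊤ := by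
    refine ρ.eq_top_of_dρ_mem hirr U (fun Z w hw => ?_) fun h => ?_
    · induction hw using Submodule.span_induction with
      | mem w hw =>
        obtain ⟨L, hL, rfl⟩ := hw
        exact hword L hL Z
      | zero => simp
      | add x y _ _ h1 h2 => rw [map_add]; exact add_mem h1 h2
      | smul r x _ h => rw [map_smul]; exact Submodule.smul_mem _ _ h
    · rw [h, Submodule.mem_bot] at hvU
      exact hv hvU
  have hweight : ∀ L : List G.lie, (∀ X ∈ L, neg X) → ∃ l : ℝ, (L ≠ [] → l < b₀) ∧ l ≤ b₀ ∧
      ρ.dρ (G.ofP β) (word L) = (l : ℂ) • word L := by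
    intro L
    induction L with
    | nil => exact fun _ => ⟨b₀, by simp, le_rfl, hβv⟩
    | cons X L ih =>
      intro hL
      obtain ⟨l, -, hl, hw⟩ := ih fun Y hY => hL Y (by simp [hY])
      obtain ⟨b, hb, hX⟩ := hL X (by simp)
      refine ⟨l + b, fun _ => by linarith, by linarith, ?_⟩
      have := dρ_eigen_add (ρ := ρ) hX hw
      push_cast
      exact this
  rw [eq_top_iff, ← hU]
  refine Submodule.span_le.2 ?_
  rintro w ⟨L, hL, rfl⟩
  obtain ⟨l, hl, -, hw⟩ := hweight L hL
  by_cases h0 : L = []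
  · rw [h0]
    exact Submodule.mem_sup_left (Submodule.mem_span_singleton_self v)
  · exact Submodule.mem_sup_right (Submodule.subset_span ⟨l, hl h0, hw⟩)

/-- The top eigenspace of an extreme point is spanned by a highest weight vector. -/
lemma isHighestWeight_of_extreme (hirr : ρ.rep.IsIrreducible)
    (hnontriv : ∃ g w, ρ.rep g w ≠ w) (hB : G.IsInvariantInner B) (hs : 0 < s)
    (hμ : ρ.IsMomentumMap s B μ)
    {β : G.𝔭} (hβ : β ∈ (convexHull ℝ (Set.range μ)).extremePoints ℝ) {β₀ : ℝ}
    (hβ₀ : IsGreatest {t : ℝ | (ρ.dρ (G.ofP β)).HasEigenvalue (t : ℂ)} β₀)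
    {w₀ : W} (hw₀ : ρ.dρ (G.ofP β) w₀ = (β₀ : ℂ) • w₀) (hw₀' : w₀ ≠ 0) :
    ρ.IsHighestWeight β β₀ w₀ := by
  have : Nontrivial W := ⟨w₀, 0, hw₀'⟩
  obtain ⟨c, hc⟩ := hμ.exists_const
  have hc' := hμ.const_brk hB hc
  obtain ⟨v, hv, b₀, N, e, b, hμv, hβv, he, hpar⟩ := exists_weight_basis hB hs hμ hc hc' hβ
  have hsup := span_sup_lower_eq_top hirr hv e hβv he hpar
  have htop : ∀ (l : ℝ) (w : W), β₀ < l → ρ.dρ (G.ofP β) w = (l : ℂ) • w → w = 0 := by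
    intro l w hl hw
    by_contra h0
    have := hβ₀.2 (Module.End.hasEigenvalue_of_hasEigenvector
      ⟨Module.End.mem_eigenspace_iff.2 hw, h0⟩)
    linarith
  obtain ⟨δ, hδ, hgap⟩ := exists_gap (ρ.dρ (G.ofP β)) b₀
  have hlow : Submodule.span ℂ {w | ∃ l : ℝ, l < b₀ ∧ ρ.dρ (G.ofP β) w = (l : ℂ) • w} ≤
      fil (ρ.dρ (G.ofP β)) (b₀ - δ) := by
    refine Submodule.span_le.2 ?_
    rintro w ⟨l, hl, hw⟩
    exact hgap δ le_rfl l w hl hw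
  -- If `b₀ < β₀`, all of `W` lies in level `b₀`, which contains no eigenvector for `β₀`.
  have hb₀ : b₀ = β₀ := by
    rcases lt_trichotomy b₀ β₀ with h | h | h
    · exfalso
      have hfil : w₀ ∈ fil (ρ.dρ (G.ofP β)) b₀ := by
        have h1 : w₀ ∈ (⊤ : Submodule ℂ W) := trivial
        rw [← hsup] at h1
        refine (sup_le ?_ (hlow.trans (fil_mono _ (by linarith)))) h1
        exact (Submodule.span_singleton_le_iff_mem _ _).2 (mem_fil le_rfl hβv)
      exact hw₀' (eq_zero_of_mem_fil h hfil hw₀)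
    · exact h
    · exact absurd (htop _ _ h hβv) hv
  subst hb₀
  have hmem : ∀ w, ρ.dρ (G.ofP β) w = (b₀ : ℂ) • w → w ∈ Submodule.span ℂ {v} := by
    intro w hw
    have h1 : w ∈ (⊤ : Submodule ℂ W) := trivial
    rw [← hsup] at h1
    obtain ⟨y, hy, x, hx, rfl⟩ := Submodule.mem_sup.1 h1
    obtain ⟨z, rfl⟩ := Submodule.mem_span_singleton.1 hy
    have hx' : ρ.dρ (G.ofP β) x = (b₀ : ℂ) • x := by
      rw [map_add, map_smul, hβv, smul_add, smul_comm] at hw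
      exact add_left_cancel hw
    rw [eq_zero_of_mem_fil (by linarith) (hlow hx) hx', add_zero]
    exact hy
  obtain ⟨z, hz⟩ := Submodule.mem_span_singleton.1 (hmem w₀ hw₀)
  have hz0 : z ≠ 0 := by rintro rfl; rw [zero_smul] at hz; exact hw₀' hz.symm
  have hspan : Submodule.span ℂ {w₀} = Submodule.span ℂ {v} := by
    rw [← hz]
    exact Submodule.span_singleton_smul_eq (IsUnit.mk0 z hz0) v
  have hμ₀ : μ (Projectivization.mk ℂ w₀ hw₀') = β := by
    rw [← hμv]
    congr 1
    exact (Projectivization.mk_eq_mk_iff' ℂ _ _ _ _).2 ⟨z, hz⟩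
  have hpar₀ : ∀ j, 0 ≤ b j → ρ.dρ (e j) w₀ ∈ Submodule.span ℂ {w₀} := by
    intro j hj
    rw [hspan, ← hz, map_smul]
    exact Submodule.smul_mem _ _ (hpar j hj)
  have hstar : ∀ (X : G.lie) (b : ℝ), b < 0 → G.ad (G.ofP β) X = (b : ℂ) • X →
      ρ.dρ (G.lieStar X) w₀ = 0 := by
    intro X b hb hX
    refine htop (b₀ + -b) _ (by linarith) ?_
    have := dρ_eigen_add (ρ := ρ) (ReductiveGroup.ad_lieStar hX) hw₀
    push_cast at this ⊢
    exact this
  refine ⟨hw₀', hw₀, fun w hw => hspan ▸ hmem w hw, hspan ▸ hsup, fun X => ?_,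
    fun X b hb hX hX0 => ?_, ?_⟩
  · rw [← e.sum_repr X, ← dρL_apply, map_sum, LinearMap.sum_apply]
    refine Submodule.sum_mem _ fun j _ => ?_
    rw [map_smul, LinearMap.smul_apply, dρL_apply]
    refine Submodule.smul_mem _ _ ?_
    by_cases hj : 0 ≤ b j
    · exact Submodule.mem_sup_left (hpar₀ j hj)
    · exact Submodule.mem_sup_right (Submodule.subset_span ⟨e j, b j, not_le.1 hj, he j, rfl⟩)
  -- With `X w₀ = 0` and `b ≠ 0` the norm identity forces `B(C, C) = 0`, so `C = 0`, and then `A =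
  -- 0` by the weight equation.
  · have key := norm_dρ_sq_eq hB hc hc' hw₀' hμ₀ hX (hstar X b hb hX)
    rw [hX0, norm_zero] at key
    have h0 : B (G.imP X) (G.imP X) = 0 := by
      have : -(2 * b) * B (G.imP X) (G.imP X) = 0 := by rw [← key]; simp
      exact (mul_eq_zero.1 this).resolve_left (by linarith)
    refine ReductiveGroup.eq_zero_of_imP_eq_zero hX hb.ne ?_
    by_contra hne
    exact (hB.pos _ hne).ne' h0
  -- Otherwise `𝔤 w₀` meets the line of `w₀` only in `0`. This kills `e j w₀` for weights `≥ 0`. For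
  -- negative weight, `X* X w₀ = [X*, X] w₀` is a top-weight vector in `𝔤 w₀`, hence zero, so `‖X
  -- w₀‖² = 0`. Then `𝔤` kills `w₀`, and irreducibility makes the representation trivial.
  · by_contra hnot
    have hline : ∀ w ∈ Submodule.span ℂ {w₀}, w ∈ ρ.lieOrbit w₀ → w = 0 := by
      intro w hw hw'
      obtain ⟨y, rfl⟩ := Submodule.mem_span_singleton.1 hw
      by_contra hne
      have hy : y ≠ 0 := by rintro rfl; simp at hne
      apply hnot
      have := Submodule.smul_mem _ y⁻¹ hw'
      rwa [smul_smul, inv_mul_cancel₀ hy, one_smul] at this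
    have horb : ∀ X : G.lie, ρ.dρ X w₀ ∈ ρ.lieOrbit w₀ := fun X => Submodule.subset_span ⟨X, rfl⟩
    have hzero : ∀ j, ρ.dρ (e j) w₀ = 0 := by
      intro j
      by_cases hj : 0 ≤ b j
      · exact hline _ (hpar₀ j hj) (horb _)
      · have hs1 := hstar (e j) (b j) (not_le.1 hj) (he j)
        have h1 : ρ.dρ (G.ad (G.lieStar (e j)) (e j)) w₀ =
            ρ.dρ (G.lieStar (e j)) (ρ.dρ (e j) w₀) := by
          rw [dρ_ad, hs1, map_zero, sub_zero]
        have h2 : ρ.dρ (G.lieStar (e j)) (ρ.dρ (e j) w₀) = 0 := by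
          refine hline _ ?_ (h1 ▸ horb _)
          rw [hspan]
          refine hmem _ ?_
          have := dρ_eigen_add (ρ := ρ) (ReductiveGroup.ad_lieStar (he j))
            (dρ_eigen_add (ρ := ρ) (he j) hw₀)
          rw [this]
          congr 1
          push_cast
          ring
        have h3 := ρ.inner_dρ (e j) w₀ (ρ.dρ (e j) w₀)
        rw [h2, inner_zero_right] at h3
        exact inner_self_eq_zero.1 h3
    have hzero' : ∀ X : G.lie, ρ.dρ X w₀ = 0 := by
      intro X
      rw [← e.sum_repr X, ← dρL_apply, map_sum, LinearMap.sum_apply]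
      refine Finset.sum_eq_zero fun j _ => ?_
      rw [map_smul, LinearMap.smul_apply, dρL_apply, hzero, smul_zero]
    have hall : Submodule.span ℂ {w₀} = ⊤ := by
      refine ρ.eq_top_of_dρ_mem hirr _ (fun X w hw => ?_) fun h => ?_
      · obtain ⟨y, rfl⟩ := Submodule.mem_span_singleton.1 hw
        rw [map_smul, hzero', smul_zero]
        exact zero_mem _
      · exact hw₀' (Submodule.span_singleton_eq_bot.1 h)
    obtain ⟨g, w, hgw⟩ := hnontriv
    have hw : w ∈ Submodule.span ℂ {w₀} := hall ▸ trivial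
    obtain ⟨y, rfl⟩ := Submodule.mem_span_singleton.1 hw
    exact hgw (by rw [map_smul, ρ.rep_eq_of_dρ_eq_zero hzero'])

/-- The maximum of `μ^β` is attained exactly on the line of the highest weight vector. -/
lemma maxSet_eq (hs : 0 < s) (hμ : ρ.IsMomentumMap s B μ) {β : G.𝔭} {β₀ : ℝ}
    (hβ₀ : IsGreatest {t : ℝ | (ρ.dρ (G.ofP β)).HasEigenvalue (t : ℂ)} β₀)
    {w₀ : W} (hw₀ : ρ.IsHighestWeight β β₀ w₀) :
    maxSet B μ β = {Projectivization.mk ℂ w₀ hw₀.ne_zero} := by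
  have : Nontrivial W := ⟨w₀, 0, hw₀.ne_zero⟩
  obtain ⟨c, hc⟩ := hμ.exists_const
  obtain ⟨N, u, χ, hu⟩ := exists_joint_eigenbasis (fun _ : Unit => ρ.dρ (G.ofP β))
    (fun _ => ρ.dρ_ofP_isSymmetric β) (fun _ _ => Commute.refl _)
  replace hu : ∀ k, ρ.dρ (G.ofP β) (u k) = (χ k () : ℂ) • u k := fun k => hu k ()
  have hle : ∀ k, χ k () ≤ β₀ := fun k => hβ₀.2 (Module.End.hasEigenvalue_of_hasEigenvector
    ⟨Module.End.mem_eigenspace_iff.2 (hu k), u.orthonormal.ne_zero k⟩)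
  -- The defect from the maximum is a sum of nonnegative terms; equality kills every component
  -- outside the `β₀`-eigenspace.
  have hsum : ∀ w : W, β₀ * ‖w‖ ^ 2 - (⟪ρ.dρ (G.ofP β) w, w⟫_ℂ).re =
      ∑ k, (β₀ - χ k ()) * ‖⟪u k, w⟫_ℂ‖ ^ 2 := by
    intro w
    rw [re_inner_eq_sum (ρ.dρ_ofP_isSymmetric β) u hu, ← u.sum_sq_norm_inner_right w,
      Finset.mul_sum, ← Finset.sum_sub_distrib]
    exact Finset.sum_congr rfl fun k _ => by ring
  have hnonneg : ∀ (w : W) (k : Fin N), 0 ≤ (β₀ - χ k ()) * ‖⟪u k, w⟫_ℂ‖ ^ 2 := fun w k =>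
    mul_nonneg (sub_nonneg.2 (hle k)) (by positivity)
  have hray : ∀ w : W, w ≠ 0 → ρ.rayleigh β w ≤ β₀ := by
    intro w hw
    rw [rayleigh, div_le_iff₀ (by positivity)]
    have := Finset.sum_nonneg fun k (_ : k ∈ Finset.univ) => hnonneg w k
    rw [← hsum] at this
    linarith
  have hray₀ : ρ.rayleigh β w₀ = β₀ := ρ.rayleigh_of_eigen hw₀.ne_zero hw₀.eigen
  have hs2 : 0 < s / 2 := by positivity
  ext x
  rw [Set.mem_singleton_iff]
  induction x using Projectivization.ind with
  | h w hw =>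
  constructor
  · intro hx
    have h1 := hx (Projectivization.mk ℂ w₀ hw₀.ne_zero)
    rw [hc, hc, hray₀, add_le_add_iff_right] at h1
    have h2 : ρ.rayleigh β w = β₀ := le_antisymm (hray w hw) (le_of_mul_le_mul_left h1 hs2)
    rw [rayleigh, div_eq_iff (by positivity)] at h2
    have h3 := hsum w
    rw [h2, sub_self] at h3
    have h4 := (Finset.sum_eq_zero_iff_of_nonneg fun k _ => hnonneg w k).1 h3.symm
    have h5 : ρ.dρ (G.ofP β) w = (β₀ : ℂ) • w := by
      conv_lhs => rw [← u.sum_repr' w]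
      conv_rhs => rw [← u.sum_repr' w]
      rw [map_sum, Finset.smul_sum]
      refine Finset.sum_congr rfl fun k hk => ?_
      rw [map_smul, hu, smul_comm]
      rcases mul_eq_zero.1 (h4 k hk) with h | h
      · rw [sub_eq_zero.1 h]
      · have : ⟪u k, w⟫_ℂ = 0 := norm_eq_zero.1 (pow_eq_zero_iff two_ne_zero |>.1 h)
        rw [this]
        simp
    obtain ⟨y, hy⟩ := Submodule.mem_span_singleton.1 (hw₀.mem_span w h5)
    exact (Projectivization.mk_eq_mk_iff' ℂ _ _ _ _).2 ⟨y, hy⟩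
  · intro hx
    rw [hx]
    intro y
    induction y using Projectivization.ind with
    | h y hy =>
    rw [hc, hc, hray₀]
    exact add_le_add_left (mul_le_mul_of_nonneg_left (hray y hy) hs2.le) _

end UnitaryRep

end HighestWeight

/-! ### Truncated exponentials -/

section TruncExp

lemma exp_eq_truncExp {A : Type*} [Ring A] [Algebra ℂ A] [TopologicalSpace A]
    [IsTopologicalRing A] {x : A} {m : ℕ} (h : x ^ m = 0) :
    NormedSpace.exp x = truncExp m x := by
  rw [NormedSpace.exp_eq_tsum ℂ, truncExp]
  refine tsum_eq_sum fun k hk => ?_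
  rw [Finset.mem_range, not_lt] at hk
  rw [pow_eq_zero_of_le hk h, smul_zero]

lemma truncExp_map {A A' : Type*} [Ring A] [Algebra ℂ A] [Ring A'] [Algebra ℂ A']
    (f : A →ₐ[ℂ] A') (m : ℕ) (x : A) : f (truncExp m x) = truncExp m (f x) := by
  simp [truncExp, map_sum]

/-- Isolates the linear term from the powers of degree at least two; the length `m + 2` ensures that
constant and linear terms are present. -/
lemma truncExp_sub_truncExp {A : Type*} [Ring A] [Algebra ℂ A] (m : ℕ) (a b : A) :
    truncExp (m + 2) a - truncExp (m + 2) b =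
      (a - b) + ∑ k ∈ Finset.range m,
        (((k + 2).factorial : ℂ)⁻¹) • (a ^ (k + 1 + 1) - b ^ (k + 1 + 1)) := by
  rw [truncExp, truncExp, ← Finset.sum_sub_distrib, Finset.sum_range_succ',
    Finset.sum_range_succ']
  simp only [← smul_sub]
  rw [add_assoc, add_comm]
  simp

lemma truncExp_zero {A : Type*} [Ring A] [Algebra ℂ A] (m : ℕ) : truncExp (m + 2) (0 : A) = 1 := by
  rw [truncExp, Finset.sum_range_succ']
  simp

variable {E : Type*} [AddCommGroup E] [Module ℂ E]

/-- Each nonlinear term has at least one extra factor lowering by `δ`. This is the contraction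
estimate behind both fixed-point iterations below. -/
lemma truncExp_sub_mem_fil {A a b : Module.End ℂ E} {δ c : ℝ} (hδ : 0 ≤ δ)
    (ha : ∀ t, ∀ x ∈ fil A t, a x ∈ fil A (t - δ))
    (hb : ∀ t, ∀ x ∈ fil A t, b x ∈ fil A (t - δ))
    (hab : ∀ t, ∀ x ∈ fil A t, (a - b) x ∈ fil A (t + c)) (m : ℕ) {t : ℝ} {x : E}
    (hx : x ∈ fil A t) :
    (truncExp (m + 2) a - truncExp (m + 2) b - (a - b)) x ∈ fil A (t + c - δ) := by
  rw [truncExp_sub_truncExp, add_sub_cancel_left, LinearMap.sum_apply]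
  refine Submodule.sum_mem _ fun k _ => Submodule.smul_mem _ _ ?_
  refine fil_mono A ?_ (pow_sub_pow_mem_fil ha hb hab (k + 1) hx)
  push_cast
  nlinarith [mul_nonneg (Nat.cast_nonneg (α := ℝ) k) hδ]

lemma truncExp_sub_one_mem_fil {A a : Module.End ℂ E} {δ : ℝ} (hδ : 0 ≤ δ)
    (ha : ∀ t, ∀ x ∈ fil A t, a x ∈ fil A (t - δ)) (m : ℕ) {t : ℝ} {x : E}
    (hx : x ∈ fil A t) : truncExp (m + 2) a x - x ∈ fil A (t - δ) := by
  have h := truncExp_sub_truncExp m a 0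
  rw [truncExp_zero] at h
  have h' : truncExp (m + 2) a x - x = (truncExp (m + 2) a - 1) x := rfl
  rw [h', h, LinearMap.add_apply, LinearMap.sum_apply]
  refine add_mem (by simpa using ha t x hx) (Submodule.sum_mem _ fun k _ =>
    Submodule.smul_mem _ _ ?_)
  rw [zero_pow (Nat.succ_ne_zero _), sub_zero]
  refine fil_mono A ?_ (pow_mem_fil ha (k + 1 + 1) hx)
  push_cast
  nlinarith [mul_nonneg (Nat.cast_nonneg (α := ℝ) k) hδ]

end TruncExp

/-! ### Conjugation by a one-parameter group -/

section Conjugation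

variable {n : Type*} [Fintype n] [DecidableEq n]

/-- Conjugation by `exp(tβ)`. -/
def flow (β : Matrix n n ℂ) (t : ℝ) : Matrix n n ℂ →ₗ[ℂ] Matrix n n ℂ :=
  LinearMap.mulLeft ℂ (NormedSpace.exp ((t : ℂ) • β)) ∘ₗ
    LinearMap.mulRight ℂ (NormedSpace.exp (-((t : ℂ) • β)))

lemma flow_apply (β X : Matrix n n ℂ) (t : ℝ) :
    flow β t X = NormedSpace.exp ((t : ℂ) • β) * (X * NormedSpace.exp (-((t : ℂ) • β))) := rfl

lemma flow_eq_conj (β X : Matrix n n ℂ) (t : ℝ) :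
    flow β t X = (expGL ((t : ℂ) • β) : Matrix n n ℂ) * X *
      (((expGL ((t : ℂ) • β))⁻¹ : Matrix.GeneralLinearGroup n ℂ) : Matrix n n ℂ) := by
  rw [flow_apply, ← expGL_neg, Matrix.mul_assoc]
  rfl

lemma expGL_flow (β X : Matrix n n ℂ) (t : ℝ) :
    expGL (flow β t X) = expGL ((t : ℂ) • β) * expGL X * (expGL ((t : ℂ) • β))⁻¹ := by
  rw [flow_eq_conj, expGL_conj]

open scoped Matrix.Norms.Operator in
lemma exp_mul_eq_of_semiconj {P Q Y : Matrix n n ℂ} (h : Q * Y = Y * P) :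
    NormedSpace.exp Q * Y = Y * NormedSpace.exp P := by
  have h' : SemiconjBy Y P Q := h.symm
  exact (h'.exp_right).eq.symm

open scoped Matrix.Norms.Operator in
lemma exp_smul_one_matrix (z : ℂ) :
    NormedSpace.exp (z • (1 : Matrix n n ℂ)) = Complex.exp z • (1 : Matrix n n ℂ) := by
  have h := NormedSpace.algebraMap_exp_comm (𝕂 := ℂ) (𝔸 := Matrix n n ℂ) z
  rw [Algebra.algebraMap_eq_smul_one, Algebra.algebraMap_eq_smul_one, ← Complex.exp_eq_exp_ℂ] at h
  exact h.symm

/-- `βX = X(β + l)` exponentiates to `exp(tβ) X = e^{tl} X exp(tβ)`. -/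
lemma flow_eigen {β X : Matrix n n ℂ} {l : ℝ} (h : adMat β X = (l : ℂ) • X) (t : ℝ) :
    flow β t X = ((Real.exp (t * l) : ℝ) : ℂ) • X := by
  have h1 : ((t : ℂ) • β) * X = X * ((t : ℂ) • β + ((t * l : ℝ) : ℂ) • (1 : Matrix n n ℂ)) := by
    rw [adMat_apply, sub_eq_iff_eq_add] at h
    rw [Matrix.smul_mul, h, Matrix.mul_add, Matrix.mul_smul, Matrix.mul_smul, Matrix.mul_one]
    push_cast
    module
  have h2 := exp_mul_eq_of_semiconj h1
  rw [flow_apply, ← Matrix.mul_assoc, h2, Matrix.exp_add_of_commute _ _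
    ((Commute.one_right _).smul_right _), exp_smul_one_matrix, Matrix.mul_smul, Matrix.mul_one,
    Matrix.mul_smul, Matrix.smul_mul, Matrix.mul_assoc]
  have h3 : NormedSpace.exp ((t : ℂ) • β) * NormedSpace.exp (-((t : ℂ) • β)) = 1 := by
    rw [← Matrix.exp_add_of_commute _ _ (Commute.refl ((t : ℂ) • β)).neg_right]
    simp
  rw [h3, Matrix.mul_one, ← Complex.ofReal_exp]

lemma tendsto_flow_zero {β X : Matrix n n ℂ} {δ : ℝ} (hδ : 0 < δ)
    (hX : X ∈ fil (adMat β) (-δ)) :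
    Filter.Tendsto (fun t => flow β t X) Filter.atTop (𝓝 0) := by
  induction hX using Submodule.span_induction with
  | mem X hX =>
    obtain ⟨l, hl, hX⟩ := hX
    have h1 : Filter.Tendsto (fun t : ℝ => ((Real.exp (t * l) : ℝ) : ℂ)) Filter.atTop (𝓝 0) := by
      have : Filter.Tendsto (fun t : ℝ => Real.exp (t * l)) Filter.atTop (𝓝 0) :=
        Real.tendsto_exp_atBot.comp
          (Filter.tendsto_id.atTop_mul_const_of_neg (by linarith : l < 0))
      exact_mod_cast (Complex.continuous_ofReal.tendsto 0).comp this
    simp only [flow_eigen hX]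
    simpa using h1.smul_const X
  | zero => simp
  | add X Y _ _ h1 h2 => simpa using h1.add h2
  | smul r X _ h => simpa using h.const_smul r

open scoped Matrix.Norms.Operator in
/-- An element contracted by the flow is a sum of eigenvectors with negative eigenvalues. -/
lemma mem_span_of_tendsto_flow (V : Submodule ℂ (Matrix n n ℂ)) {β : Matrix n n ℂ} (hβ : βᴴ = β)
    (hV : ∀ X ∈ V, adMat β X ∈ V) (X : V)
    (hX : Filter.Tendsto (fun t => flow β t X) Filter.atTop (𝓝 0)) :
    X ∈ Submodule.span ℂ {Y : V | ∃ l : ℝ, l < 0 ∧ adMat β Y = (l : ℂ) • (Y : Matrix n n ℂ)} := by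
  obtain ⟨N, b, _, c, hb⟩ := exists_joint_adMat_basis V β β hβ hβ rfl hV hV
  have hbc : ∀ k, adMat β (b k) = (c k : ℂ) • (b k : Matrix n n ℂ) := fun k => (hb k).2
  rw [← b.sum_repr X]
  refine Submodule.sum_mem _ fun k _ => ?_
  by_cases hk : c k < 0
  · exact Submodule.smul_mem _ _ (Submodule.subset_span ⟨c k, hk, hbc k⟩)
  suffices h0 : b.repr X k = 0 by rw [h0, zero_smul]; exact zero_mem _
  obtain ⟨F, hF⟩ := LinearMap.exists_extend (b.coord k)
  have hF' : ∀ Y : V, F Y = b.repr Y k := fun Y => LinearMap.congr_fun hF Y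
  have h1 : ∀ t : ℝ, F (flow β t X) = ((Real.exp (t * c k) : ℝ) : ℂ) * b.repr X k := by
    intro t
    have h2 : flow β t X = ((∑ j, (b.repr X j * ((Real.exp (t * c j) : ℝ) : ℂ)) • b j : V) :
        Matrix n n ℂ) := by
      conv_lhs => rw [← b.sum_repr X]
      simp only [Submodule.coe_sum, Submodule.coe_smul, map_sum, map_smul, flow_eigen (hbc _),
        smul_smul]
    rw [h2, hF', map_sum, Finset.sum_apply']
    simp only [map_smul, Finsupp.smul_apply, b.repr_self, Finsupp.single_apply, smul_eq_mul,
      mul_ite, mul_one, mul_zero, Finset.sum_ite_eq', Finset.mem_univ, if_true]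
    ring
  have h2 : Filter.Tendsto (fun t => F (flow β t X)) Filter.atTop (𝓝 0) := by
    have := ((LinearMap.toContinuousLinearMap F).continuous.tendsto 0).comp hX
    simpa using! this
  -- A coordinate of weight `≥ 0` is multiplied by a factor at least `1` for `t ≥ 0`, yet must tend
  -- to `0`.
  have h3 : ‖b.repr X k‖ ≤ 0 := by
    refine ge_of_tendsto (by simpa using h2.norm) ?_
    filter_upwards [Filter.eventually_ge_atTop 0] with t ht
    rw [h1, norm_mul, Complex.norm_real, Real.norm_eq_abs, abs_of_pos (Real.exp_pos _)]
    have : 1 ≤ Real.exp (t * c k) := Real.one_le_exp (mul_nonneg ht (not_lt.1 hk))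
    nlinarith [norm_nonneg (b.repr X k)]
  exact norm_le_zero_iff.1 h3

end Conjugation

/-! ### The group `R^{β₋}` -/

section Rminus

variable {n : Type*} [Fintype n] [DecidableEq n] {G : ReductiveGroup n}
  {W : Type*} [NormedAddCommGroup W] [InnerProductSpace ℂ W]

/-- Numerical bounds for the weights of `β` on `𝔤`, on the matrices and on `W`. -/
structure WeightBounds (ρ : UnitaryRep W G) (β : G.𝔭) (β₀ : ℝ) where
  /-- a lower bound for the gaps between weights -/
  δ : ℝ
  δ_pos : 0 < δ
  /-- a bound for the number of steps in the filtrations -/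
  K : ℕ
  gap_lie : ∀ (l : ℝ) (X : G.lie), l < 0 → G.ad (G.ofP β) X = (l : ℂ) • X →
    X ∈ fil (G.ad (G.ofP β)) (-δ)
  gap_mat : ∀ (l : ℝ) (X : Matrix n n ℂ), l < 0 → adMat (β : Matrix n n ℂ) X = (l : ℂ) • X →
    X ∈ fil (adMat (β : Matrix n n ℂ)) (-δ)
  gap_rep : ∀ (l : ℝ) (w : W), l < β₀ → ρ.dρ (G.ofP β) w = (l : ℂ) • w →
    w ∈ fil (ρ.dρ (G.ofP β)) (β₀ - δ)
  bot_lie : fil (G.ad (G.ofP β)) (-(K * δ)) = ⊥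
  bot_mat : fil (adMat (β : Matrix n n ℂ)) (-(K * δ)) = ⊥
  bot_rep : fil (ρ.dρ (G.ofP β)) (β₀ - K * δ) = ⊥

lemma nonempty_weightBounds [FiniteDimensional ℂ W] (ρ : UnitaryRep W G) (β : G.𝔭) (β₀ : ℝ) :
    Nonempty (WeightBounds ρ β β₀) := by
  obtain ⟨δ₁, hδ₁, g₁⟩ := exists_gap (G.ad (G.ofP β)) 0
  obtain ⟨δ₂, hδ₂, g₂⟩ := exists_gap (adMat (β : Matrix n n ℂ)) 0
  obtain ⟨δ₃, hδ₃, g₃⟩ := exists_gap (ρ.dρ (G.ofP β)) β₀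
  obtain ⟨c₁, hc₁⟩ := exists_fil_eq_bot (G.ad (G.ofP β))
  obtain ⟨c₂, hc₂⟩ := exists_fil_eq_bot (adMat (β : Matrix n n ℂ))
  obtain ⟨c₃, hc₃⟩ := exists_fil_eq_bot (ρ.dρ (G.ofP β))
  let δ := min δ₁ (min δ₂ δ₃)
  have hδ : 0 < δ := lt_min hδ₁ (lt_min hδ₂ hδ₃)
  -- `Kδ ≥ |c₁| + |c₂| + |c₃| + |β₀|`, so `K` steps of size `δ` exhaust all three filtrations, the
  -- last one starting at `β₀`.
  obtain ⟨K, hK⟩ := exists_nat_ge ((|c₁| + |c₂| + |c₃| + |β₀|) / δ)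
  rw [div_le_iff₀ hδ] at hK
  have a₁ := neg_abs_le c₁
  have a₂ := neg_abs_le c₂
  have a₃ := neg_abs_le c₃
  have a₄ := le_abs_self β₀
  have n₁ := abs_nonneg c₁
  have n₂ := abs_nonneg c₂
  have n₃ := abs_nonneg c₃
  have n₄ := abs_nonneg β₀
  refine ⟨⟨δ, hδ, K, fun l X hl hX => ?_, fun l X hl hX => ?_, fun l X hl hX => ?_, ?_, ?_, ?_⟩⟩
  · simpa using g₁ δ (min_le_left _ _) l X hl hX
  · simpa using g₂ δ ((min_le_right _ _).trans (min_le_left _ _)) l X hl hX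
  · exact g₃ δ ((min_le_right _ _).trans (min_le_right _ _)) l X hl hX
  · exact eq_bot_iff.2 (hc₁ ▸ fil_mono _ (by linarith))
  · exact eq_bot_iff.2 (hc₂ ▸ fil_mono _ (by linarith))
  · exact eq_bot_iff.2 (hc₃ ▸ fil_mono _ (by linarith))

namespace WeightBounds

variable {ρ : UnitaryRep W G} {β : G.𝔭} {β₀ : ℝ} (C : WeightBounds ρ β β₀)

/-- The Lie algebra of `R^{β₋}`. -/
def nil : Submodule ℂ G.lie := fil (G.ad (G.ofP β)) (-C.δ)

lemma mul_mem_fil {X Y : Matrix n n ℂ} {a b : ℝ} (hX : X ∈ fil (adMat (β : Matrix n n ℂ)) a)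
    (hY : Y ∈ fil (adMat (β : Matrix n n ℂ)) b) :
    X * Y ∈ fil (adMat (β : Matrix n n ℂ)) (a + b) := by
  refine fil_bilinear (LinearMap.mul ℂ (Matrix n n ℂ)) (fun X Y => ?_) hX hY
  simp only [LinearMap.mul_apply', adMat_apply]
  noncomm_ring

lemma one_mem_fil : (1 : Matrix n n ℂ) ∈ fil (adMat (β : Matrix n n ℂ)) 0 :=
  mem_fil (l := 0) le_rfl (by simp)

lemma coe_mem_fil {X : G.lie} {a : ℝ} (hX : X ∈ fil (G.ad (G.ofP β)) a) :
    (X : Matrix n n ℂ) ∈ fil (adMat (β : Matrix n n ℂ)) a := by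
  have := fil_map (A₂ := adMat (β : Matrix n n ℂ)) G.lie.subtype 0 (fun x => by simp) hX
  simpa using this

lemma mulLeft_lowers {X : Matrix n n ℂ} (hX : X ∈ fil (adMat (β : Matrix n n ℂ)) (-C.δ)) :
    ∀ t, ∀ Y ∈ fil (adMat (β : Matrix n n ℂ)) t,
      LinearMap.mulLeft ℂ X Y ∈ fil (adMat (β : Matrix n n ℂ)) (t - C.δ) := by
  intro t Y hY
  have := mul_mem_fil hX hY
  rwa [neg_add_eq_sub] at this

/-- Left multiplication by `X` lowers levels by `δ` and `1` has level `0`, so enough factors land in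
the zero level. -/
lemma pow_mat_eq_zero {X : Matrix n n ℂ} (hX : X ∈ fil (adMat (β : Matrix n n ℂ)) (-C.δ)) :
    X ^ (C.K + 2) = 0 := by
  have h := pow_mem_fil (C.mulLeft_lowers hX) (C.K + 2) one_mem_fil
  rw [LinearMap.pow_mulLeft, LinearMap.mulLeft_apply, mul_one] at h
  have h2 := fil_mono _ (by push_cast; nlinarith [C.δ_pos] :
    (0 : ℝ) - ((C.K + 2 : ℕ) : ℝ) * C.δ ≤ -(C.K * C.δ)) h
  rwa [C.bot_mat, Submodule.mem_bot] at h2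

lemma exp_mat_eq {X : Matrix n n ℂ} (hX : X ∈ fil (adMat (β : Matrix n n ℂ)) (-C.δ)) :
    NormedSpace.exp X = truncExp (C.K + 2) X :=
  exp_eq_truncExp (C.pow_mat_eq_zero hX)

/-- Transfers the filtration estimates from endomorphisms to matrices, seen as left multiplications
applied to `1`. -/
lemma truncExp_mulLeft (m : ℕ) (X : Matrix n n ℂ) :
    truncExp m (LinearMap.mulLeft ℂ X) 1 = truncExp m X := by
  have := truncExp_map (Algebra.lmul ℂ (Matrix n n ℂ)) m X
  have h2 := congrArg (fun f : Module.End ℂ (Matrix n n ℂ) => f 1) this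
  simpa using! h2.symm

/-- The iteration whose fixed point is the logarithm of `Y`. -/
def logStep (Y X : Matrix n n ℂ) : Matrix n n ℂ := Y + X - truncExp (C.K + 2) X

/-- The logarithm on `R^{β₋}`. -/
def log (Y : Matrix n n ℂ) : Matrix n n ℂ := (C.logStep Y)^[C.K] 0

/-- The number of steps is fixed, so the map is polynomial on all matrices, although the inversion
of the exponential is only claimed when `Y - 1` has negative level. -/
lemma isPolynomialMap_log : IsPolynomialMap C.log := by
  have h : ∀ k : ℕ, IsPolynomialMap (fun Y => (C.logStep Y)^[k] 0) := by
    intro k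
    induction k with
    | zero => exact isPolynomialMap_const _
    | succ k ih =>
      simp only [Function.iterate_succ_apply', logStep]
      exact (isPolynomialMap_id.add ih).sub (ih.truncExp _)
  exact h C.K

lemma logStep_mem {X Y : Matrix n n ℂ} (hY : Y - 1 ∈ fil (adMat (β : Matrix n n ℂ)) (-C.δ))
    (hX : X ∈ fil (adMat (β : Matrix n n ℂ)) (-C.δ)) :
    C.logStep Y X ∈ fil (adMat (β : Matrix n n ℂ)) (-C.δ) := by
  have h := truncExp_sub_one_mem_fil C.δ_pos.le (C.mulLeft_lowers hX) C.K one_mem_fil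
  rw [truncExp_mulLeft, zero_sub] at h
  have e : C.logStep Y X = (Y - 1) + X - (truncExp (C.K + 2) X - 1) := by
    rw [logStep]; abel
  rw [e]
  exact sub_mem (add_mem hY hX) h

/-- The difference is minus the nonlinear part of `exp X - exp Z`, which lies `δ` below `X - Z`. -/
lemma logStep_contracts (Y : Matrix n n ℂ) {X Z : Matrix n n ℂ}
    (hX : X ∈ fil (adMat (β : Matrix n n ℂ)) (-C.δ))
    (hZ : Z ∈ fil (adMat (β : Matrix n n ℂ)) (-C.δ)) {c : ℝ}
    (hXZ : X - Z ∈ fil (adMat (β : Matrix n n ℂ)) c) :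
    C.logStep Y X - C.logStep Y Z ∈ fil (adMat (β : Matrix n n ℂ)) (c - C.δ) := by
  have h := truncExp_sub_mem_fil (c := c) C.δ_pos.le (C.mulLeft_lowers hX) (C.mulLeft_lowers hZ)
    (fun t V hV => by
      have := mul_mem_fil hXZ hV
      rw [add_comm, Matrix.sub_mul] at this
      exact this) C.K (one_mem_fil (β := β))
  rw [zero_add] at h
  have e : C.logStep Y X - C.logStep Y Z = -((truncExp (C.K + 2) (LinearMap.mulLeft ℂ X) -
      truncExp (C.K + 2) (LinearMap.mulLeft ℂ Z) -
      (LinearMap.mulLeft ℂ X - LinearMap.mulLeft ℂ Z)) 1) := by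
    simp only [LinearMap.sub_apply, truncExp_mulLeft, LinearMap.mulLeft_apply, mul_one, logStep]
    abel
  rw [e]
  exact neg_mem h

lemma iterate_logStep_eq {Y : Matrix n n ℂ}
    (hY : Y - 1 ∈ fil (adMat (β : Matrix n n ℂ)) (-C.δ)) {X Z : Matrix n n ℂ}
    (hX : X ∈ fil (adMat (β : Matrix n n ℂ)) (-C.δ))
    (hZ : Z ∈ fil (adMat (β : Matrix n n ℂ)) (-C.δ)) :
    (C.logStep Y)^[C.K] X = (C.logStep Y)^[C.K] Z :=
  iterate_eq_of_contracts C.bot_mat _ le_rfl _ (fun _ h => C.logStep_mem hY h)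
    (fun _ hx _ hy _ h => C.logStep_contracts Y hx hy h) (by nlinarith [C.δ_pos]) hX hZ

lemma log_mem {Y : Matrix n n ℂ} (hY : Y - 1 ∈ fil (adMat (β : Matrix n n ℂ)) (-C.δ)) :
    C.log Y ∈ fil (adMat (β : Matrix n n ℂ)) (-C.δ) := by
  have h : ∀ k : ℕ, (C.logStep Y)^[k] 0 ∈ fil (adMat (β : Matrix n n ℂ)) (-C.δ) := by
    intro k
    induction k with
    | zero => exact zero_mem _
    | succ k ih =>
      rw [Function.iterate_succ_apply']
      exact C.logStep_mem hY ih
  exact h C.K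

/-- `K` steps from `0` and from `logStep Y 0` agree, so `log Y` is a fixed point; fixed points of
the step are solutions of `exp X = Y`. -/
lemma exp_log {Y : Matrix n n ℂ} (hY : Y - 1 ∈ fil (adMat (β : Matrix n n ℂ)) (-C.δ)) :
    NormedSpace.exp (C.log Y) = Y := by
  have h1 : C.logStep Y (C.log Y) = C.log Y := by
    rw [log, ← Function.iterate_succ_apply' (C.logStep Y), Function.iterate_succ_apply]
    exact C.iterate_logStep_eq hY (C.logStep_mem hY (zero_mem _)) (zero_mem _)
  rw [C.exp_mat_eq (C.log_mem hY)]
  rw [logStep, add_sub_right_comm, add_eq_right, sub_eq_zero] at h1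
  exact h1.symm

lemma exp_mem_Rminus {X : G.lie} (hX : X ∈ C.nil) : G.exp X ∈ G.Rminus β := by
  change Filter.Tendsto _ _ _
  rw [tendsto_subtype_rng]
  have h1 := ((continuous_expGL (n := n)).tendsto 0).comp
    (tendsto_flow_zero C.δ_pos (coe_mem_fil hX))
  rw [expGL_zero] at h1
  refine h1.congr fun t => ?_
  rw [Function.comp_apply, expGL_flow]
  have e : ((t • β : G.𝔭) : Matrix n n ℂ) = (t : ℂ) • (β : Matrix n n ℂ) := by simp
  change _ = expGL ((t • β : G.𝔭) : Matrix n n ℂ) * expGL (X : Matrix n n ℂ) *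
    (expGL ((t • β : G.𝔭) : Matrix n n ℂ))⁻¹
  rw [e]

open scoped Matrix.Norms.Operator in
/-- Every element of `R^{β₋}` is the exponential of its logarithm. -/
lemma exists_log {g : G.carrier} (hg : g ∈ G.Rminus β) :
    ∃ X ∈ C.nil, G.exp X = g ∧
      C.log ((g : Matrix.GeneralLinearGroup n ℂ) : Matrix n n ℂ) = X := by
  set Y : Matrix n n ℂ := ((g : Matrix.GeneralLinearGroup n ℂ) : Matrix n n ℂ) with hYdef
  have hflow : ∀ t : ℝ, flow (β : Matrix n n ℂ) t Y =
      ((G.exp (G.ofP (t • β)) * g * (G.exp (G.ofP (t • β)))⁻¹ : G.carrier) :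
        Matrix.GeneralLinearGroup n ℂ) := by
    intro t
    have e : ((t • β : G.𝔭) : Matrix n n ℂ) = (t : ℂ) • (β : Matrix n n ℂ) := by simp
    rw [flow_eq_conj, ← e]
    rfl
  have hlim : Filter.Tendsto (fun t => flow (β : Matrix n n ℂ) t Y) Filter.atTop (𝓝 1) := by
    have hg' : Filter.Tendsto _ _ _ := hg
    have := ((Units.continuous_val.comp continuous_subtype_val).tendsto (1 : G.carrier)).comp hg'
    exact Filter.Tendsto.congr (fun t => (hflow t).symm) this
  have hone : ∀ t : ℝ, flow (β : Matrix n n ℂ) t 1 = 1 := by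
    intro t
    rw [flow_eq_conj, mul_one, Units.mul_inv]
  have hY : Y - 1 ∈ fil (adMat (β : Matrix n n ℂ)) (-C.δ) := by
    have h0 : Filter.Tendsto (fun t => flow (β : Matrix n n ℂ) t (Y - 1)) Filter.atTop (𝓝 0) := by
      simpa [hone] using hlim.sub_const 1
    have h1 := mem_span_of_tendsto_flow ⊤ (β := (β : Matrix n n ℂ)) β.2.2 (fun _ _ => trivial)
      ⟨Y - 1, trivial⟩ h0
    have h2 := Submodule.mem_map_of_mem (f := (⊤ : Submodule ℂ (Matrix n n ℂ)).subtype) h1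
    rw [Submodule.map_span] at h2
    refine Submodule.span_le.2 ?_ h2
    rintro _ ⟨Z, ⟨l, hl, hZ⟩, rfl⟩
    exact C.gap_mat l _ hl hZ
  have hXflow := tendsto_flow_zero C.δ_pos (C.log_mem hY)
  -- For large `t`, conjugation by `exp(tβ)` brings the group element near `1` and its logarithm
  -- near `0`. There the exponential is injective and elements of `G` have logarithms in `𝔤`;
  -- conjugating back preserves `𝔤`.
  have hXmem : C.log Y ∈ G.lie := by
    obtain ⟨L, -, -, -, hL⟩ := exists_local_log (𝔸 := Matrix n n ℂ)
    obtain ⟨V, hV, hVG⟩ := G.exists_exp_near hL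
    obtain ⟨t, ht1, ht2⟩ := ((hlim.eventually hV).and (hXflow.eventually hL)).exists
    obtain ⟨Z, hZ, hZL, hZe⟩ := hVG
      ((G.exp (G.ofP (t • β)) * g * (G.exp (G.ofP (t • β)))⁻¹ : G.carrier) :
        Matrix.GeneralLinearGroup n ℂ) (Subtype.prop _) (by rw [← hflow]; exact ht1)
    have hexp : NormedSpace.exp (flow (β : Matrix n n ℂ) t (C.log Y)) = NormedSpace.exp Z := by
      have h1 : NormedSpace.exp Z = flow (β : Matrix n n ℂ) t Y := by
        rw [hflow, ← hZe]; rfl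
      have h2 := congrArg (fun g : Matrix.GeneralLinearGroup n ℂ => (g : Matrix n n ℂ))
        (expGL_flow (β : Matrix n n ℂ) (C.log Y) t)
      simp only [coe_expGL, Units.val_mul, C.exp_log hY] at h2
      rw [h1, h2, flow_eq_conj]
      rfl
    have hZeq : flow (β : Matrix n n ℂ) t (C.log Y) = Z := by
      have hZL' : L (NormedSpace.exp Z) = Z := hZL
      rw [← hZL', ← hexp]
      exact ht2.symm
    have hk : expGL ((t : ℂ) • (β : Matrix n n ℂ)) ∈ G.carrier :=
      G.expGL_mem (G.lie.smul_mem _ β.2.1)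
    have hback := G.conj_mem_lie (G.carrier.inv_mem hk) hZ
    rw [← hZeq, flow_eq_conj] at hback
    simpa only [inv_inv, Matrix.mul_assoc, Units.inv_mul, Units.inv_mul_cancel_left, mul_one]
      using hback
  refine ⟨⟨C.log Y, hXmem⟩, ?_, ?_, rfl⟩
  · have h1 := mem_span_of_tendsto_flow G.lie (β := (β : Matrix n n ℂ)) β.2.2
      (fun _ hZ => G.commutator_mem_lie β.2.1 hZ) ⟨C.log Y, hXmem⟩ hXflow
    refine Submodule.span_le.2 ?_ h1
    rintro Z ⟨l, hl, hZ⟩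
    exact C.gap_lie l Z hl (Subtype.ext hZ)
  · exact Subtype.ext (Units.ext (C.exp_log hY))

end WeightBounds

end Rminus

/-! ### The slice at a highest weight vector -/

section Slice

set_option linter.unusedSectionVars false

variable {n : Type*} [Fintype n] [DecidableEq n] {G : ReductiveGroup n}
  {W : Type*} [NormedAddCommGroup W] [InnerProductSpace ℂ W]

lemma map_mem_fil {E : Type*} [AddCommGroup E] [Module ℂ E] {A : Module.End ℂ E} {c : ℝ} {x : E}
    (hx : x ∈ fil A c) : A x ∈ fil A c := by
  simpa using fil_map (A₂ := A) A 0 (fun x => by simp) hx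

/-- The linear data describing the slice at the highest weight vector `w₀`: the coordinate `ℓ`
along `w₀`, and a retraction `κ` of the map `X ↦ X · w₀` on the Lie algebra of `R^{β₋}`. -/
structure Slice {ρ : UnitaryRep W G} {β : G.𝔭} {β₀ : ℝ} (C : WeightBounds ρ β β₀) (w₀ : W) where
  /-- the coordinate along `w₀` -/
  ℓ : Module.Dual ℂ W
  /-- the retraction -/
  κ : W →ₗ[ℂ] G.lie
  sub_smul_mem : ∀ w, w - ℓ w • w₀ ∈ fil (ρ.dρ (G.ofP β)) (β₀ - C.δ)
  ℓ_of_mem : ∀ w ∈ fil (ρ.dρ (G.ofP β)) (β₀ - C.δ), ℓ w = 0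
  ℓ_eq_zero_iff : ∀ w, ℓ w = 0 ↔ w ∈ (Submodule.span ℂ {w₀})ᗮ
  mem_fil_top : w₀ ∈ fil (ρ.dρ (G.ofP β)) β₀
  κ_mem : ∀ w, κ w ∈ C.nil
  κ_dρ : ∀ X ∈ C.nil, κ (ρ.dρ X w₀) = X
  κ_mem_fil : ∀ t, ∀ w ∈ fil (ρ.dρ (G.ofP β)) t, κ w ∈ fil (G.ad (G.ofP β)) (t - β₀)
  κ_eq_zero_iff : ∀ w, κ w = 0 ↔ w ∈ Submodule.span ℂ {w₀} ⊔ (ρ.lieOrbit w₀)ᗮ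
  ℓ_κ_eq_zero_iff : ∀ w, (ℓ w = 0 ∧ κ w = 0) ↔ w ∈ (ρ.lieOrbit w₀)ᗮ

lemma UnitaryRep.rep_neg_rep (ρ : UnitaryRep W G) (X : G.lie) (y : W) : ρ.rep (G.exp (-X)) (ρ.rep (G.exp X) y) = y := by
  rw [G.exp_neg, ρ.rep.inv_self_apply]

lemma UnitaryRep.rep_rep_neg (ρ : UnitaryRep W G) (X : G.lie) (y : W) : ρ.rep (G.exp X) (ρ.rep (G.exp (-X)) y) = y := by
  rw [G.exp_neg, ρ.rep.self_inv_apply]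

variable [FiniteDimensional ℂ W] {ρ : UnitaryRep W G} {β : G.𝔭} {β₀ : ℝ} {w₀ : W}

lemma dρ_mem_fil {X : G.lie} {w : W} {a b : ℝ} (hX : X ∈ fil (G.ad (G.ofP β)) a)
    (hw : w ∈ fil (ρ.dρ (G.ofP β)) b) : ρ.dρ X w ∈ fil (ρ.dρ (G.ofP β)) (a + b) := by
  refine fil_bilinear ρ.dρL (fun X w => ?_) hX hw
  simp only [UnitaryRep.dρL_apply, ρ.dρ_ad]
  abel

/-- The Lie algebra of `R^{β₋}` acts freely on a highest weight vector. -/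
lemma UnitaryRep.IsHighestWeight.eq_zero_of_dρ_eq_zero (hw : ρ.IsHighestWeight β β₀ w₀)
    (C : WeightBounds ρ β β₀) {X : G.lie} (hX : X ∈ C.nil) (h0 : ρ.dρ X w₀ = 0) : X = 0 := by
  -- The annihilator of `w₀` in `𝔫` is stable under `ad β`, hence spanned by weight vectors. Those
  -- of negative weight vanish by `hw.inj`, the others because `𝔫` has only negative weights.
  let U : Submodule ℂ G.lie := C.nil ⊓ LinearMap.ker (ρ.dρL.flip w₀)
  let V : Submodule ℂ (Matrix n n ℂ) := U.map G.lie.subtype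
  have hV : ∀ Y ∈ V, adMat (β : Matrix n n ℂ) Y ∈ V := by
    rintro _ ⟨Y, ⟨hY1, hY2⟩, rfl⟩
    have hY2' : ρ.dρ Y w₀ = 0 := hY2
    refine ⟨G.ad (G.ofP β) Y, ⟨map_mem_fil hY1, ?_⟩, rfl⟩
    change ρ.dρ (G.ad (G.ofP β) Y) w₀ = 0
    rw [ρ.dρ_ad, hw.eigen, hY2', map_smul, hY2', map_zero, smul_zero, sub_zero]
  obtain ⟨N, b, _, c, hb⟩ := exists_joint_adMat_basis V β β β.2.2 β.2.2 rfl hV hV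
  have hb0 : ∀ k, b k = 0 := by
    intro k
    obtain ⟨Y, ⟨hY1, hY2⟩, hY⟩ := (b k).2
    have hYe : G.ad (G.ofP β) Y = (c k : ℂ) • Y := by
      apply Subtype.ext
      have := (hb k).2
      rw [← hY] at this
      exact this
    have hY0 : Y = 0 := by
      by_cases hk : c k < 0
      · exact hw.inj Y _ hk hYe hY2
      · exact eq_zero_of_mem_fil (by linarith [C.δ_pos]) hY1 hYe
    apply Subtype.ext
    rw [← hY, hY0]
    rfl
  have hXV : (X : Matrix n n ℂ) ∈ V := ⟨X, ⟨hX, h0⟩, rfl⟩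
  have := b.sum_repr ⟨(X : Matrix n n ℂ), hXV⟩
  simp only [hb0, smul_zero, Finset.sum_const_zero] at this
  have h1 : (X : Matrix n n ℂ) = 0 := congrArg Subtype.val this.symm
  exact Subtype.ext h1

lemma UnitaryRep.IsHighestWeight.inner_eq_zero (hw : ρ.IsHighestWeight β β₀ w₀)
    (C : WeightBounds ρ β β₀) {w : W} (h : w ∈ fil (ρ.dρ (G.ofP β)) (β₀ - C.δ)) :
    ⟪w₀, w⟫_ℂ = 0 := by
  induction h using Submodule.span_induction with
  | mem w h =>
    obtain ⟨l, hl, hlw⟩ := h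
    have h1 := ρ.dρ_ofP_isSymmetric β w₀ w
    rw [hw.eigen, hlw, inner_smul_left, inner_smul_right, Complex.conj_ofReal] at h1
    have h2 : ((β₀ : ℂ) - l) * ⟪w₀, w⟫_ℂ = 0 := by rw [sub_mul, h1, sub_self]
    refine (mul_eq_zero.1 h2).resolve_left fun h3 => ?_
    have : β₀ - l = 0 := by exact_mod_cast h3
    linarith [C.δ_pos]
  | zero => exact inner_zero_right _
  | add x y _ _ hx hy => rw [inner_add_right, hx, hy, add_zero]
  | smul c x _ hx => rw [inner_smul_right, hx, mul_zero]

/-- `κ` is the orthogonal projection onto `𝔫 w₀` followed by the inverse of `X ↦ X w₀`; `ℓ` is the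
normalized inner product with `w₀`. -/
lemma UnitaryRep.IsHighestWeight.nonempty_slice (hw : ρ.IsHighestWeight β β₀ w₀)
    (C : WeightBounds ρ β β₀) : Nonempty (Slice C w₀) := by
  let ι : C.nil →ₗ[ℂ] W := ρ.dρL.flip w₀ ∘ₗ C.nil.subtype
  have hι : ∀ X : C.nil, ι X = ρ.dρ X w₀ := fun _ => rfl
  have hιinj : Function.Injective ι := by
    rw [injective_iff_map_eq_zero]
    exact fun X hX => Subtype.ext (hw.eq_zero_of_dρ_eq_zero C X.2 hX)
  let e := LinearEquiv.ofInjective ι hιinj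
  let R := LinearMap.range ι
  let κ : W →ₗ[ℂ] G.lie := C.nil.subtype ∘ₗ e.symm.toLinearMap ∘ₗ
    (R.orthogonalProjectionOnto : W →ₗ[ℂ] R)
  let ℓ : Module.Dual ℂ W := (⟪w₀, w₀⟫_ℂ)⁻¹ • innerₛₗ ℂ w₀
  have hne : ⟪w₀, w₀⟫_ℂ ≠ 0 := inner_self_ne_zero.2 hw.ne_zero
  have hℓ : ∀ w, ℓ w = (⟪w₀, w₀⟫_ℂ)⁻¹ * ⟪w₀, w⟫_ℂ := fun _ => rfl
  have hℓ0 : ∀ w, ℓ w = 0 ↔ ⟪w₀, w⟫_ℂ = 0 := fun w => by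
    rw [hℓ, mul_eq_zero]
    exact or_iff_right (inv_ne_zero hne)
  have hℓ1 : ℓ w₀ = 1 := by rw [hℓ, inv_mul_cancel₀ hne]
  have htop : w₀ ∈ fil (ρ.dρ (G.ofP β)) β₀ := mem_fil le_rfl hw.eigen
  have hκR : ∀ X ∈ C.nil, κ (ρ.dρ X w₀) = X := by
    intro X hX
    have h1 : R.orthogonalProjectionOnto (ρ.dρ X w₀) = e ⟨X, hX⟩ :=
      Submodule.orthogonalProjectionOnto_mem_subspace_eq_self (e ⟨X, hX⟩)
    change ((e.symm (R.orthogonalProjectionOnto (ρ.dρ X w₀)) : C.nil) : G.lie) = X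
    rw [h1, e.symm_apply_apply]
  have hκ0 : ∀ w, κ w = 0 ↔ w ∈ Rᗮ := by
    intro w
    change ((e.symm (R.orthogonalProjectionOnto w) : C.nil) : G.lie) = 0 ↔ _
    rw [ZeroMemClass.coe_eq_zero, LinearEquiv.map_eq_zero_iff,
      Submodule.orthogonalProjectionOnto_eq_zero_iff]
  have hRfil : R ≤ fil (ρ.dρ (G.ofP β)) (β₀ - C.δ) := by
    rintro _ ⟨X, rfl⟩
    rw [sub_eq_neg_add]
    exact dρ_mem_fil X.2 htop
  have hw₀R : w₀ ∈ Rᗮ := by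
    intro u hu
    rw [← inner_conj_symm, hw.inner_eq_zero C (hRfil hu), map_zero]
  have hAR : ∀ X : G.lie, ρ.dρ (G.ofP β) (ρ.dρ X w₀) =
      ρ.dρ (G.ad (G.ofP β) X) w₀ + (β₀ : ℂ) • ρ.dρ X w₀ := by
    intro X
    rw [ρ.dρ_ad, hw.eigen, map_smul, sub_add_cancel]
  -- The symmetric operator of `β` preserves `R = 𝔫 w₀`, hence also `Rᗮ`; the weight of `X w₀` is
  -- that of `X` plus `β₀`.
  have hequiv : ∀ w, G.ad (G.ofP β) (κ w) =
      κ (ρ.dρ (G.ofP β) w) + ((-β₀ : ℝ) : ℂ) • κ w := by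
    intro w
    have hw' : w ∈ R ⊔ Rᗮ := by
      rw [Submodule.sup_orthogonal_of_hasOrthogonalProjection]; trivial
    obtain ⟨_, ⟨X, rfl⟩, q, hq, rfl⟩ := Submodule.mem_sup.1 hw'
    have hAq : ρ.dρ (G.ofP β) q ∈ Rᗮ := by
      rintro _ ⟨Y, rfl⟩
      rw [← ρ.dρ_ofP_isSymmetric β, hι, hAR, inner_add_left, inner_smul_left]
      have h1 := hq _ ⟨⟨G.ad (G.ofP β) Y, map_mem_fil Y.2⟩, rfl⟩
      have h2 := hq _ ⟨Y, rfl⟩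
      rw [hι] at h1 h2
      rw [h1, h2, mul_zero, add_zero]
    rw [map_add, map_add, map_add, map_add, (hκ0 q).2 hq, (hκ0 _).2 hAq, hι, hAR, map_add, map_smul,
      hκR _ X.2, hκR _ (map_mem_fil X.2)]
    have h0 : (β₀ : ℂ) • (X : G.lie) + ((-β₀ : ℝ) : ℂ) • (X : G.lie) = 0 := by
      rw [← add_smul, ← Complex.ofReal_add, add_neg_cancel, Complex.ofReal_zero, zero_smul]
    rw [map_zero, add_zero, add_zero, add_zero, add_assoc, h0, add_zero]
  -- The inclusion of `w₀` itself is where nontriviality of the representation enters.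
  have horb : ρ.lieOrbit w₀ = Submodule.span ℂ {w₀} ⊔ R := by
    apply le_antisymm
    · refine Submodule.span_le.2 ?_
      rintro _ ⟨X, rfl⟩
      refine (sup_le_sup_left (Submodule.span_le.2 ?_) _ : _ ≤ Submodule.span ℂ {w₀} ⊔ R)
        (hw.dρ_mem X)
      rintro _ ⟨Y, b, hb, hY, rfl⟩
      exact ⟨⟨Y, C.gap_lie b Y hb hY⟩, rfl⟩
    · refine sup_le ((Submodule.span_singleton_le_iff_mem _ _).2 hw.mem_lieOrbit) ?_
      rintro _ ⟨X, rfl⟩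
      exact Submodule.subset_span ⟨X, rfl⟩
  have hspan : ∀ w, ℓ w = 0 ↔ w ∈ (Submodule.span ℂ {w₀})ᗮ := fun w => by
    rw [hℓ0, Submodule.mem_orthogonal_singleton_iff_inner_right]
  have hboth : ∀ w, (ℓ w = 0 ∧ κ w = 0) ↔ w ∈ (ρ.lieOrbit w₀)ᗮ := fun w => by
    rw [hspan, hκ0, horb, ← Submodule.inf_orthogonal, Submodule.mem_inf]
  have hsub : ∀ w, w - ℓ w • w₀ ∈ fil (ρ.dρ (G.ofP β)) (β₀ - C.δ) := by
    intro w
    have h1 : w ∈ (⊤ : Submodule ℂ W) := trivial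
    rw [← hw.sup_eq_top] at h1
    obtain ⟨_, hy, x, hx, rfl⟩ := Submodule.mem_sup.1 h1
    obtain ⟨c, rfl⟩ := Submodule.mem_span_singleton.1 hy
    have hx' : x ∈ fil (ρ.dρ (G.ofP β)) (β₀ - C.δ) := by
      refine Submodule.span_le.2 ?_ hx
      rintro x ⟨l, hl, hx⟩
      exact C.gap_rep l x hl hx
    rw [map_add, map_smul, hℓ1, (hℓ0 x).2 (hw.inner_eq_zero C hx'), smul_eq_mul, mul_one, add_zero,
      add_sub_cancel_left]
    exact hx'
  refine ⟨⟨ℓ, κ, hsub, fun w h => (hℓ0 w).2 (hw.inner_eq_zero C h), hspan, htop,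
    fun w => Subtype.prop _, hκR, fun t w h => ?_, fun w => ⟨fun h => ?_, fun h => ?_⟩, hboth⟩⟩
  · rw [sub_eq_add_neg]
    exact fil_map κ (-β₀) hequiv h
  · rw [← add_sub_cancel (ℓ w • w₀) w]
    refine Submodule.add_mem_sup (Submodule.smul_mem _ _ (Submodule.mem_span_singleton_self _))
      ((hboth _).1 ⟨?_, ?_⟩)
    · rw [map_sub, map_smul, hℓ1, smul_eq_mul, mul_one, sub_self]
    · rw [map_sub, map_smul, h, (hκ0 w₀).2 hw₀R, smul_zero, sub_zero]
  · obtain ⟨_, hy, x, hx, rfl⟩ := Submodule.mem_sup.1 h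
    obtain ⟨c, rfl⟩ := Submodule.mem_span_singleton.1 hy
    rw [map_add, map_smul, (hκ0 w₀).2 hw₀R, ((hboth x).2 hx).2, smul_zero, add_zero]

namespace WeightBounds

variable (C : WeightBounds ρ β β₀)

lemma dρ_lowers {X : G.lie} (hX : X ∈ C.nil) : ∀ t, ∀ w ∈ fil (ρ.dρ (G.ofP β)) t,
    ρ.dρ X w ∈ fil (ρ.dρ (G.ofP β)) (t - C.δ) := by
  intro t w hw
  rw [sub_eq_neg_add]
  exact dρ_mem_fil hX hw

end WeightBounds

namespace Slice

variable {C : WeightBounds ρ β β₀} (Sl : Slice C w₀)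

lemma mem_fil_self (Sl : Slice C w₀) (w : W) : w ∈ fil (ρ.dρ (G.ofP β)) β₀ := by
  rw [← sub_add_cancel w (Sl.ℓ w • w₀)]
  exact add_mem (fil_mono _ (by linarith [C.δ_pos]) (Sl.sub_smul_mem w))
    (Submodule.smul_mem _ _ Sl.mem_fil_top)

lemma rep_exp_eq (Sl : Slice C w₀) {X : G.lie} (hX : X ∈ C.nil) (w : W) :
    ρ.rep (G.exp X) w = truncExp (C.K + 2) (ρ.dρ X) w := by
  have h0 : ρ.dρ X ^ (C.K + 2) = 0 := by
    ext w
    have h := fil_mono _ (by push_cast; nlinarith [C.δ_pos] :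
      β₀ - ((C.K + 2 : ℕ) : ℝ) * C.δ ≤ β₀ - C.K * C.δ)
      (pow_mem_fil (C.dρ_lowers hX) (C.K + 2) (Sl.mem_fil_self w))
    rwa [C.bot_rep, Submodule.mem_bot] at h
  have h1 : ρ.dρc X ^ (C.K + 2) = 0 := by
    ext w
    have := LinearMap.congr_fun h0 w
    rw [← ContinuousLinearMap.coe_coe, ContinuousLinearMap.toLinearMap_pow]
    exact this
  rw [ρ.rep_exp, exp_eq_truncExp h1]
  simp only [truncExp, sum_apply, LinearMap.sum_apply]
  refine Finset.sum_congr rfl fun k _ => ?_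
  rw [smul_apply, LinearMap.smul_apply, ← ContinuousLinearMap.coe_coe,
    ContinuousLinearMap.toLinearMap_pow]
  rfl

/-- Elements of `exp 𝔫` change a vector only in levels below `β₀`, where `ℓ` vanishes. -/
lemma ℓ_rep_exp {X : G.lie} (hX : X ∈ C.nil) (w : W) : Sl.ℓ (ρ.rep (G.exp X) w) = Sl.ℓ w := by
  rw [Sl.rep_exp_eq hX, ← sub_eq_zero, ← map_sub]
  exact Sl.ℓ_of_mem _
    (truncExp_sub_one_mem_fil C.δ_pos.le (C.dρ_lowers hX) C.K (Sl.mem_fil_self w))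

/-- The iteration whose fixed point moves `v` into the slice. -/
def step (v : W) (X : G.lie) : G.lie :=
  Sl.κ (truncExp (C.K + 2) (ρ.dρ (-X)) v + ρ.dρ X w₀)

/-- The element of the Lie algebra of `R^{β₋}` whose exponential carries the slice to `v`. -/
def coordinate (v : W) : G.lie := (Sl.step v)^[C.K] 0

lemma isPolynomialMap_coordinate : IsPolynomialMap Sl.coordinate := by
  have h : ∀ k : ℕ, IsPolynomialMap (fun v => (Sl.step v)^[k] 0) := by
    intro k
    induction k with
    | zero => exact isPolynomialMap_const _
    | succ k ih =>
      simp only [Function.iterate_succ_apply', step]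
      exact ((IsPolynomialMap.bilinear LinearMap.id ((ih.neg.linear_comp ρ.dρL).truncExp _)
        isPolynomialMap_id).add (ih.linear_comp (ρ.dρL.flip w₀))).linear_comp Sl.κ
  exact h C.K

/-- As `ℓ v = 1`, `v` is `w₀` plus lower terms, so `-(X - Z) v` cancels `(X - Z) w₀` to leading
order; the nonlinear terms gain `δ` anyway. -/
lemma step_contracts {v : W} (hv : Sl.ℓ v = 1) {X Z : G.lie} (hX : X ∈ C.nil) (hZ : Z ∈ C.nil)
    {c : ℝ} (hXZ : X - Z ∈ fil (G.ad (G.ofP β)) c) :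
    Sl.step v X - Sl.step v Z ∈ fil (G.ad (G.ofP β)) (c - C.δ) := by
  have hneg : ρ.dρ (-X) - ρ.dρ (-Z) = ρ.dρ (-(X - Z)) := by
    simp only [sub_eq_add_neg, neg_add, ρ.dρ_neg, ρ.dρ_add]
  have h1 := truncExp_sub_mem_fil (c := c) C.δ_pos.le (C.dρ_lowers (neg_mem hX))
    (C.dρ_lowers (neg_mem hZ)) (fun t w hw => by
      rw [hneg, add_comm]
      exact dρ_mem_fil (neg_mem hXZ) hw) C.K (Sl.mem_fil_self v)
  have h2 := dρ_mem_fil (ρ := ρ) hXZ (Sl.sub_smul_mem v)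
  have h3 := sub_mem h1 (fil_mono _ (by linarith : c + (β₀ - C.δ) ≤ β₀ + c - C.δ) h2)
  have h4 := Sl.κ_mem_fil _ _ h3
  rw [show β₀ + c - C.δ - β₀ = c - C.δ by ring] at h4
  rw [step, step, ← map_sub]
  convert h4 using 2
  rw [hv, one_smul, hneg]
  simp only [sub_eq_add_neg, ρ.dρ_neg, ρ.dρ_add, LinearMap.add_apply, LinearMap.neg_apply,
    map_add, map_neg]
  abel

lemma iterate_step_eq {v : W} (hv : Sl.ℓ v = 1) {X Z : G.lie} (hX : X ∈ C.nil)
    (hZ : Z ∈ C.nil) : (Sl.step v)^[C.K] X = (Sl.step v)^[C.K] Z :=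
  iterate_eq_of_contracts C.bot_lie C.nil le_rfl _ (fun _ _ => Sl.κ_mem _)
    (fun _ hx _ hy _ h => Sl.step_contracts hv hx hy h) (by nlinarith [C.δ_pos]) hX hZ

lemma step_eq_self_iff {v : W} {X : G.lie} (hX : X ∈ C.nil) :
    Sl.step v X = X ↔ Sl.κ (ρ.rep (G.exp (-X)) v) = 0 := by
  rw [step, map_add, Sl.κ_dρ X hX, add_eq_right, Sl.rep_exp_eq (neg_mem hX)]

lemma coordinate_mem (v : W) : Sl.coordinate v ∈ C.nil := by
  have h : ∀ k : ℕ, (Sl.step v)^[k] 0 ∈ C.nil := by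
    intro k
    cases k with
    | zero => exact zero_mem _
    | succ k =>
      rw [Function.iterate_succ_apply']
      exact Sl.κ_mem _
  exact h C.K

lemma κ_rep_coordinate {v : W} (hv : Sl.ℓ v = 1) :
    Sl.κ (ρ.rep (G.exp (-Sl.coordinate v)) v) = 0 := by
  rw [← Sl.step_eq_self_iff (Sl.coordinate_mem v)]
  rw [coordinate, ← Function.iterate_succ_apply' (Sl.step v), Function.iterate_succ_apply]
  exact Sl.iterate_step_eq hv (Sl.κ_mem _) (zero_mem _)

/-- A solution is a fixed point of the step, so iteration from it is constant, and all starting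
points in `𝔫` agree after `K` steps. -/
lemma coordinate_eq {v : W} (hv : Sl.ℓ v = 1) {X : G.lie} (hX : X ∈ C.nil)
    (h : Sl.κ (ρ.rep (G.exp (-X)) v) = 0) : Sl.coordinate v = X := by
  rw [coordinate, Sl.iterate_step_eq hv (zero_mem _) hX]
  exact Function.iterate_fixed ((Sl.step_eq_self_iff hX).2 h) _

/-- The coordinate of the line spanned by `v`. -/
def lineCoordinate (v : W) : G.lie := Sl.coordinate ((Sl.ℓ v)⁻¹ • v)

lemma lineCoordinate_mem (v : W) : Sl.lineCoordinate v ∈ C.nil := Sl.coordinate_mem _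

lemma ℓ_inv_smul {v : W} (hv : Sl.ℓ v ≠ 0) : Sl.ℓ ((Sl.ℓ v)⁻¹ • v) = 1 := by
  rw [map_smul, smul_eq_mul, inv_mul_cancel₀ hv]

lemma κ_rep_lineCoordinate {v : W} (hv : Sl.ℓ v ≠ 0) :
    Sl.κ (ρ.rep (G.exp (-Sl.lineCoordinate v)) v) = 0 := by
  have h := Sl.κ_rep_coordinate (Sl.ℓ_inv_smul hv)
  rw [map_smul, map_smul] at h
  exact (smul_eq_zero.1 h).resolve_left (inv_ne_zero hv)

/-- The `R^{β₋}`-factor is recovered from the line alone, which yields injectivity of the action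
map. -/
lemma lineCoordinate_rep {X : G.lie} (hX : X ∈ C.nil) {y : W} (hy : Sl.ℓ y ≠ 0)
    (h : Sl.κ y = 0) : Sl.lineCoordinate (ρ.rep (G.exp X) y) = X := by
  have hv : Sl.ℓ (ρ.rep (G.exp X) y) ≠ 0 := by rwa [Sl.ℓ_rep_exp hX]
  refine Sl.coordinate_eq (Sl.ℓ_inv_smul hv) hX ?_
  rw [map_smul, ρ.rep_neg_rep, map_smul, h, smul_zero]

end Slice

end Slice

/-! ### The local structure theorem -/

section LocalStructureTheorem

variable {n : Type*} [Fintype n] [DecidableEq n] {G : ReductiveGroup n}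
  {W : Type*} [NormedAddCommGroup W] [InnerProductSpace ℂ W]

lemma mk_mem_projSet {W : Type*} [AddCommGroup W] [Module ℂ W] (U : Submodule ℂ W) {v : W}
    (hv : v ≠ 0) : Projectivization.mk ℂ v hv ∈ projSet U ↔ v ∈ U := by
  change (Projectivization.mk ℂ v hv).submodule ≤ U ↔ _
  rw [Projectivization.submodule_mk, Submodule.span_singleton_le_iff_mem]

lemma UnitaryRep.rep_ne_zero (ρ : UnitaryRep W G) (g : G.carrier) {v : W} (hv : v ≠ 0) :
    ρ.rep g v ≠ 0 :=
  (map_ne_zero_iff _ (ρ.rep.apply_bijective g).injective).2 hv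

lemma UnitaryRep.act_mk (ρ : UnitaryRep W G) (g : G.carrier) {v : W} (hv : v ≠ 0) :
    ρ.act g (Projectivization.mk ℂ v hv) = Projectivization.mk ℂ (ρ.rep g v) (ρ.rep_ne_zero g hv) :=
  rfl

lemma UnitaryRep.act_injective (ρ : UnitaryRep W G) (g : G.carrier) :
    Function.Injective (ρ.act g) :=
  Projectivization.map_injective _ (ρ.rep.apply_bijective g).injective

variable [FiniteDimensional ℂ W] {ρ : UnitaryRep W G} {β : G.𝔭} {β₀ : ℝ} {w₀ : W}
  {C : WeightBounds ρ β β₀} (Sl : Slice C w₀) {S T : Set (ℙ ℂ W)}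

namespace Slice

/-- The action of `R^{β₋}` on the slice. -/
def actionMap (hS : ∀ v hv, Projectivization.mk ℂ v hv ∈ S ↔ Sl.κ v = 0 ∧ Sl.ℓ v ≠ 0)
    (hT : ∀ v hv, Projectivization.mk ℂ v hv ∈ T ↔ Sl.ℓ v ≠ 0) (p : G.Rminus β × S) : T :=
  ⟨ρ.act p.1 p.2, by
    obtain ⟨⟨r, hr⟩, ⟨x, hx⟩⟩ := p
    obtain ⟨X, hX, rfl, -⟩ := C.exists_log hr
    induction x using Projectivization.ind with
    | h v hv =>
      rw [ρ.act_mk, hT, Sl.ℓ_rep_exp hX]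
      exact ((hS v hv).1 hx).2⟩

lemma actionMap_injective
    (hS : ∀ v hv, Projectivization.mk ℂ v hv ∈ S ↔ Sl.κ v = 0 ∧ Sl.ℓ v ≠ 0)
    (hT : ∀ v hv, Projectivization.mk ℂ v hv ∈ T ↔ Sl.ℓ v ≠ 0) :
    Function.Injective (Sl.actionMap hS hT) := by
  rintro ⟨⟨r, hr⟩, ⟨x, hx⟩⟩ ⟨⟨r', hr'⟩, ⟨x', hx'⟩⟩ h
  replace h : ρ.act r x = ρ.act r' x' := congrArg Subtype.val h
  suffices hrr : r = r' by
    subst hrr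
    obtain rfl := ρ.act_injective r h
    rfl
  obtain ⟨X, hX, rfl, -⟩ := C.exists_log hr
  obtain ⟨X', hX', rfl, -⟩ := C.exists_log hr'
  induction x using Projectivization.ind with
  | h y hy =>
  induction x' using Projectivization.ind with
  | h y' hy' =>
    obtain ⟨h1, h2⟩ := (hS y hy).1 hx
    obtain ⟨h1', h2'⟩ := (hS y' hy').1 hx'
    rw [ρ.act_mk, ρ.act_mk, Projectivization.mk_eq_mk_iff'] at h
    obtain ⟨c, hc⟩ := h
    rw [← map_smul] at hc
    have hℓ : Sl.ℓ (c • y') ≠ 0 := by rwa [← Sl.ℓ_rep_exp hX', hc, Sl.ℓ_rep_exp hX]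
    have hκ : Sl.κ (c • y') = 0 := by rw [map_smul, h1', smul_zero]
    rw [← Sl.lineCoordinate_rep hX h2 h1, ← Sl.lineCoordinate_rep hX' hℓ hκ, hc]

lemma rep_lineCoordinate_mem
    (hS : ∀ v hv, Projectivization.mk ℂ v hv ∈ S ↔ Sl.κ v = 0 ∧ Sl.ℓ v ≠ 0)
    {v : W} (hv : v ≠ 0) (hℓ : Sl.ℓ v ≠ 0) :
    Projectivization.mk ℂ (ρ.rep (G.exp (-Sl.lineCoordinate v)) v) (ρ.rep_ne_zero _ hv) ∈ S := by
  rw [hS, Sl.ℓ_rep_exp (neg_mem (Sl.lineCoordinate_mem v))]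
  exact ⟨Sl.κ_rep_lineCoordinate hℓ, hℓ⟩

lemma actionMap_lineCoordinate
    (hS : ∀ v hv, Projectivization.mk ℂ v hv ∈ S ↔ Sl.κ v = 0 ∧ Sl.ℓ v ≠ 0)
    (hT : ∀ v hv, Projectivization.mk ℂ v hv ∈ T ↔ Sl.ℓ v ≠ 0)
    {v : W} (hv : v ≠ 0) (hℓ : Sl.ℓ v ≠ 0) :
    Sl.actionMap hS hT (⟨G.exp (Sl.lineCoordinate v), C.exp_mem_Rminus (Sl.lineCoordinate_mem v)⟩,
      ⟨_, Sl.rep_lineCoordinate_mem hS hv hℓ⟩) = ⟨Projectivization.mk ℂ v hv, (hT v hv).2 hℓ⟩ := by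
  apply Subtype.ext
  change ρ.act _ (Projectivization.mk ℂ _ _) = _
  rw [ρ.act_mk]
  congr 1
  exact ρ.rep_rep_neg _ v

/-- The action of `R^{β₋}` on the slice, as a bijection. -/
def actionEquiv (hS : ∀ v hv, Projectivization.mk ℂ v hv ∈ S ↔ Sl.κ v = 0 ∧ Sl.ℓ v ≠ 0)
    (hT : ∀ v hv, Projectivization.mk ℂ v hv ∈ T ↔ Sl.ℓ v ≠ 0) : G.Rminus β × S ≃ T :=
  Equiv.ofBijective (Sl.actionMap hS hT) ⟨Sl.actionMap_injective hS hT, by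
    rintro ⟨x, hx⟩
    induction x using Projectivization.ind with
    | h v hv => exact ⟨_, Sl.actionMap_lineCoordinate hS hT hv ((hT v hv).1 hx)⟩⟩

/-- The representation is only assumed holomorphic. On `R^{β₋}` it is algebraic, because `r` acts as
the truncated exponential of the derived action of its polynomial logarithm. -/
lemma isRegularMap_actionEquiv
    (hS : ∀ v hv, Projectivization.mk ℂ v hv ∈ S ↔ Sl.κ v = 0 ∧ Sl.ℓ v ≠ 0)
    (hT : ∀ v hv, Projectivization.mk ℂ v hv ∈ T ↔ Sl.ℓ v ≠ 0) :
    IsRegularMap (prodCoord (G.Rminus β) S) (projCoord T) (Sl.actionEquiv hS hT) := by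
  -- A linear projection onto `𝔤` lets the derived representation follow `log` on all matrices.
  obtain ⟨P, hP⟩ := G.lie.subtype.exists_leftInverse_of_injective G.lie.ker_subtype
  let F : (n → n → ℂ) × W → Module.End ℂ W := fun z =>
    truncExp (C.K + 2) (ρ.dρ (P (C.log (Matrix.ofLinearEquiv ℂ z.1))))
  have hF : IsPolynomialMap F :=
    ((((C.isPolynomialMap_log.comp (isPolynomialMap_linear
      ((Matrix.ofLinearEquiv ℂ : (n → n → ℂ) ≃ₗ[ℂ] Matrix n n ℂ).toLinearMap ∘ₗ
        LinearMap.fst ℂ (n → n → ℂ) W))).linear_comp P).linear_comp ρ.dρL).truncExp _)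
  have hval : ∀ (q : G.Rminus β × S) a v hv,
      prodCoord (G.Rminus β) S q = (a, Projectivization.mk ℂ v hv) →
      F (a, v) v = ρ.rep q.1 v ∧ (q.2 : ℙ ℂ W) = Projectivization.mk ℂ v hv := by
    rintro ⟨⟨r, hr⟩, x⟩ a v hv h
    obtain ⟨X, hX, rfl, hlog⟩ := C.exists_log hr
    have ha : Matrix.ofLinearEquiv ℂ a =
        (((G.exp X : G.carrier) : Matrix.GeneralLinearGroup n ℂ) : Matrix n n ℂ) :=
      (congrArg Prod.fst h).symm
    refine ⟨?_, congrArg Prod.snd h⟩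
    have hPX : P (X : Matrix n n ℂ) = X := LinearMap.congr_fun hP X
    simp only [F, ha, hlog, hPX]
    exact (Sl.rep_exp_eq hX v).symm
  have hsnd : IsPolynomialMap (fun z : (n → n → ℂ) × W => z.2) :=
    isPolynomialMap_linear (LinearMap.snd ℂ (n → n → ℂ) W)
  intro p
  refine ⟨0, 1, fun _ => PUnit.unit, fun _ => 1, fun z => F z z.2, isPolynomialMap_const _,
    isPolynomialMap_const _, IsPolynomialMap.bilinear LinearMap.id hF hsnd, fun _ _ _ => rfl, fun _ _ _ => by simp,
    fun a c v => by simp [F], fun a v hv h => ⟨one_ne_zero, ?_⟩, fun q a v hv h _ hL0 => ?_⟩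
  · change F (a, v) v ≠ 0
    rw [(hval p a v hv h).1]
    exact ρ.rep_ne_zero _ hv
  · obtain ⟨h1, h2⟩ := hval q a v hv h
    refine Prod.ext rfl ?_
    change ρ.act q.1 q.2 = _
    rw [h2, ρ.act_mk]
    congr 1
    exact h1.symm

/-- On the chart `ℓ = 1` the inverse is `v ↦ (exp X, exp(-X) v)` with `X = coordinate v`, a
polynomial map. Homogenizing by `ℓ` gives one formula on all of `T`, with denominator a power of
`ℓ`. -/
lemma isRegularMap_actionEquiv_symm
    (hS : ∀ v hv, Projectivization.mk ℂ v hv ∈ S ↔ Sl.κ v = 0 ∧ Sl.ℓ v ≠ 0)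
    (hT : ∀ v hv, Projectivization.mk ℂ v hv ∈ T ↔ Sl.ℓ v ≠ 0) :
    IsRegularMap (projCoord T) (prodCoord (G.Rminus β) S) (Sl.actionEquiv hS hT).symm := by
  have hP₁ : IsPolynomialMap (fun v : W => (Matrix.ofLinearEquiv ℂ).symm
      (truncExp (C.K + 2) (Sl.coordinate v : Matrix n n ℂ))) :=
    IsPolynomialMap.linear_comp (Matrix.ofLinearEquiv ℂ).symm.toLinearMap
      ((Sl.isPolynomialMap_coordinate.linear_comp G.lie.subtype).truncExp _)
  have hP₂ : IsPolynomialMap (fun v : W => truncExp (C.K + 2) (ρ.dρ (-Sl.coordinate v)) v) :=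
    IsPolynomialMap.bilinear LinearMap.id
      ((Sl.isPolynomialMap_coordinate.neg.linear_comp ρ.dρL).truncExp _) isPolynomialMap_id
  obtain ⟨d, h₁⟩ := exists_homogenization Sl.ℓ hP₁
  obtain ⟨e, h₂⟩ := exists_homogenization Sl.ℓ hP₂
  obtain ⟨N, hN, hN', hN''⟩ := h₁ d le_rfl
  obtain ⟨L, hL, hL', hL''⟩ := h₂ e le_rfl
  have hsnd : IsPolynomialMap (fun z : PUnit.{1} × W => z.2) :=
    isPolynomialMap_linear (LinearMap.snd ℂ PUnit.{1} W)
  have hNv : ∀ v, Sl.ℓ v ≠ 0 → (Sl.ℓ v ^ d)⁻¹ • N v = fun a b =>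
      (((G.exp (Sl.lineCoordinate v) : G.carrier) : Matrix.GeneralLinearGroup n ℂ) :
        Matrix n n ℂ) a b := by
    intro v hv
    rw [hN'' v hv, inv_smul_smul₀ (pow_ne_zero _ hv), ← C.exp_mat_eq
      (WeightBounds.coe_mem_fil (Sl.coordinate_mem _))]
    rfl
  have hLv : ∀ v, Sl.ℓ v ≠ 0 →
      L v = (Sl.ℓ v ^ e * (Sl.ℓ v)⁻¹) • ρ.rep (G.exp (-Sl.lineCoordinate v)) v := by
    intro v hv
    rw [hL'' v hv, ← Sl.rep_exp_eq (neg_mem (Sl.coordinate_mem _)), map_smul, smul_smul]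
    rfl
  intro p
  have hp : ∀ (q : T) a v hv, projCoord T q = (a, Projectivization.mk ℂ v hv) →
      (q : ℙ ℂ W) = Projectivization.mk ℂ v hv ∧ Sl.ℓ v ≠ 0 := by
    intro q a v hv h
    have h1 : (q : ℙ ℂ W) = Projectivization.mk ℂ v hv := congrArg Prod.snd h
    exact ⟨h1, (hT v hv).1 (h1 ▸ q.2)⟩
  refine ⟨d, e, fun z => N z.2, fun z => Sl.ℓ z.2 ^ d, fun z => L z.2, hN.comp hsnd,
    (hsnd.linear_comp Sl.ℓ).pow d, hL.comp hsnd, fun _ c v => hN' c v,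
    fun _ c v => by simp [mul_pow], fun _ c v => hL' c v, fun a v hv h => ?_,
    fun q a v hv h _ hL0 => ?_⟩
  · obtain ⟨-, hℓ⟩ := hp p a v hv h
    refine ⟨pow_ne_zero _ hℓ, ?_⟩
    change L v ≠ 0
    rw [hLv v hℓ]
    exact smul_ne_zero (mul_ne_zero (pow_ne_zero _ hℓ) (inv_ne_zero hℓ)) (ρ.rep_ne_zero _ hv)
  · obtain ⟨hq, hℓ⟩ := hp q a v hv h
    have hqs : (Sl.actionEquiv hS hT).symm q =
        (⟨G.exp (Sl.lineCoordinate v), C.exp_mem_Rminus (Sl.lineCoordinate_mem v)⟩,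
          ⟨_, Sl.rep_lineCoordinate_mem hS hv hℓ⟩) := by
      rw [Equiv.symm_apply_eq]
      exact (Subtype.ext hq).trans (Sl.actionMap_lineCoordinate hS hT hv hℓ).symm
    rw [hqs]
    refine Prod.ext (hNv v hℓ).symm ?_
    change Projectivization.mk ℂ _ _ = Projectivization.mk ℂ _ _
    rw [Projectivization.mk_eq_mk_iff']
    refine ⟨(Sl.ℓ v ^ e * (Sl.ℓ v)⁻¹)⁻¹, ?_⟩
    change _ • L v = _
    rw [hLv v hℓ, inv_smul_smul₀ (mul_ne_zero (pow_ne_zero _ hℓ) (inv_ne_zero hℓ))]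

end Slice

end LocalStructureTheorem

end LocalStructure

end

open LocalStructure in
theorem theorem7 {n : Type*} [Fintype n] [DecidableEq n] (G : ReductiveGroup n)
    {W : Type*} [NormedAddCommGroup W] [InnerProductSpace ℂ W] [FiniteDimensional ℂ W]
    (ρ : UnitaryRep W G) (hirr : ρ.rep.IsIrreducible) (hnontriv : ∃ g w, ρ.rep g w ≠ w)
    (B : LinearMap.BilinForm ℝ G.𝔭) (hB : G.IsInvariantInner B)
    (s : ℝ) (hs : 0 < s) (μ : ℙ ℂ W → G.𝔭) (hμ : ρ.IsMomentumMap s B μ)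
    (β : G.𝔭) (hβ : β ∈ (convexHull ℝ (Set.range μ)).extremePoints ℝ)
    (β₀ : ℝ)
    (hβ₀ : IsGreatest {t : ℝ | (ρ.dρ (G.ofP β)).HasEigenvalue (t : ℂ)} β₀)
    (Wβ₀ : Submodule ℂ W) (hWβ₀ : Wβ₀ = (ρ.dρ (G.ofP β)).eigenspace (β₀ : ℂ))
    (w₀ : W) (hw₀ : w₀ ∈ Wβ₀) (hw₀' : w₀ ≠ 0)
    (S T : Set (ℙ ℂ W))
    (hS : S = projSet (Wβ₀ ⊔ (ρ.lieOrbit w₀)ᗮ) \ projSet (ρ.lieOrbit w₀)ᗮ)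
    (hT : T = Set.univ \ projSet Wβ₀ᗮ) :
    Wβ₀ = Submodule.span ℂ {w₀} ∧
    UnitaryRep.maxSet B μ β = {Projectivization.mk ℂ w₀ hw₀'} ∧
    ∃ Φ : G.Rminus β × S ≃ T,
      (∀ r x, (Φ (r, x) : ℙ ℂ W) = ρ.act r x) ∧
      IsRegularMap (prodCoord (G.Rminus β) S) (projCoord T) Φ ∧
      IsRegularMap (projCoord T) (prodCoord (G.Rminus β) S) Φ.symm ∧
      IsHolomorphicMap (prodCoord (G.Rminus β) S) (projCoord T) Φ ∧
      IsHolomorphicMap (projCoord T) (prodCoord (G.Rminus β) S) Φ.symm := by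
  have hw₀e : ρ.dρ (G.ofP β) w₀ = (β₀ : ℂ) • w₀ := by
    rwa [hWβ₀, Module.End.mem_eigenspace_iff] at hw₀
  have hw := UnitaryRep.isHighestWeight_of_extreme hirr hnontriv hB hs hμ hβ hβ₀ hw₀e hw₀'
  have hspan : Wβ₀ = Submodule.span ℂ {w₀} := by
    apply le_antisymm
    · intro w h
      rw [hWβ₀, Module.End.mem_eigenspace_iff] at h
      exact hw.mem_span w h
    · exact (Submodule.span_singleton_le_iff_mem _ _).2 hw₀
  obtain ⟨C⟩ := nonempty_weightBounds ρ β β₀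
  obtain ⟨Sl⟩ := hw.nonempty_slice C
  -- Where `κ = 0`, lying outside `(𝔤 w₀)ᗮ` amounts to `ℓ ≠ 0`.
  have hS' : ∀ v hv, Projectivization.mk ℂ v hv ∈ S ↔ Sl.κ v = 0 ∧ Sl.ℓ v ≠ 0 := by
    intro v hv
    rw [hS, hspan, Set.mem_sdiff, mk_mem_projSet, mk_mem_projSet, ← Sl.κ_eq_zero_iff,
      ← Sl.ℓ_κ_eq_zero_iff]
    tauto
  have hT' : ∀ v hv, Projectivization.mk ℂ v hv ∈ T ↔ Sl.ℓ v ≠ 0 := by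
    intro v hv
    rw [hT, hspan, Set.mem_sdiff, mk_mem_projSet, ← Sl.ℓ_eq_zero_iff]
    simp
  have h₁ := Sl.isRegularMap_actionEquiv hS' hT'
  have h₂ := Sl.isRegularMap_actionEquiv_symm hS' hT'
  exact ⟨hspan, UnitaryRep.maxSet_eq hs hμ hβ₀ hw, Sl.actionEquiv hS' hT', fun _ _ => rfl,
    h₁, h₂, h₁.isHolomorphicMap, h₂.isHolomorphicMap⟩
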